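/- Let $k$ be a field, $V$ an $n$-dimensional $k$-vector space with basis $v_1,\dots,v_n$ and dual basis $\theta_1,\dots,\theta_n$ of $V^*$. Let $m\ge N\ge 2$ and $d$ be integers. A *preregular form* on a finite-dimensional space $Z$ is an $m$-linear form $t:Z^m\to k$ together with $\varphi\in GL(Z)$ such that $t(z_1,\dots,z_{m-1},x)=t(\varphi x,z_1,\dots,z_{m-1})$ for all $z_i,x\in Z$, and such that $t(x,z_1,\dots,z_{m-1})=0$ for all $z_i$ implies $x=0$. Let $\mathsf e$ be a preregular form on $V$ and $\mathsf f$ a preregular form on $V^*$; write $\mathsf e_{i_1\cdots i_m}=\mathsf e(v_{i_1},\dots,v_{i_m})$ and $\mathsf f_{i_1\cdots i_m}=\mathsf f(\theta_{i_1},\dots,\theta_{i_m})$. **Superpotential algebras.** $A(\mathsf e,N)$ is the graded algebra $k\langle x_1,\dots,x_n\rangle$ ($\deg x_i=1$) modulo the relations $\sum_{j_1,\dots,j_N}\mathsf e_{i_1\cdots i_{m-N}j_1\cdots j_N}x_{j_1}\cdots x_{j_N}=0$ for all $i_1,\dots,i_{m-N}$. $A(\mathsf f,N)$ is defined in the same way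 from $\mathsf f$, with generators $y_1,\dots,y_n$. **Hopf algebras.** $\mathcal H(\mathsf e)$ is the algebra generated by $a_{ij},b_{ij}$ ($1\le i,j\le n$) and $\mathsf D_{\mathsf e}^{\pm1}$ subject to $$\sum_{i_1,\dots,i_m}\mathsf e_{i_1\cdots i_m}a_{i_1j_1}\cdots a_{i_mj_m}=\mathsf e_{j_1\cdots j_m}\mathsf D_{\mathsf e},\qquad \sum_{i_1,\dots,i_m}\mathsf e_{i_1\cdots i_m}b_{i_mj_m}\cdots b_{i_1j_1}=\mathsf e_{j_1\cdots j_m}\mathsf D_{\mathsf e}^{-1},$$ $$\mathsf D_{\mathsf e}\mathsf D_{\mathsf e}^{-1}=\mathsf D_{\mathsf e}^{-1}\mathsf D_{\mathsf e}=1,\qquad \mathbb A\mathbb B=\mathbb I ,$$ where $\mathbb A=(a_{ij})$ and $\mathbb B=(b_{ij})$. $\mathcal H(\mathsf f)$ is the algebra generated by $a_{ij},b_{ij}$ and $\mathsf D_{\mathsf f}^{\pm1}$ subject to $$\sum_{i_1,\dots,i_m}\mathsf f_{i_1\cdots i_m}a_{j_1i_1}\cdots a_{j_mi_m}=\mathsf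 f_{j_1\cdots j_m}\mathsf D_{\mathsf f}^{-1},\qquad \sum_{i_1,\dots,i_m}\mathsf f_{i_1\cdots i_m}b_{j_mi_m}\cdots b_{j_1i_1}=\mathsf f_{j_1\cdots j_m}\mathsf D_{\mathsf f},$$ $$\mathsf D_{\mathsf f}\mathsf D_{\mathsf f}^{-1}=\mathsf D_{\mathsf f}^{-1}\mathsf D_{\mathsf f}=1,\qquad \mathbb B\mathbb A=\mathbb I .$$ Both are Hopf algebras with $\Delta(a_{ij})=\sum_l a_{il}\otimes a_{lj}$, $\Delta(b_{ij})=\sum_l b_{lj}\otimes b_{il}$, $\varepsilon(a_{ij})=\varepsilon(b_{ij})=\delta_{ij}$, $\mathsf D^{\pm1}$ grouplike, and antipode with $S(\mathbb A)=\mathbb B$. Let $\mathcal S(\mathsf e)=\mathcal H(\mathsf e)/(\mathsf D_{\mathsf e}-1)$ and $\mathcal S(\mathsf f)=\mathcal H(\mathsf f)/(\mathsf D_{\mathsf f}-1)$ be the quotient Hopf algebras. **Coactions.** A left (right) coaction of a Hopf algebra $K$ on a graded algebra $A$ is a structure of left (right) $K$-comodule algebra on $A$ that preserves the grading. If $A$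 is Artin–Schelter (AS) regular of global dimension $d$, such a coaction induces a coaction on the one-dimensional space $\mathrm{Ext}^d_A(k,k)$, which is given by a grouplike element of $K$, the *homological codeterminant*; it is *trivial* if this element is $1$. **Assumptions.** Let $\nu_N(2i)=Ni$ and $\nu_N(2i+1)=Ni+1$, and assume that $\nu_N(d)=m$ (so $m=d$ if $N=2$). In (a) assume that $A(\mathsf e,N)$, and in (b) that $A(\mathsf f,N)$, is AS regular of global dimension $d$ and $N$-Koszul (that is, $\mathrm{Tor}_i(k,k)$ is concentrated in internal degree $\nu_N(i)$ for every $i$). **Theorem.** (a) There is a left coaction $\rho$ of $\mathcal H(\mathsf e)$ on $A(\mathsf e,N)$ with $\rho(x_i)=\sum_j a_{ij}\otimes x_j$, and it is universal: for every Hopf algebra $K$ and every left coaction $\rho_K$ of $K$ on $A(\mathsf e,N)$ there is a unique Hopf algebra map $\phi:\mathcal H(\mathsf e)\to K$ with $(\phi\otimes\mathrm{id})\circ\rho=\rho_K$. Likewise there is a left coaction $\rho$ of $\mathcal S(\mathsf e)$ on $A(\mathsf e,N)$ with $\rho(x_i)=\sum_j a_{ij}\otimes x_j$; it has trivial homological codeterminant,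 and for every Hopf algebra $K$ and every left coaction $\rho_K$ of $K$ on $A(\mathsf e,N)$ with trivial homological codeterminant there is a unique Hopf algebra map $\phi:\mathcal S(\mathsf e)\to K$ with $(\phi\otimes\mathrm{id})\circ\rho=\rho_K$. In other words, $\mathcal H(\mathsf e)=\mathcal O_{A(\mathsf e,N)}(GL)$ and $\mathcal S(\mathsf e)=\mathcal O_{A(\mathsf e,N)}(SL)$. (b) There is a right coaction $\rho$ of $\mathcal H(\mathsf f)$ on $A(\mathsf f,N)$ with $\rho(y_j)=\sum_i y_i\otimes a_{ij}$, and it is universal among all right coactions of Hopf algebras on $A(\mathsf f,N)$: each $\rho_K$ equals $(\mathrm{id}\otimes\phi)\circ\rho$ for a unique Hopf algebra map $\phi:\mathcal H(\mathsf f)\to K$. There is a right coaction of $\mathcal S(\mathsf f)$ on $A(\mathsf f,N)$ given by the same formula; it has trivial homological codeterminant and is universal, in the same sense, among the right coactions of Hopf algebras on $A(\mathsf f,N)$ with trivial homological codeterminant. In other words, $\mathcal H(\mathsf f)=\mathcal O_{A(\mathsf f,N)}(GL)$ and $\mathcal S(\mathsf f)=\mathcal O_{A(\mathsf f,N)}(SL)$.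 -/

import Mathlib

open scoped TensorProduct
open CategoryTheory

universe u v w w'

namespace PreregularQuantumGroup

/-! ### Preregular forms -/

/-- A preregular `(r + 1)`-linear form `(t, φ)` on a vector space `Z`: it is nondegenerate in its
first argument and `t (z₁, …, z_r, x) = t (φ x, z₁, …, z_r)` with `φ ∈ GL(Z)`. -/
structure PreregularForm (k : Type u) [Field k] (Z : Type v) [AddCommGroup Z] [Module k Z]
    (r : ℕ) where
  form : MultilinearMap k (fun _ : Fin (r + 1) => Z) k
  twist : Z ≃ₗ[k] Z
  nondeg : ∀ x : Z, (∀ z : Fin r → Z, form (Fin.cons x z) = 0) → x = 0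
  cyclic : ∀ (z : Fin r → Z) (x : Z), form (Fin.snoc z x) = form (Fin.cons (twist x) z)

/-- The coefficients `t_{i₁ ⋯ i_m} = t (z_{i₁}, …, z_{i_m})` with respect to a basis. -/
noncomputable def PreregularForm.coeff {k : Type u} [Field k] {Z : Type v} [AddCommGroup Z] [Module k Z]
    {r n : ℕ} (t : PreregularForm k Z r) (b : Module.Basis (Fin n) k Z)
    (I : Fin (r + 1) → Fin n) : k :=
  t.form fun s => b (I s)

/-! ### Products of matrix entries -/

/-- `X_{i₁ j₁} X_{i₂ j₂} ⋯ X_{i_m j_m}`. -/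
def prodPow {R : Type u} [Monoid R] {m n : ℕ} (X : Matrix (Fin n) (Fin n) R)
    (I J : Fin m → Fin n) : R :=
  (List.ofFn fun s => X (I s) (J s)).prod

/-- `X_{i_m j_m} ⋯ X_{i₂ j₂} X_{i₁ j₁}`. -/
def revPow {R : Type u} [Monoid R] {m n : ℕ} (X : Matrix (Fin n) (Fin n) R)
    (I J : Fin m → Fin n) : R :=
  (List.ofFn fun s => X (I s) (J s)).reverse.prod

section Products

variable {m n : ℕ}

theorem sum_cons {M : Type u} [AddCommMonoid M] (F : (Fin (m + 1) → Fin n) → M) :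
    ∑ I, F I = ∑ i, ∑ I : Fin m → Fin n, F (Fin.cons i I) := by
  rw [← Fintype.sum_prod_type' (f := fun i I => F (Fin.cons i I))]
  exact (Fintype.sum_equiv (Fin.consEquiv fun _ => Fin n) _ _ fun _ => rfl).symm

theorem sum_snoc {M : Type u} [AddCommMonoid M] (F : (Fin (m + 1) → Fin n) → M) :
    ∑ I, F I = ∑ i, ∑ I : Fin m → Fin n, F (Fin.snoc I i) := by
  rw [← Fintype.sum_prod_type' (f := fun i I => F (Fin.snoc I i))]
  exact (Fintype.sum_equiv (Fin.snocEquiv fun _ => Fin n) _ _ fun _ => rfl).symm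

section Monoid

variable {R : Type u} [Monoid R] (X : Matrix (Fin n) (Fin n) R)

@[simp] theorem prodPow_zero (I J : Fin 0 → Fin n) : prodPow X I J = 1 := by simp [prodPow]

@[simp] theorem revPow_zero (I J : Fin 0 → Fin n) : revPow X I J = 1 := by simp [revPow]

@[simp] theorem prodPow_cons (i j : Fin n) (I J : Fin m → Fin n) :
    prodPow X (Fin.cons i I : Fin (m + 1) → Fin n) (Fin.cons j J : Fin (m + 1) → Fin n) =
      X i j * prodPow X I J := by
  simp [prodPow, List.ofFn_succ]

@[simp] theorem revPow_cons (i j : Fin n) (I J : Fin m → Fin n) :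
    revPow X (Fin.cons i I : Fin (m + 1) → Fin n) (Fin.cons j J : Fin (m + 1) → Fin n) =
      revPow X I J * X i j := by
  simp [revPow, List.ofFn_succ]

@[simp] theorem prodPow_snoc (i j : Fin n) (I J : Fin m → Fin n) :
    prodPow X (Fin.snoc I i : Fin (m + 1) → Fin n) (Fin.snoc J j : Fin (m + 1) → Fin n) =
      prodPow X I J * X i j := by
  simp [prodPow, List.ofFn_succ', -List.ofFn_succ]

@[simp] theorem revPow_snoc (i j : Fin n) (I J : Fin m → Fin n) :
    revPow X (Fin.snoc I i : Fin (m + 1) → Fin n) (Fin.snoc J j : Fin (m + 1) → Fin n) =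
      X i j * revPow X I J := by
  simp [revPow, List.ofFn_succ', -List.ofFn_succ]

theorem map_prodPow {S : Type v} [Monoid S] {F : Type w} [FunLike F R S] [MonoidHomClass F R S]
    (f : F) (I J : Fin m → Fin n) : f (prodPow X I J) = prodPow (X.map f) I J := by
  simp [prodPow, map_list_prod, List.map_ofFn, Function.comp_def]

theorem map_revPow {S : Type v} [Monoid S] {F : Type w} [FunLike F R S] [MonoidHomClass F R S]
    (f : F) (I J : Fin m → Fin n) : f (revPow X I J) = revPow (X.map f) I J := by
  simp [revPow, map_list_prod, List.map_ofFn, Function.comp_def]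

theorem prodPow_op (I J : Fin m → Fin n) :
    prodPow (X.map MulOpposite.op) I J = MulOpposite.op (revPow X I J) := by
  simp [prodPow, revPow, MulOpposite.op_list_prod, List.map_ofFn, Function.comp_def]

theorem revPow_op (I J : Fin m → Fin n) :
    revPow (X.map MulOpposite.op) I J = MulOpposite.op (prodPow X I J) := by
  simp [prodPow, revPow, MulOpposite.op_list_prod, List.map_ofFn, Function.comp_def]

end Monoid

section Semiring

variable {R : Type u} [Semiring R]

theorem cons_delta (i j : Fin n) (I J : Fin m → Fin n) :
    (if (Fin.cons i I : Fin (m + 1) → Fin n) = Fin.cons j J then (1 : R) else 0) =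
      (if i = j then 1 else 0) * if I = J then 1 else 0 := by
  by_cases h : i = j <;> by_cases h' : I = J <;> simp [Fin.cons_inj, h, h']

theorem snoc_delta (i j : Fin n) (I J : Fin m → Fin n) :
    (if (Fin.snoc I i : Fin (m + 1) → Fin n) = Fin.snoc J j then (1 : R) else 0) =
      (if i = j then 1 else 0) * if I = J then 1 else 0 := by
  by_cases h : i = j <;> by_cases h' : I = J <;> simp [Fin.snoc_inj, h, h']

theorem prodPow_one (I J : Fin m → Fin n) :
    prodPow (1 : Matrix (Fin n) (Fin n) R) I J = if I = J then 1 else 0 := by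
  induction m with
  | zero => simp [Subsingleton.elim I J]
  | succ m ih =>
    refine Fin.consCases (fun i I => ?_) I
    refine Fin.consCases (fun j J => ?_) J
    rw [prodPow_cons, ih, cons_delta, Matrix.one_apply]

theorem revPow_one (I J : Fin m → Fin n) :
    revPow (1 : Matrix (Fin n) (Fin n) R) I J = if I = J then 1 else 0 := by
  induction m with
  | zero => simp [Subsingleton.elim I J]
  | succ m ih =>
    refine Fin.snocCases (fun I i => ?_) I
    refine Fin.snocCases (fun J j => ?_) J
    rw [revPow_snoc, ih, snoc_delta, Matrix.one_apply]

theorem prodPow_mul_revPow {X Y : Matrix (Fin n) (Fin n) R} (h : X * Y = 1)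
    (I J : Fin m → Fin n) :
    ∑ K, prodPow X I K * revPow Y K J = if I = J then 1 else 0 := by
  induction m with
  | zero => simp [Subsingleton.elim I J]
  | succ m ih =>
    refine Fin.snocCases (fun I i => ?_) I
    refine Fin.snocCases (fun J j => ?_) J
    rw [sum_snoc, Finset.sum_comm]
    have h' : ∑ l, X i l * Y l j = if i = j then 1 else 0 := by
      rw [← Matrix.mul_apply, h, Matrix.one_apply]
    have : ∀ K : Fin m → Fin n, ∑ l, prodPow X (Fin.snoc I i : Fin (m + 1) → Fin n) (Fin.snoc K l) *
        revPow Y (Fin.snoc K l : Fin (m + 1) → Fin n) (Fin.snoc J j) =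
        (if i = j then 1 else 0) * (prodPow X I K * revPow Y K J) := by
      intro K
      calc _ = prodPow X I K * (∑ l, X i l * Y l j) * revPow Y K J := by
            simp [Finset.mul_sum, Finset.sum_mul, mul_assoc]
        _ = _ := by rw [h']; split_ifs <;> simp
    rw [Finset.sum_congr rfl fun K _ => this K, ← Finset.mul_sum, ih, snoc_delta]

theorem revPow_mul_prodPow {X Y : Matrix (Fin n) (Fin n) R} (h : X * Y = 1)
    (I J : Fin m → Fin n) :
    ∑ K, revPow X I K * prodPow Y K J = if I = J then 1 else 0 := by
  induction m with
  | zero => simp [Subsingleton.elim I J]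
  | succ m ih =>
    refine Fin.consCases (fun i I => ?_) I
    refine Fin.consCases (fun j J => ?_) J
    rw [sum_cons, Finset.sum_comm]
    have h' : ∑ l, X i l * Y l j = if i = j then 1 else 0 := by
      rw [← Matrix.mul_apply, h, Matrix.one_apply]
    have : ∀ K : Fin m → Fin n, ∑ l, revPow X (Fin.cons i I : Fin (m + 1) → Fin n) (Fin.cons l K) *
        prodPow Y (Fin.cons l K : Fin (m + 1) → Fin n) (Fin.cons j J) =
        (if i = j then 1 else 0) * (revPow X I K * prodPow Y K J) := by
      intro K
      calc _ = revPow X I K * (∑ l, X i l * Y l j) * prodPow Y K J := by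
            simp [Finset.mul_sum, Finset.sum_mul, mul_assoc]
        _ = _ := by rw [h']; split_ifs <;> simp
    rw [Finset.sum_congr rfl fun K _ => this K, ← Finset.mul_sum, ih, cons_delta]

end Semiring

section Tensor

variable {k : Type u} [CommSemiring k] {R S : Type v} [Semiring R] [Semiring S] [Algebra k R]
  [Algebra k S]

theorem prodPow_tensor (X : Matrix (Fin n) (Fin n) R) (Y : Matrix (Fin n) (Fin n) S)
    (I J : Fin m → Fin n) :
    prodPow (Matrix.of fun i j => ∑ l, X i l ⊗ₜ[k] Y l j) I J =
      ∑ K, prodPow X I K ⊗ₜ[k] prodPow Y K J := by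
  induction m with
  | zero => simp [Algebra.TensorProduct.one_def]
  | succ m ih =>
    refine Fin.consCases (fun i I => ?_) I
    refine Fin.consCases (fun j J => ?_) J
    rw [prodPow_cons, ih, sum_cons, Matrix.of_apply, Finset.sum_mul_sum]
    simp [Algebra.TensorProduct.tmul_mul_tmul]

theorem revPow_tensor (X : Matrix (Fin n) (Fin n) R) (Y : Matrix (Fin n) (Fin n) S)
    (I J : Fin m → Fin n) :
    revPow (Matrix.of fun i j => ∑ l, Y l j ⊗ₜ[k] X i l) I J =
      ∑ K, revPow Y K J ⊗ₜ[k] revPow X I K := by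
  induction m with
  | zero => simp [Algebra.TensorProduct.one_def]
  | succ m ih =>
    refine Fin.snocCases (fun I i => ?_) I
    refine Fin.snocCases (fun J j => ?_) J
    rw [revPow_snoc, ih, sum_snoc, Matrix.of_apply, Finset.sum_mul_sum]
    simp [Algebra.TensorProduct.tmul_mul_tmul]

end Tensor

end Products

/-! ### Coefficients of a preregular form -/

namespace PreregularForm

variable {k : Type u} [Field k] {Z : Type v} [AddCommGroup Z] [Module k Z] {r n : ℕ}
  (t : PreregularForm k Z r) (b : Module.Basis (Fin n) k Z)

/-- The matrix of the twist `φ`, with `φ (z_l) = ∑ k, P k l • z_k`. -/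
noncomputable def twistMatrix : Matrix (Fin n) (Fin n) k := LinearMap.toMatrix b b t.twist

/-- The inverse of the matrix of the twist. -/
noncomputable def twistMatrixInv : Matrix (Fin n) (Fin n) k := LinearMap.toMatrix b b t.twist.symm

theorem twistMatrixInv_mul : t.twistMatrixInv b * t.twistMatrix b = 1 := by
  rw [twistMatrix, twistMatrixInv, ← LinearMap.toMatrix_comp b b b]
  simp

theorem twistMatrix_mul_inv : t.twistMatrix b * t.twistMatrixInv b = 1 := by
  rw [twistMatrix, twistMatrixInv, ← LinearMap.toMatrix_comp b b b]
  simp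

theorem form_cons_sum (z : Fin r → Z) (f : Fin n → k) :
    t.form (Fin.cons (∑ i, f i • b i) z) = ∑ i, f i * t.form (Fin.cons (b i) z) := by
  have key : ∀ x : Z, t.form (Fin.cons x z) = t.form.toLinearMap (Fin.cons 0 z) 0 x := by
    intro x
    simp [MultilinearMap.toLinearMap_apply]
  simp only [key, map_sum, map_smul, smul_eq_mul]

theorem basis_cons (i : Fin n) (I : Fin r → Fin n) :
    (fun s => b ((Fin.cons i I : Fin (r + 1) → Fin n) s)) =
      (Fin.cons (b i) (fun s => b (I s)) : Fin (r + 1) → Z) := by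
  funext s
  refine Fin.cases ?_ (fun s => ?_) s <;> simp

theorem basis_snoc (i : Fin n) (I : Fin r → Fin n) :
    (fun s => b ((Fin.snoc I i : Fin (r + 1) → Fin n) s)) =
      (Fin.snoc (fun s => b (I s)) (b i) : Fin (r + 1) → Z) := by
  funext s
  refine Fin.lastCases ?_ (fun s => ?_) s <;> simp

theorem coeff_snoc (I : Fin r → Fin n) (l : Fin n) :
    t.coeff b (Fin.snoc I l) = ∑ i, t.twistMatrix b i l * t.coeff b (Fin.cons i I) := by
  have h : t.twist (b l) = ∑ i, t.twistMatrix b i l • b i := by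
    simp [twistMatrix, LinearMap.toMatrix_apply, b.sum_repr]
  simp only [coeff, basis_cons, basis_snoc, t.cyclic, h, form_cons_sum]

theorem coeff_cons (I : Fin r → Fin n) (i : Fin n) :
    t.coeff b (Fin.cons i I) = ∑ l, t.twistMatrixInv b l i * t.coeff b (Fin.snoc I l) := by
  have h := t.twistMatrix_mul_inv b
  simp only [coeff_snoc, Finset.mul_sum]
  rw [Finset.sum_comm]
  have : ∀ j, ∑ l, t.twistMatrixInv b l i * (t.twistMatrix b j l * t.coeff b (Fin.cons j I)) =
      (if j = i then 1 else 0) * t.coeff b (Fin.cons j I) := by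
    intro j
    rw [← Matrix.one_apply, ← h, Matrix.mul_apply, Finset.sum_mul]
    exact Finset.sum_congr rfl fun l _ => by ring
  simp [this]

theorem exists_polar_right : ∃ p : Fin n → (Fin r → Fin n) → k,
    ∀ i j, ∑ I, t.coeff b (Fin.cons i I) * p j I = if i = j then 1 else 0 := by
  let F : Z →ₗ[k] ((Fin r → Fin n) → k) :=
    b.constr k fun i I => t.coeff b (Fin.cons i I)
  have hF : ∀ x I, F x I = t.form (Fin.cons x fun s => b (I s)) := by
    intro x I
    conv_rhs => rw [← b.sum_repr x, form_cons_sum]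
    simp [F, Module.Basis.constr_apply_fintype, coeff, basis_cons]
  have hker : LinearMap.ker F = ⊥ := by
    rw [LinearMap.ker_eq_bot']
    intro x hx
    apply t.nondeg
    intro z
    have : t.form.curryLeft x = 0 := by
      refine Module.Basis.ext_multilinear (fun _ => b) fun I => ?_
      have := congrFun hx I
      rw [hF] at this
      simpa using this
    simpa using congrArg (fun g => g z) this
  obtain ⟨G, hG⟩ := F.exists_leftInverse_of_injective hker
  refine ⟨fun j I => b.repr (G (Pi.single I 1)) j, fun i j => ?_⟩
  have h1 : G (F (b i)) = b i := LinearMap.congr_fun hG (b i)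
  have h2 : F (b i) = ∑ I, t.coeff b (Fin.cons i I) • (Pi.single I 1 : (Fin r → Fin n) → k) := by
    funext I
    rw [hF]
    simp [coeff, basis_cons, Finset.sum_apply, Pi.single_apply]
  rw [h2] at h1
  have h3 := congrArg (fun y => b.repr y j) h1
  simp only [map_sum, map_smul, Finsupp.coe_finsetSum, Finset.sum_apply, Finsupp.smul_apply,
    smul_eq_mul, Module.Basis.repr_self, Finsupp.single_apply] at h3
  exact h3

theorem exists_polar_left : ∃ p : Fin n → (Fin r → Fin n) → k,
    ∀ i j, ∑ I, p i I * t.coeff b (Fin.snoc I j) = if i = j then 1 else 0 := by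
  obtain ⟨p, hp⟩ := t.exists_polar_right b
  refine ⟨fun i I => ∑ l, t.twistMatrixInv b i l * p l I, fun i j => ?_⟩
  have : ∀ I, (∑ l, t.twistMatrixInv b i l * p l I) * t.coeff b (Fin.snoc I j) =
      ∑ l, ∑ s, t.twistMatrixInv b i l * t.twistMatrix b s j *
        (t.coeff b (Fin.cons s I) * p l I) := by
    intro I
    rw [coeff_snoc, Finset.sum_mul_sum]
    exact Finset.sum_congr rfl fun l _ => Finset.sum_congr rfl fun s _ => by ring
  rw [Finset.sum_congr rfl fun I _ => this I, Finset.sum_comm]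
  have : ∀ l, ∑ I, ∑ s, t.twistMatrixInv b i l * t.twistMatrix b s j *
        (t.coeff b (Fin.cons s I) * p l I) = t.twistMatrixInv b i l * t.twistMatrix b l j := by
    intro l
    rw [Finset.sum_comm]
    simp [← Finset.mul_sum, hp]
  rw [Finset.sum_congr rfl fun l _ => this l, ← Matrix.mul_apply, twistMatrixInv_mul,
    Matrix.one_apply]

end PreregularForm

/-! ### The defining relations of `H(e)` and `H(f)` in an arbitrary algebra -/

/-- The relations of `H(e)`, for matrices `α`, `β` and elements `g`, `g'` of an algebra:
`∑ e_I α_{i₁j₁} ⋯ α_{i_m j_m} = e_J g`, `∑ e_I β_{i_m j_m} ⋯ β_{i₁j₁} = e_J g'`,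
`g g' = g' g = 1` and `α β = 1`. -/
structure LeftRelations {k : Type u} [Field k] {m n : ℕ} (c : (Fin m → Fin n) → k) {K : Type w}
    [Ring K] [Algebra k K] (α β : Matrix (Fin n) (Fin n) K) (g g' : K) : Prop where
  rel : ∀ J, ∑ I, c I • prodPow α I J = c J • g
  rel' : ∀ J, ∑ I, c I • revPow β I J = c J • g'
  mul_inv : g * g' = 1
  inv_mul : g' * g = 1
  mul_eq_one : α * β = 1

/-- The relations of `H(f)`, for matrices `α`, `β` and elements `g`, `g'` of an algebra:
`∑ f_I α_{j₁i₁} ⋯ α_{j_m i_m} = f_J g'`, `∑ f_I β_{j_m i_m} ⋯ β_{j₁i₁} = f_J g`,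
`g g' = g' g = 1` and `β α = 1`. -/
structure RightRelations {k : Type u} [Field k] {m n : ℕ} (c : (Fin m → Fin n) → k) {K : Type w}
    [Ring K] [Algebra k K] (α β : Matrix (Fin n) (Fin n) K) (g g' : K) : Prop where
  rel : ∀ J, ∑ I, c I • prodPow α J I = c J • g'
  rel' : ∀ J, ∑ I, c I • revPow β J I = c J • g
  mul_inv : g * g' = 1
  inv_mul : g' * g = 1
  mul_eq_one : β * α = 1

section Relations

variable {k : Type u} [Field k] {Z : Type v} [AddCommGroup Z] [Module k Z] {r n : ℕ}
  {t : PreregularForm k Z r} {b : Module.Basis (Fin n) k Z} {K : Type w} [Ring K] [Algebra k K]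
  {α β : Matrix (Fin n) (Fin n) K} {g g' : K}

/-- `g' P⁻¹ α P g`, the image of `β` under the antipode. -/
noncomputable def leftTwist (t : PreregularForm k Z r) (b : Module.Basis (Fin n) k Z)
    (α : Matrix (Fin n) (Fin n) K) (g g' : K) : Matrix (Fin n) (Fin n) K :=
  Matrix.of fun i j => ∑ q, ∑ s,
    (t.twistMatrixInv b i s * t.twistMatrix b q j) • (g' * α s q * g)

/-- `g' Q⁻ᵀ α Qᵀ g`, the image of `β` under the antipode. -/
noncomputable def rightTwist (t : PreregularForm k Z r) (b : Module.Basis (Fin n) k Z)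
    (α : Matrix (Fin n) (Fin n) K) (g g' : K) : Matrix (Fin n) (Fin n) K :=
  Matrix.of fun i j => ∑ q, ∑ s,
    (t.twistMatrixInv b q i * t.twistMatrix b j s) • (g' * α q s * g)

namespace LeftRelations

theorem exists_left_inv (h : LeftRelations (t.coeff b) α β g g') (p : Fin n → (Fin r → Fin n) → k)
    (hp : ∀ i j, ∑ I, p i I * t.coeff b (Fin.snoc I j) = if i = j then 1 else 0) :
    β = Matrix.of fun i j => ∑ L, ∑ M, (p i L * t.coeff b (Fin.snoc M j)) •
      (g' * prodPow α M L) := by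
  symm
  refine left_inv_eq_right_inv ?_ h.mul_eq_one
  ext i j
  rw [Matrix.mul_apply, Matrix.one_apply]
  calc _ = ∑ L, p i L • (g' * ∑ I : Fin (r + 1) → Fin n,
            t.coeff b I • prodPow α I (Fin.snoc L j)) := by
        simp only [sum_snoc, prodPow_snoc, Matrix.of_apply, Finset.sum_mul, Finset.mul_sum,
          Finset.smul_sum, smul_mul_assoc, mul_smul_comm, smul_smul, mul_assoc]
        rw [Finset.sum_comm]
    _ = _ := by
        simp only [h.rel, mul_smul_comm, h.inv_mul, smul_smul, ← Finset.sum_smul, hp]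
        split_ifs <;> simp

theorem inv_mul_eq_one (h : LeftRelations (t.coeff b) α β g g') : β * α = 1 := by
  obtain ⟨p, hp⟩ := t.exists_polar_left b
  rw [h.exists_left_inv p hp]
  ext i j
  rw [Matrix.mul_apply, Matrix.one_apply]
  calc _ = ∑ L, p i L • (g' * ∑ I : Fin (r + 1) → Fin n,
            t.coeff b I • prodPow α I (Fin.snoc L j)) := by
        simp only [sum_snoc, prodPow_snoc, Matrix.of_apply, Finset.sum_mul, Finset.mul_sum,
          Finset.smul_sum, smul_mul_assoc, mul_smul_comm, smul_smul, mul_assoc]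
        rw [Finset.sum_comm]
    _ = _ := by
        simp only [h.rel, mul_smul_comm, h.inv_mul, smul_smul, ← Finset.sum_smul, hp]
        split_ifs <;> simp

theorem twist_mul (h : LeftRelations (t.coeff b) α β g g') : (leftTwist t b α g g').transpose * β.transpose = 1 := by
  obtain ⟨p, hp⟩ := t.exists_polar_left b
  rw [h.exists_left_inv p hp]
  ext j i
  rw [Matrix.mul_apply, Matrix.one_apply]
  have h1 : ∀ s, ∑ l, t.twistMatrixInv b l s • (∑ L, ∑ M, (p i L * t.coeff b (Fin.snoc M l)) •
      (g' * prodPow α M L)) =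
      ∑ L, ∑ M, (p i L * t.coeff b (Fin.cons s M)) • (g' * prodPow α M L) := by
    intro s
    simp only [Finset.smul_sum, smul_smul]
    rw [Finset.sum_comm]
    refine Finset.sum_congr rfl fun L _ => ?_
    rw [Finset.sum_comm]
    refine Finset.sum_congr rfl fun M _ => ?_
    rw [← Finset.sum_smul, t.coeff_cons, Finset.mul_sum]
    congr 1
    exact Finset.sum_congr rfl fun l _ => by ring
  have h2 : ∀ q, ∑ s, α s q * g * (∑ L, ∑ M, (p i L * t.coeff b (Fin.cons s M)) •
      (g' * prodPow α M L)) = ∑ L, (p i L * t.coeff b (Fin.cons q L)) • g := by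
    intro q
    calc _ = ∑ L, p i L • ∑ I : Fin (r + 1) → Fin n,
              t.coeff b I • prodPow α I (Fin.cons q L) := by
          simp only [sum_cons, prodPow_cons, Finset.mul_sum, Finset.smul_sum, mul_smul_comm,
            smul_smul]
          rw [Finset.sum_comm]
          refine Finset.sum_congr rfl fun L _ => Finset.sum_congr rfl fun s _ =>
            Finset.sum_congr rfl fun M _ => ?_
          rw [mul_assoc (α s q), ← mul_assoc g, h.mul_inv, one_mul]
      _ = _ := by simp only [h.rel, smul_smul]
  calc _ = ∑ q, t.twistMatrix b q j • (g' * ∑ s, α s q * g *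
          ∑ l, t.twistMatrixInv b l s • (∑ L, ∑ M, (p i L * t.coeff b (Fin.snoc M l)) •
            (g' * prodPow α M L))) := by
        simp only [Matrix.transpose_apply, Matrix.of_apply, leftTwist, Finset.sum_mul]
        rw [Finset.sum_comm]
        refine Finset.sum_congr rfl fun q _ => ?_
        rw [Finset.sum_comm]
        rw [Finset.mul_sum, Finset.smul_sum]
        refine Finset.sum_congr rfl fun s _ => ?_
        rw [Finset.mul_sum, Finset.mul_sum, Finset.smul_sum]
        refine Finset.sum_congr rfl fun l _ => ?_
        rw [smul_mul_assoc, mul_smul_comm, mul_smul_comm, smul_smul, mul_comm (t.twistMatrix b q j)]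
        simp only [mul_assoc]
    _ = ∑ q, t.twistMatrix b q j • (g' * ∑ L, (p i L * t.coeff b (Fin.cons q L)) • g) := by
        simp only [h1, h2]
    _ = (∑ L, p i L * t.coeff b (Fin.snoc L j)) • (1 : K) := by
        simp only [Finset.mul_sum, mul_smul_comm, h.inv_mul, Finset.smul_sum, smul_smul,
          t.coeff_snoc]
        rw [Finset.sum_comm, Finset.sum_smul]
        refine Finset.sum_congr rfl fun L _ => ?_
        rw [Finset.sum_smul]
        exact Finset.sum_congr rfl fun q _ => by ring_nf
    _ = _ := by
        rw [hp]
        rcases eq_or_ne i j with rfl | hij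
        · simp
        · simp [hij, hij.symm]

theorem mul_twist (h : LeftRelations (t.coeff b) α β g g') : β.transpose * (leftTwist t b α g g').transpose = 1 := by
  obtain ⟨p, hp⟩ := t.exists_polar_left b
  have key : β.transpose * (Matrix.of fun j i => ∑ L, ∑ M, (p i L * t.coeff b (Fin.snoc M j)) •
      (revPow β M L * g)) = 1 := by
    ext j i
    rw [Matrix.mul_apply, Matrix.one_apply]
    calc _ = ∑ L, p i L • ((∑ I : Fin (r + 1) → Fin n,
              t.coeff b I • revPow β I (Fin.snoc L j)) * g) := by
          simp only [sum_snoc, revPow_snoc, Matrix.of_apply, Finset.sum_mul, Finset.mul_sum,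
            Finset.smul_sum, smul_mul_assoc, mul_smul_comm, smul_smul, mul_assoc,
            Matrix.transpose_apply]
          rw [Finset.sum_comm]
      _ = _ := by
          simp only [h.rel', smul_mul_assoc, h.inv_mul, smul_smul, ← Finset.sum_smul, hp]
          rcases eq_or_ne i j with rfl | hij
          · simp
          · simp [hij, hij.symm]
  rw [left_inv_eq_right_inv h.twist_mul key]
  exact key

theorem twist_rel (h : LeftRelations (t.coeff b) α β g g') (J : Fin (r + 1) → Fin n) :
    ∑ I, t.coeff b I • prodPow (leftTwist t b α g g') I J = t.coeff b J • g := by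
  have h1 : ∀ I, t.coeff b I • (1 : K) = (∑ M, t.coeff b M • revPow β M I) * g := by
    intro I
    rw [h.rel', smul_mul_assoc, h.inv_mul]
  calc _ = ∑ I, ∑ M, prodPow (leftTwist t b α g g') I J * (t.coeff b M • revPow β M I) * g := by
        refine Finset.sum_congr rfl fun I _ => ?_
        rw [← Finset.sum_mul, ← Finset.mul_sum, mul_assoc, ← h1, mul_smul_comm, mul_one]
    _ = ∑ M, (t.coeff b M • ∑ I, prodPow (leftTwist t b α g g').transpose J I *
          revPow β.transpose I M) * g := by
        rw [Finset.sum_comm]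
        refine Finset.sum_congr rfl fun M _ => ?_
        rw [Finset.smul_sum, Finset.sum_mul]
        refine Finset.sum_congr rfl fun I _ => ?_
        rw [mul_smul_comm]
        rfl
    _ = _ := by
        simp [prodPow_mul_revPow h.twist_mul]

end LeftRelations

namespace RightRelations

theorem right_inv_mul (h : RightRelations (t.coeff b) α β g g') (p : Fin n → (Fin r → Fin n) → k)
    (hp : ∀ i j, ∑ I, t.coeff b (Fin.cons i I) * p j I = if i = j then 1 else 0) :
    α * (Matrix.of fun i j => ∑ L, ∑ M, (t.coeff b (Fin.cons i M) * p j L) •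
      (prodPow α L M * g)) = 1 := by
  ext i j
  rw [Matrix.mul_apply, Matrix.one_apply]
  calc _ = ∑ L, p j L • ((∑ I : Fin (r + 1) → Fin n,
            t.coeff b I • prodPow α (Fin.cons i L) I) * g) := by
        simp only [sum_cons, prodPow_cons, Matrix.of_apply, Finset.sum_mul, Finset.mul_sum,
          Finset.smul_sum, smul_mul_assoc, mul_smul_comm, smul_smul, mul_assoc]
        rw [Finset.sum_comm]
        refine Finset.sum_congr rfl fun L _ => Finset.sum_congr rfl fun s _ =>
          Finset.sum_congr rfl fun M _ => ?_
        rw [mul_comm (p j L)]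
    _ = _ := by
        simp only [h.rel, smul_mul_assoc, h.inv_mul, smul_smul, ← Finset.sum_smul,
          mul_comm (p j _), hp]
        split_ifs <;> simp

theorem inv_eq (h : RightRelations (t.coeff b) α β g g') (p : Fin n → (Fin r → Fin n) → k)
    (hp : ∀ i j, ∑ I, t.coeff b (Fin.cons i I) * p j I = if i = j then 1 else 0) :
    β = Matrix.of fun i j => ∑ L, ∑ M, (t.coeff b (Fin.cons i M) * p j L) •
      (prodPow α L M * g) :=
  left_inv_eq_right_inv h.mul_eq_one (h.right_inv_mul p hp)

theorem mul_inv_eq_one (h : RightRelations (t.coeff b) α β g g') : α * β = 1 := by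
  obtain ⟨p, hp⟩ := t.exists_polar_right b
  rw [h.inv_eq p hp]
  exact h.right_inv_mul p hp

theorem mul_twist (h : RightRelations (t.coeff b) α β g g') : β.transpose * (rightTwist t b α g g').transpose = 1 := by
  obtain ⟨p, hp⟩ := t.exists_polar_right b
  rw [h.inv_eq p hp]
  ext j i
  rw [Matrix.mul_apply, Matrix.one_apply]
  have h1 : ∀ s, ∑ l, t.twistMatrix b l s • (∑ L, ∑ M, (t.coeff b (Fin.cons l M) * p j L) •
      (prodPow α L M * g)) =
      ∑ L, ∑ M, (t.coeff b (Fin.snoc M s) * p j L) • (prodPow α L M * g) := by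
    intro s
    simp only [Finset.smul_sum, smul_smul]
    rw [Finset.sum_comm]
    refine Finset.sum_congr rfl fun L _ => ?_
    rw [Finset.sum_comm]
    refine Finset.sum_congr rfl fun M _ => ?_
    rw [← Finset.sum_smul, t.coeff_snoc, Finset.sum_mul]
    congr 1
    exact Finset.sum_congr rfl fun l _ => by ring
  have h2 : ∀ q, ∑ s, (∑ L, ∑ M, (t.coeff b (Fin.snoc M s) * p j L) • (prodPow α L M * g)) *
      (g' * α q s) = ∑ L, (t.coeff b (Fin.snoc L q) * p j L) • g' := by
    intro q
    calc _ = ∑ L, p j L • ∑ I : Fin (r + 1) → Fin n,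
              t.coeff b I • prodPow α (Fin.snoc L q) I := by
          simp only [sum_snoc, prodPow_snoc, Finset.sum_mul, Finset.smul_sum, smul_mul_assoc,
            smul_smul]
          rw [Finset.sum_comm]
          refine Finset.sum_congr rfl fun L _ => Finset.sum_congr rfl fun s _ =>
            Finset.sum_congr rfl fun M _ => ?_
          rw [mul_assoc (prodPow α L M), ← mul_assoc g, h.mul_inv, one_mul, mul_comm (p j L)]
      _ = _ := by simp only [h.rel, smul_smul, mul_comm (p j _)]
  calc _ = ∑ q, t.twistMatrixInv b q i • ((∑ s, (∑ l, t.twistMatrix b l s •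
          (∑ L, ∑ M, (t.coeff b (Fin.cons l M) * p j L) • (prodPow α L M * g))) *
            (g' * α q s)) * g) := by
        simp only [Matrix.transpose_apply, Matrix.of_apply, rightTwist]
        simp_rw [Finset.mul_sum]
        rw [Finset.sum_comm]
        refine Finset.sum_congr rfl fun q _ => ?_
        rw [Finset.sum_comm]
        rw [Finset.sum_mul, Finset.smul_sum]
        refine Finset.sum_congr rfl fun s _ => ?_
        rw [Finset.sum_mul, Finset.sum_mul, Finset.smul_sum]
        refine Finset.sum_congr rfl fun l _ => ?_
        rw [mul_smul_comm, smul_mul_assoc, smul_mul_assoc, smul_smul]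
        simp only [mul_assoc]
    _ = ∑ q, t.twistMatrixInv b q i • ((∑ L, (t.coeff b (Fin.snoc L q) * p j L) • g') * g) := by
        simp only [h1, h2]
    _ = (∑ L, t.coeff b (Fin.cons i L) * p j L) • (1 : K) := by
        simp only [Finset.sum_mul, smul_mul_assoc, h.inv_mul, Finset.smul_sum, smul_smul,
          t.coeff_cons]
        rw [Finset.sum_comm, Finset.sum_smul]
        refine Finset.sum_congr rfl fun L _ => ?_
        rw [Finset.sum_smul]
        exact Finset.sum_congr rfl fun q _ => by ring_nf
    _ = _ := by
        rw [hp]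
        rcases eq_or_ne i j with rfl | hij
        · simp
        · simp [hij, hij.symm]

theorem twist_mul (h : RightRelations (t.coeff b) α β g g') : (rightTwist t b α g g').transpose * β.transpose = 1 := by
  obtain ⟨p, hp⟩ := t.exists_polar_right b
  have key : (Matrix.of fun j i => ∑ L, ∑ M, (t.coeff b (Fin.cons i M) * p j L) •
      (g' * revPow β L M)) * β.transpose = 1 := by
    ext j i
    rw [Matrix.mul_apply, Matrix.one_apply]
    calc _ = ∑ L, p j L • (g' * (∑ I : Fin (r + 1) → Fin n,
              t.coeff b I • revPow β (Fin.cons i L) I)) := by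
          simp only [sum_cons, revPow_cons, Matrix.of_apply, Finset.sum_mul, Finset.mul_sum,
            Finset.smul_sum, smul_mul_assoc, mul_smul_comm, smul_smul, mul_assoc,
            Matrix.transpose_apply]
          rw [Finset.sum_comm]
          refine Finset.sum_congr rfl fun L _ => Finset.sum_congr rfl fun s _ =>
            Finset.sum_congr rfl fun M _ => ?_
          rw [mul_comm (p j L)]
      _ = _ := by
          simp only [h.rel', mul_smul_comm, h.inv_mul, smul_smul, ← Finset.sum_smul,
            mul_comm (p j _), hp]
          rcases eq_or_ne i j with rfl | hij
          · simp
          · simp [hij, hij.symm]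
  rw [← left_inv_eq_right_inv key h.mul_twist]
  exact key

theorem twist_rel (h : RightRelations (t.coeff b) α β g g') (J : Fin (r + 1) → Fin n) :
    ∑ I, t.coeff b I • prodPow (rightTwist t b α g g') J I = t.coeff b J • g' := by
  have h1 : ∀ I, t.coeff b I • (1 : K) = g' * (∑ M, t.coeff b M • revPow β I M) := by
    intro I
    rw [h.rel', mul_smul_comm, h.inv_mul]
  calc _ = ∑ I, ∑ M, g' * (t.coeff b M • revPow β I M) * prodPow (rightTwist t b α g g') J I := by
        refine Finset.sum_congr rfl fun I _ => ?_
        rw [← Finset.sum_mul, ← Finset.mul_sum, ← h1, smul_mul_assoc, one_mul]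
    _ = ∑ M, g' * (t.coeff b M • ∑ I, revPow β.transpose M I *
          prodPow (rightTwist t b α g g').transpose I J) := by
        rw [Finset.sum_comm]
        refine Finset.sum_congr rfl fun M _ => ?_
        rw [Finset.smul_sum, Finset.mul_sum]
        refine Finset.sum_congr rfl fun I _ => ?_
        rw [mul_assoc, smul_mul_assoc]
        rfl
    _ = _ := by
        simp [revPow_mul_prodPow h.mul_twist]

end RightRelations

end Relations

/-! ### The Hopf algebras `H(e)` and `H(f)` -/

/-- The generators `a_{ij}`, `b_{ij}`, `D`, `D⁻¹`. -/
inductive Gen (n : ℕ) : Type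
  | a (i j : Fin n)
  | b (i j : Fin n)
  | D
  | Dinv

/-- The defining relations of `H(e)`, where `c I = e_{i₁ ⋯ i_m}`. -/
inductive LeftRel {k : Type u} [Field k] {m n : ℕ} (c : (Fin m → Fin n) → k) :
    FreeAlgebra k (Gen n) → FreeAlgebra k (Gen n) → Prop
  | rel_a (J : Fin m → Fin n) : LeftRel c
      (∑ I, c I • prodPow (Matrix.of fun i j => FreeAlgebra.ι k (Gen.a i j)) I J)
      (c J • FreeAlgebra.ι k Gen.D)
  | rel_b (J : Fin m → Fin n) : LeftRel c
      (∑ I, c I • revPow (Matrix.of fun i j => FreeAlgebra.ι k (Gen.b i j)) I J)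
      (c J • FreeAlgebra.ι k Gen.Dinv)
  | mul_inv : LeftRel c (FreeAlgebra.ι k Gen.D * FreeAlgebra.ι k Gen.Dinv) 1
  | inv_mul : LeftRel c (FreeAlgebra.ι k Gen.Dinv * FreeAlgebra.ι k Gen.D) 1
  | mul_eq_one (i j : Fin n) : LeftRel c
      (∑ l, FreeAlgebra.ι k (Gen.a i l) * FreeAlgebra.ι k (Gen.b l j)) (if i = j then 1 else 0)

/-- The defining relations of `H(f)`, where `c I = f_{i₁ ⋯ i_m}`. -/
inductive RightRel {k : Type u} [Field k] {m n : ℕ} (c : (Fin m → Fin n) → k) :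
    FreeAlgebra k (Gen n) → FreeAlgebra k (Gen n) → Prop
  | rel_a (J : Fin m → Fin n) : RightRel c
      (∑ I, c I • prodPow (Matrix.of fun i j => FreeAlgebra.ι k (Gen.a i j)) J I)
      (c J • FreeAlgebra.ι k Gen.Dinv)
  | rel_b (J : Fin m → Fin n) : RightRel c
      (∑ I, c I • revPow (Matrix.of fun i j => FreeAlgebra.ι k (Gen.b i j)) J I)
      (c J • FreeAlgebra.ι k Gen.D)
  | mul_inv : RightRel c (FreeAlgebra.ι k Gen.D * FreeAlgebra.ι k Gen.Dinv) 1
  | inv_mul : RightRel c (FreeAlgebra.ι k Gen.Dinv * FreeAlgebra.ι k Gen.D) 1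
  | mul_eq_one (i j : Fin n) : RightRel c
      (∑ l, FreeAlgebra.ι k (Gen.b i l) * FreeAlgebra.ι k (Gen.a l j)) (if i = j then 1 else 0)

/-- The assignment `a_{ij} ↦ α_{ij}`, `b_{ij} ↦ β_{ij}`, `D ↦ g`, `D⁻¹ ↦ g'`. -/
def genVal {n : ℕ} {K : Type w} (α β : Matrix (Fin n) (Fin n) K) (g g' : K) : Gen n → K
  | Gen.a i j => α i j
  | Gen.b i j => β i j
  | Gen.D => g
  | Gen.Dinv => g'

/-- An algebra map `S : H → Hᵐᵒᵖ` satisfying the antipode axioms on a set of elements on which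
every point of `H` depends polynomially makes a bialgebra `H` into a Hopf algebra. -/
theorem antipode_axioms {k : Type u} [Field k] {H : Type w} [Ring H] [Bialgebra k H]
    (S : H →ₐ[k] Hᵐᵒᵖ) (s : Set H) (hs : Algebra.adjoin k s = ⊤)
    (hl : ∀ x ∈ s, LinearMap.mul' k H
      ((((MulOpposite.opLinearEquiv k).symm.toLinearMap ∘ₗ S.toLinearMap).rTensor H)
        (Coalgebra.comul x)) = algebraMap k H (Coalgebra.counit x))
    (hr : ∀ x ∈ s, LinearMap.mul' k H
      ((((MulOpposite.opLinearEquiv k).symm.toLinearMap ∘ₗ S.toLinearMap).lTensor H)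
        (Coalgebra.comul x)) = algebraMap k H (Coalgebra.counit x)) :
    (LinearMap.mul' k H ∘ₗ
      ((MulOpposite.opLinearEquiv k).symm.toLinearMap ∘ₗ S.toLinearMap).rTensor H ∘ₗ
        Coalgebra.comul = Algebra.linearMap k H ∘ₗ Coalgebra.counit) ∧
    (LinearMap.mul' k H ∘ₗ
      ((MulOpposite.opLinearEquiv k).symm.toLinearMap ∘ₗ S.toLinearMap).lTensor H ∘ₗ
        Coalgebra.comul = Algebra.linearMap k H ∘ₗ Coalgebra.counit) := by
  set T : H →ₗ[k] H := (MulOpposite.opLinearEquiv k).symm.toLinearMap ∘ₗ S.toLinearMap with hT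
  have Tmul : ∀ x y, T (x * y) = T y * T x := by intro x y; simp [hT]
  have T1 : T 1 = 1 := by simp [hT]
  have hL : ∀ (p : H ⊗[k] H) (x y : H), LinearMap.mul' k H (T.rTensor H (p * (x ⊗ₜ y))) =
      T x * LinearMap.mul' k H (T.rTensor H p) * y := by
    intro p x y
    induction p with
    | zero => simp
    | tmul p q => simp [Algebra.TensorProduct.tmul_mul_tmul, Tmul, mul_assoc]
    | add p q hp hq => simp [add_mul, mul_add, hp, hq]
  have hR : ∀ (p : H ⊗[k] H) (x y : H), LinearMap.mul' k H (T.lTensor H ((x ⊗ₜ y) * p)) =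
      x * LinearMap.mul' k H (T.lTensor H p) * T y := by
    intro p x y
    induction p with
    | zero => simp
    | tmul p q => simp [Algebra.TensorProduct.tmul_mul_tmul, Tmul, mul_assoc]
    | add p q hp hq => simp [add_mul, mul_add, hp, hq]
  have hL' : ∀ (p q : H ⊗[k] H) (c d : k), LinearMap.mul' k H (T.rTensor H p) = algebraMap k H c →
      LinearMap.mul' k H (T.rTensor H q) = algebraMap k H d →
      LinearMap.mul' k H (T.rTensor H (p * q)) = algebraMap k H (c * d) := by
    intro p q c d hp hq
    have : ∀ q : H ⊗[k] H, LinearMap.mul' k H (T.rTensor H (p * q)) =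
        algebraMap k H c * LinearMap.mul' k H (T.rTensor H q) := by
      intro q
      induction q with
      | zero => simp
      | tmul x y => rw [hL, hp]; simp [← Algebra.commutes c, mul_assoc]
      | add x y hx hy => simp [mul_add, hx, hy]
    rw [this, hq, map_mul]
  have hR' : ∀ (p q : H ⊗[k] H) (c d : k), LinearMap.mul' k H (T.lTensor H p) = algebraMap k H c →
      LinearMap.mul' k H (T.lTensor H q) = algebraMap k H d →
      LinearMap.mul' k H (T.lTensor H (p * q)) = algebraMap k H (c * d) := by
    intro p q c d hp hq
    have : ∀ p : H ⊗[k] H, LinearMap.mul' k H (T.lTensor H (p * q)) =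
        LinearMap.mul' k H (T.lTensor H p) * algebraMap k H d := by
      intro p
      induction p with
      | zero => simp
      | tmul x y => rw [hR, hq]; simp [Algebra.commutes d, mul_assoc]
      | add x y hx hy => simp [add_mul, hx, hy]
    rw [this, hp, map_mul]
  have main : ∀ x : H, LinearMap.mul' k H (T.rTensor H (Coalgebra.comul x)) =
      algebraMap k H (Coalgebra.counit x) ∧ LinearMap.mul' k H (T.lTensor H (Coalgebra.comul x)) =
      algebraMap k H (Coalgebra.counit x) := by
    intro x
    have hx : x ∈ Algebra.adjoin k s := hs ▸ Algebra.mem_top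
    induction hx using Algebra.adjoin_induction with
    | mem x hx => exact ⟨hl x hx, hr x hx⟩
    | algebraMap c =>
      simp [Algebra.algebraMap_eq_smul_one, Algebra.TensorProduct.one_def, T1]
    | add x y _ _ hx hy => simp [hx.1, hx.2, hy.1, hy.2]
    | mul x y _ _ hx hy =>
      rw [Bialgebra.comul_mul, Bialgebra.counit_mul]
      exact ⟨hL' _ _ _ _ hx.1 hy.1, hR' _ _ _ _ hx.2 hy.2⟩
  exact ⟨LinearMap.ext fun x => (main x).1, LinearMap.ext fun x => (main x).2⟩

theorem ringQuot_induction {k : Type u} [Field k] {n : ℕ}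
    (rel : FreeAlgebra k (Gen n) → FreeAlgebra k (Gen n) → Prop) :
    Algebra.adjoin k (Set.range fun x : Gen n => RingQuot.mkAlgHom k rel (FreeAlgebra.ι k x)) =
      ⊤ := by
  have : (Set.range fun x : Gen n => RingQuot.mkAlgHom k rel (FreeAlgebra.ι k x)) =
      RingQuot.mkAlgHom k rel '' Set.range (FreeAlgebra.ι k) := by
    rw [← Set.range_comp]; rfl
  rw [this, ← AlgHom.map_adjoin, FreeAlgebra.adjoin_range_ι, Algebra.map_top,
    AlgHom.range_eq_top]
  exact RingQuot.mkAlgHom_surjective k rel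

section

variable {k : Type u} [Field k] {Z : Type v} [AddCommGroup Z] [Module k Z] {r n : ℕ}

/-- The algebra `H(e)`; the basis `b` is used to write down its presentation. -/
def HLeft (e : PreregularForm k Z r) (b : Module.Basis (Fin n) k Z) : Type u :=
  RingQuot (LeftRel (e.coeff b))

/-- The algebra `H(f)`; the basis `b` is used to write down its presentation. -/
def HRight (f : PreregularForm k Z r) (b : Module.Basis (Fin n) k Z) : Type u :=
  RingQuot (RightRel (f.coeff b))

namespace HLeft

variable (e : PreregularForm k Z r) (b : Module.Basis (Fin n) k Z)

noncomputable instance : Ring (HLeft e b) := inferInstanceAs (Ring (RingQuot _))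
noncomputable instance : Algebra k (HLeft e b) := inferInstanceAs (Algebra k (RingQuot _))

/-- The generators of `H(e)`. -/
noncomputable def gen (x : Gen n) : HLeft e b :=
  RingQuot.mkAlgHom k (LeftRel (e.coeff b)) (FreeAlgebra.ι k x)

/-- The matrix `𝔸 = (a_{ij})`. -/
noncomputable def A : Matrix (Fin n) (Fin n) (HLeft e b) := Matrix.of fun i j => gen e b (Gen.a i j)

/-- The matrix `𝔹 = (b_{ij})`. -/
noncomputable def B : Matrix (Fin n) (Fin n) (HLeft e b) := Matrix.of fun i j => gen e b (Gen.b i j)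

/-- The element `D_e`. -/
noncomputable def D : HLeft e b := gen e b Gen.D

/-- The element `D_e⁻¹`. -/
noncomputable def Dinv : HLeft e b := gen e b Gen.Dinv

theorem adjoin_gen : Algebra.adjoin k (Set.range (gen e b)) = ⊤ := ringQuot_induction _

theorem relations : LeftRelations (e.coeff b) (A e b) (B e b) (D e b) (Dinv e b) where
  rel J := by
    simpa [map_prodPow] using! RingQuot.mkAlgHom_rel k (LeftRel.rel_a (c := e.coeff b) J)
  rel' J := by
    simpa [map_revPow] using! RingQuot.mkAlgHom_rel k (LeftRel.rel_b (c := e.coeff b) J)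
  mul_inv := by
    simpa using! RingQuot.mkAlgHom_rel k (LeftRel.mul_inv (c := e.coeff b))
  inv_mul := by
    simpa using! RingQuot.mkAlgHom_rel k (LeftRel.inv_mul (c := e.coeff b))
  mul_eq_one := by
    ext i j
    have := RingQuot.mkAlgHom_rel k (LeftRel.mul_eq_one (c := e.coeff b) i j)
    rw [Matrix.mul_apply, Matrix.one_apply]
    simpa [apply_ite] using! this

variable {e b}
variable {K : Type w} [Ring K] [Algebra k K] {α β : Matrix (Fin n) (Fin n) K} {g g' : K}

/-- The algebra map out of `H(e)` determined by elements satisfying the defining relations. -/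
noncomputable def lift (h : LeftRelations (e.coeff b) α β g g') : HLeft e b →ₐ[k] K :=
  RingQuot.liftAlgHom k ⟨FreeAlgebra.lift k (genVal α β g g'), by
    have ha : (Matrix.of fun i j => FreeAlgebra.ι k (Gen.a i j)).map
        (FreeAlgebra.lift k (genVal α β g g')) = α := by ext i j; simp [genVal]
    have hb : (Matrix.of fun i j => FreeAlgebra.ι k (Gen.b i j)).map
        (FreeAlgebra.lift k (genVal α β g g')) = β := by ext i j; simp [genVal]
    intro x y hxy
    cases hxy with
    | rel_a J => simpa [map_prodPow, ha, genVal] using h.rel J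
    | rel_b J => simpa [map_revPow, hb, genVal] using h.rel' J
    | mul_inv => simpa [genVal] using h.mul_inv
    | inv_mul => simpa [genVal] using h.inv_mul
    | mul_eq_one i j =>
      have := congrFun (congrFun h.mul_eq_one i) j
      rw [Matrix.mul_apply, Matrix.one_apply] at this
      simpa [apply_ite, genVal] using this⟩

variable (h : LeftRelations (e.coeff b) α β g g')

theorem lift_gen (x : Gen n) : lift h (gen e b x) = genVal α β g g' x :=
  (RingQuot.liftAlgHom_mkAlgHom_apply _ _ _ _).trans (FreeAlgebra.lift_ι_apply _ _)

@[simp] theorem lift_A (i j : Fin n) : lift h (A e b i j) = α i j := lift_gen h _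

@[simp] theorem lift_B (i j : Fin n) : lift h (B e b i j) = β i j := lift_gen h _

@[simp] theorem lift_D : lift h (D e b) = g := lift_gen h _

@[simp] theorem lift_Dinv : lift h (Dinv e b) = g' := lift_gen h _

theorem algHom_ext {φ ψ : HLeft e b →ₐ[k] K} (hA : ∀ i j, φ (A e b i j) = ψ (A e b i j))
    (hB : ∀ i j, φ (B e b i j) = ψ (B e b i j)) (hD : φ (D e b) = ψ (D e b))
    (hD' : φ (Dinv e b) = ψ (Dinv e b)) : φ = ψ := by
  refine RingQuot.ringQuot_ext' k φ ψ (FreeAlgebra.hom_ext (funext fun x => ?_))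
  cases x with
  | a i j => exact hA i j
  | b i j => exact hB i j
  | D => exact hD
  | Dinv => exact hD'

variable (e b)

theorem comulRelations : LeftRelations (e.coeff b)
    (Matrix.of fun i j => ∑ l, A e b i l ⊗ₜ[k] A e b l j)
    (Matrix.of fun i j => ∑ l, B e b l j ⊗ₜ[k] B e b i l)
    (D e b ⊗ₜ[k] D e b) (Dinv e b ⊗ₜ[k] Dinv e b) where
  rel J := by
    simp only [prodPow_tensor, Finset.smul_sum]
    rw [Finset.sum_comm]
    simp only [TensorProduct.smul_tmul', ← TensorProduct.sum_tmul, (relations e b).rel]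
    simp only [TensorProduct.smul_tmul, ← TensorProduct.tmul_sum, (relations e b).rel]
  rel' J := by
    simp only [revPow_tensor, Finset.smul_sum]
    rw [Finset.sum_comm]
    simp only [← TensorProduct.tmul_smul, ← TensorProduct.tmul_sum, (relations e b).rel']
    simp only [← TensorProduct.smul_tmul, ← TensorProduct.sum_tmul, (relations e b).rel']
  mul_inv := by simp [(relations e b).mul_inv, Algebra.TensorProduct.one_def]
  inv_mul := by simp [(relations e b).inv_mul, Algebra.TensorProduct.one_def]
  mul_eq_one := by
    have hAB : ∀ i j, ∑ l, A e b i l * B e b l j = if i = j then 1 else 0 := fun i j => by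
      rw [← Matrix.mul_apply, (relations e b).mul_eq_one, Matrix.one_apply]
    ext i j
    rw [Matrix.mul_apply, Matrix.one_apply]
    simp only [Matrix.of_apply, Finset.sum_mul_sum, Algebra.TensorProduct.tmul_mul_tmul]
    rw [Finset.sum_comm]
    have : ∀ p, ∑ s, ∑ q, (A e b i p * B e b q j) ⊗ₜ[k] (A e b p s * B e b s q) =
        (A e b i p * B e b p j) ⊗ₜ[k] (1 : HLeft e b) := by
      intro p
      rw [Finset.sum_comm]
      simp only [← TensorProduct.tmul_sum, hAB]
      simp [apply_ite]
    simp only [this, ← TensorProduct.sum_tmul, hAB]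
    split_ifs <;> simp [Algebra.TensorProduct.one_def]

theorem counitRelations :
    LeftRelations (e.coeff b) (1 : Matrix (Fin n) (Fin n) k) 1 (1 : k) 1 where
  rel J := by simp [prodPow_one]
  rel' J := by simp [revPow_one]
  mul_inv := by simp
  inv_mul := by simp
  mul_eq_one := by simp

theorem antipodeRelations : LeftRelations (e.coeff b)
    ((B e b).map MulOpposite.op)
    ((leftTwist e b (A e b) (D e b) (Dinv e b)).map MulOpposite.op)
    (MulOpposite.op (Dinv e b)) (MulOpposite.op (D e b)) where
  rel J := by
    simp only [prodPow_op, ← MulOpposite.op_smul, ← Finset.op_sum, (relations e b).rel']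
  rel' J := by
    simp only [revPow_op, ← MulOpposite.op_smul, ← Finset.op_sum, (relations e b).twist_rel]
  mul_inv := by rw [← MulOpposite.op_mul, (relations e b).mul_inv, MulOpposite.op_one]
  inv_mul := by rw [← MulOpposite.op_mul, (relations e b).inv_mul, MulOpposite.op_one]
  mul_eq_one := by
    ext i j
    have := congrFun (congrFun (relations e b).twist_mul j) i
    rw [Matrix.mul_apply, Matrix.one_apply] at this
    rw [Matrix.mul_apply, Matrix.one_apply]
    simp only [Matrix.map_apply, ← MulOpposite.op_mul, ← Finset.op_sum]
    simp only [Matrix.transpose_apply] at this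
    rw [this]
    rcases eq_or_ne i j with rfl | hij
    · simp
    · simp [hij, hij.symm]

noncomputable instance : Bialgebra k (HLeft e b) :=
  Bialgebra.ofAlgHom (lift (comulRelations e b)) (lift (counitRelations e b))
    (by
      refine algHom_ext (fun i j => ?_) (fun i j => ?_) ?_ ?_
      · simp [TensorProduct.sum_tmul, TensorProduct.tmul_sum]
        exact Finset.sum_comm
      · simp [TensorProduct.sum_tmul, TensorProduct.tmul_sum]
        exact Finset.sum_comm
      · simp
      · simp)
    (by
      refine algHom_ext (fun i j => ?_) (fun i j => ?_) ?_ ?_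
      · simp [Matrix.one_apply, TensorProduct.ite_tmul]
      · simp [Matrix.one_apply, TensorProduct.ite_tmul]
      · simp
      · simp)
    (by
      refine algHom_ext (fun i j => ?_) (fun i j => ?_) ?_ ?_
      · simp [Matrix.one_apply, TensorProduct.tmul_ite]
      · simp [Matrix.one_apply, TensorProduct.tmul_ite]
      · simp
      · simp)

theorem comul_A (i j : Fin n) :
    Coalgebra.comul (R := k) (A e b i j) = ∑ l, A e b i l ⊗ₜ[k] A e b l j :=
  lift_A (comulRelations e b) i j

theorem comul_B (i j : Fin n) :
    Coalgebra.comul (R := k) (B e b i j) = ∑ l, B e b l j ⊗ₜ[k] B e b i l :=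
  lift_B (comulRelations e b) i j

theorem comul_D : Coalgebra.comul (R := k) (D e b) = D e b ⊗ₜ[k] D e b :=
  lift_D (comulRelations e b)

theorem comul_Dinv : Coalgebra.comul (R := k) (Dinv e b) = Dinv e b ⊗ₜ[k] Dinv e b :=
  lift_Dinv (comulRelations e b)

theorem counit_A (i j : Fin n) :
    Coalgebra.counit (R := k) (A e b i j) = if i = j then 1 else 0 :=
  (lift_A (counitRelations e b) i j).trans Matrix.one_apply

theorem counit_B (i j : Fin n) :
    Coalgebra.counit (R := k) (B e b i j) = if i = j then 1 else 0 :=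
  (lift_B (counitRelations e b) i j).trans Matrix.one_apply

theorem counit_D : Coalgebra.counit (R := k) (D e b) = 1 := lift_D (counitRelations e b)

theorem counit_Dinv : Coalgebra.counit (R := k) (Dinv e b) = 1 := lift_Dinv (counitRelations e b)

/-- The antipode: `S(𝔸) = 𝔹`, `S(𝔹) = D⁻¹ P⁻¹ 𝔸 P D`, `S(D^{±1}) = D^{∓1}`. -/
noncomputable def antipodeOp : HLeft e b →ₐ[k] (HLeft e b)ᵐᵒᵖ := lift (antipodeRelations e b)

/-- The antipode as a linear map. -/
noncomputable def antipodeLinear : HLeft e b →ₗ[k] HLeft e b :=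
  (MulOpposite.opLinearEquiv k).symm.toLinearMap ∘ₗ (antipodeOp e b).toLinearMap

theorem antipode_axioms :
    (LinearMap.mul' k (HLeft e b) ∘ₗ (antipodeLinear e b).rTensor (HLeft e b) ∘ₗ
      Coalgebra.comul = Algebra.linearMap k (HLeft e b) ∘ₗ Coalgebra.counit) ∧
    (LinearMap.mul' k (HLeft e b) ∘ₗ (antipodeLinear e b).lTensor (HLeft e b) ∘ₗ
      Coalgebra.comul = Algebra.linearMap k (HLeft e b) ∘ₗ Coalgebra.counit) := by
  refine PreregularQuantumGroup.antipode_axioms (antipodeOp e b) (Set.range (gen e b)) (adjoin_gen e b) ?_ ?_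
  · rintro _ ⟨x, rfl⟩
    cases x with
    | a i j =>
      change LinearMap.mul' k _ (LinearMap.rTensor _ _ (Coalgebra.comul (A e b i j))) =
        algebraMap k _ (Coalgebra.counit (A e b i j))
      have := congrFun (congrFun (relations e b).inv_mul_eq_one i) j
      rw [Matrix.mul_apply, Matrix.one_apply] at this
      rw [comul_A, counit_A]
      simpa [antipodeOp, apply_ite] using this
    | b i j =>
      change LinearMap.mul' k _ (LinearMap.rTensor _ _ (Coalgebra.comul (B e b i j))) =
        algebraMap k _ (Coalgebra.counit (B e b i j))
      have := congrFun (congrFun (relations e b).twist_mul j) i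
      rw [Matrix.mul_apply, Matrix.one_apply] at this
      rw [comul_B, counit_B]
      simpa [antipodeOp, apply_ite, eq_comm] using this
    | D =>
      change LinearMap.mul' k _ (LinearMap.rTensor _ _ (Coalgebra.comul (D e b))) =
        algebraMap k _ (Coalgebra.counit (D e b))
      rw [comul_D, counit_D]
      simpa [antipodeOp] using (relations e b).inv_mul
    | Dinv =>
      change LinearMap.mul' k _ (LinearMap.rTensor _ _ (Coalgebra.comul (Dinv e b))) =
        algebraMap k _ (Coalgebra.counit (Dinv e b))
      rw [comul_Dinv, counit_Dinv]
      simpa [antipodeOp] using (relations e b).mul_inv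
  · rintro _ ⟨x, rfl⟩
    cases x with
    | a i j =>
      change LinearMap.mul' k _ (LinearMap.lTensor _ _ (Coalgebra.comul (A e b i j))) =
        algebraMap k _ (Coalgebra.counit (A e b i j))
      have := congrFun (congrFun (relations e b).mul_eq_one i) j
      rw [Matrix.mul_apply, Matrix.one_apply] at this
      rw [comul_A, counit_A]
      simpa [antipodeOp, apply_ite] using this
    | b i j =>
      change LinearMap.mul' k _ (LinearMap.lTensor _ _ (Coalgebra.comul (B e b i j))) =
        algebraMap k _ (Coalgebra.counit (B e b i j))
      have := congrFun (congrFun (relations e b).mul_twist j) i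
      rw [Matrix.mul_apply, Matrix.one_apply] at this
      rw [comul_B, counit_B]
      simpa [antipodeOp, apply_ite, eq_comm] using this
    | D =>
      change LinearMap.mul' k _ (LinearMap.lTensor _ _ (Coalgebra.comul (D e b))) =
        algebraMap k _ (Coalgebra.counit (D e b))
      rw [comul_D, counit_D]
      simpa [antipodeOp] using (relations e b).mul_inv
    | Dinv =>
      change LinearMap.mul' k _ (LinearMap.lTensor _ _ (Coalgebra.comul (Dinv e b))) =
        algebraMap k _ (Coalgebra.counit (Dinv e b))
      rw [comul_Dinv, counit_Dinv]
      simpa [antipodeOp] using (relations e b).inv_mul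

noncomputable instance : HopfAlgebra k (HLeft e b) where
  antipode := antipodeLinear e b
  mul_antipode_rTensor_comul := (antipode_axioms e b).1
  mul_antipode_lTensor_comul := (antipode_axioms e b).2

theorem isGroupLikeElem_D : IsGroupLikeElem k (D e b) := ⟨counit_D e b, comul_D e b⟩

end HLeft

namespace HRight

variable (f : PreregularForm k Z r) (b : Module.Basis (Fin n) k Z)

noncomputable instance : Ring (HRight f b) := inferInstanceAs (Ring (RingQuot _))
noncomputable instance : Algebra k (HRight f b) := inferInstanceAs (Algebra k (RingQuot _))

/-- The generators of `H(f)`. -/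
noncomputable def gen (x : Gen n) : HRight f b :=
  RingQuot.mkAlgHom k (RightRel (f.coeff b)) (FreeAlgebra.ι k x)

/-- The matrix `𝔸 = (a_{ij})`. -/
noncomputable def A : Matrix (Fin n) (Fin n) (HRight f b) := Matrix.of fun i j => gen f b (Gen.a i j)

/-- The matrix `𝔹 = (b_{ij})`. -/
noncomputable def B : Matrix (Fin n) (Fin n) (HRight f b) := Matrix.of fun i j => gen f b (Gen.b i j)

/-- The element `D_f`. -/
noncomputable def D : HRight f b := gen f b Gen.D

/-- The element `D_f⁻¹`. -/
noncomputable def Dinv : HRight f b := gen f b Gen.Dinv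

theorem adjoin_gen : Algebra.adjoin k (Set.range (gen f b)) = ⊤ := ringQuot_induction _

theorem relations : RightRelations (f.coeff b) (A f b) (B f b) (D f b) (Dinv f b) where
  rel J := by
    simpa [map_prodPow] using! RingQuot.mkAlgHom_rel k (RightRel.rel_a (c := f.coeff b) J)
  rel' J := by
    simpa [map_revPow] using! RingQuot.mkAlgHom_rel k (RightRel.rel_b (c := f.coeff b) J)
  mul_inv := by
    simpa using! RingQuot.mkAlgHom_rel k (RightRel.mul_inv (c := f.coeff b))
  inv_mul := by
    simpa using! RingQuot.mkAlgHom_rel k (RightRel.inv_mul (c := f.coeff b))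
  mul_eq_one := by
    ext i j
    have := RingQuot.mkAlgHom_rel k (RightRel.mul_eq_one (c := f.coeff b) i j)
    rw [Matrix.mul_apply, Matrix.one_apply]
    simpa [apply_ite] using! this

variable {f b}
variable {K : Type w} [Ring K] [Algebra k K] {α β : Matrix (Fin n) (Fin n) K} {g g' : K}

/-- The algebra map out of `H(f)` determined by elements satisfying the defining relations. -/
noncomputable def lift (h : RightRelations (f.coeff b) α β g g') : HRight f b →ₐ[k] K :=
  RingQuot.liftAlgHom k ⟨FreeAlgebra.lift k (genVal α β g g'), by
    have ha : (Matrix.of fun i j => FreeAlgebra.ι k (Gen.a i j)).map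
        (FreeAlgebra.lift k (genVal α β g g')) = α := by ext i j; simp [genVal]
    have hb : (Matrix.of fun i j => FreeAlgebra.ι k (Gen.b i j)).map
        (FreeAlgebra.lift k (genVal α β g g')) = β := by ext i j; simp [genVal]
    intro x y hxy
    cases hxy with
    | rel_a J => simpa [map_prodPow, ha, genVal] using h.rel J
    | rel_b J => simpa [map_revPow, hb, genVal] using h.rel' J
    | mul_inv => simpa [genVal] using h.mul_inv
    | inv_mul => simpa [genVal] using h.inv_mul
    | mul_eq_one i j =>
      have := congrFun (congrFun h.mul_eq_one i) j
      rw [Matrix.mul_apply, Matrix.one_apply] at this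
      simpa [apply_ite, genVal] using this⟩

variable (h : RightRelations (f.coeff b) α β g g')

theorem lift_gen (x : Gen n) : lift h (gen f b x) = genVal α β g g' x :=
  (RingQuot.liftAlgHom_mkAlgHom_apply _ _ _ _).trans (FreeAlgebra.lift_ι_apply _ _)

@[simp] theorem lift_A (i j : Fin n) : lift h (A f b i j) = α i j := lift_gen h _

@[simp] theorem lift_B (i j : Fin n) : lift h (B f b i j) = β i j := lift_gen h _

@[simp] theorem lift_D : lift h (D f b) = g := lift_gen h _

@[simp] theorem lift_Dinv : lift h (Dinv f b) = g' := lift_gen h _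

theorem algHom_ext {φ ψ : HRight f b →ₐ[k] K} (hA : ∀ i j, φ (A f b i j) = ψ (A f b i j))
    (hB : ∀ i j, φ (B f b i j) = ψ (B f b i j)) (hD : φ (D f b) = ψ (D f b))
    (hD' : φ (Dinv f b) = ψ (Dinv f b)) : φ = ψ := by
  refine RingQuot.ringQuot_ext' k φ ψ (FreeAlgebra.hom_ext (funext fun x => ?_))
  cases x with
  | a i j => exact hA i j
  | b i j => exact hB i j
  | D => exact hD
  | Dinv => exact hD'

variable (f b)

theorem comulRelations : RightRelations (f.coeff b)
    (Matrix.of fun i j => ∑ l, A f b i l ⊗ₜ[k] A f b l j)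
    (Matrix.of fun i j => ∑ l, B f b l j ⊗ₜ[k] B f b i l)
    (D f b ⊗ₜ[k] D f b) (Dinv f b ⊗ₜ[k] Dinv f b) where
  rel J := by
    simp only [prodPow_tensor, Finset.smul_sum]
    rw [Finset.sum_comm]
    simp only [← TensorProduct.tmul_smul, ← TensorProduct.tmul_sum, (relations f b).rel]
    simp only [← TensorProduct.smul_tmul, ← TensorProduct.sum_tmul, (relations f b).rel]
  rel' J := by
    simp only [revPow_tensor, Finset.smul_sum]
    rw [Finset.sum_comm]
    simp only [TensorProduct.smul_tmul', ← TensorProduct.sum_tmul, (relations f b).rel']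
    simp only [TensorProduct.smul_tmul, ← TensorProduct.tmul_sum, (relations f b).rel']
  mul_inv := by simp [(relations f b).mul_inv, Algebra.TensorProduct.one_def]
  inv_mul := by simp [(relations f b).inv_mul, Algebra.TensorProduct.one_def]
  mul_eq_one := by
    have hBA : ∀ i j, ∑ l, B f b i l * A f b l j = if i = j then 1 else 0 := fun i j => by
      rw [← Matrix.mul_apply, (relations f b).mul_eq_one, Matrix.one_apply]
    ext i j
    rw [Matrix.mul_apply, Matrix.one_apply]
    simp only [Matrix.of_apply, Finset.sum_mul_sum, Algebra.TensorProduct.tmul_mul_tmul]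
    rw [Finset.sum_comm]
    have : ∀ p, ∑ s, ∑ q, (B f b p s * A f b s q) ⊗ₜ[k] (B f b i p * A f b q j) =
        (1 : HRight f b) ⊗ₜ[k] (B f b i p * A f b p j) := by
      intro p
      rw [Finset.sum_comm]
      simp only [← TensorProduct.sum_tmul, hBA]
      simp [TensorProduct.ite_tmul]
    simp only [this, ← TensorProduct.tmul_sum, hBA]
    split_ifs <;> simp [Algebra.TensorProduct.one_def]

theorem counitRelations :
    RightRelations (f.coeff b) (1 : Matrix (Fin n) (Fin n) k) 1 (1 : k) 1 where
  rel J := by simp [prodPow_one]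
  rel' J := by simp [revPow_one]
  mul_inv := by simp
  inv_mul := by simp
  mul_eq_one := by simp

theorem antipodeRelations : RightRelations (f.coeff b)
    ((B f b).map MulOpposite.op)
    ((rightTwist f b (A f b) (D f b) (Dinv f b)).map MulOpposite.op)
    (MulOpposite.op (Dinv f b)) (MulOpposite.op (D f b)) where
  rel J := by
    simp only [prodPow_op, ← MulOpposite.op_smul, ← Finset.op_sum, (relations f b).rel']
  rel' J := by
    simp only [revPow_op, ← MulOpposite.op_smul, ← Finset.op_sum, (relations f b).twist_rel]
  mul_inv := by rw [← MulOpposite.op_mul, (relations f b).mul_inv, MulOpposite.op_one]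
  inv_mul := by rw [← MulOpposite.op_mul, (relations f b).inv_mul, MulOpposite.op_one]
  mul_eq_one := by
    ext i j
    have := congrFun (congrFun (relations f b).mul_twist j) i
    rw [Matrix.mul_apply, Matrix.one_apply] at this
    rw [Matrix.mul_apply, Matrix.one_apply]
    simp only [Matrix.map_apply, ← MulOpposite.op_mul, ← Finset.op_sum]
    simp only [Matrix.transpose_apply] at this
    rw [this]
    rcases eq_or_ne i j with rfl | hij
    · simp
    · simp [hij, hij.symm]

noncomputable instance : Bialgebra k (HRight f b) :=
  Bialgebra.ofAlgHom (lift (comulRelations f b)) (lift (counitRelations f b))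
    (by
      refine algHom_ext (fun i j => ?_) (fun i j => ?_) ?_ ?_
      · simp [TensorProduct.sum_tmul, TensorProduct.tmul_sum]
        exact Finset.sum_comm
      · simp [TensorProduct.sum_tmul, TensorProduct.tmul_sum]
        exact Finset.sum_comm
      · simp
      · simp)
    (by
      refine algHom_ext (fun i j => ?_) (fun i j => ?_) ?_ ?_
      · simp [Matrix.one_apply, TensorProduct.ite_tmul]
      · simp [Matrix.one_apply, TensorProduct.ite_tmul]
      · simp
      · simp)
    (by
      refine algHom_ext (fun i j => ?_) (fun i j => ?_) ?_ ?_
      · simp [Matrix.one_apply, TensorProduct.tmul_ite]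
      · simp [Matrix.one_apply, TensorProduct.tmul_ite]
      · simp
      · simp)

theorem comul_A (i j : Fin n) :
    Coalgebra.comul (R := k) (A f b i j) = ∑ l, A f b i l ⊗ₜ[k] A f b l j :=
  lift_A (comulRelations f b) i j

theorem comul_B (i j : Fin n) :
    Coalgebra.comul (R := k) (B f b i j) = ∑ l, B f b l j ⊗ₜ[k] B f b i l :=
  lift_B (comulRelations f b) i j

theorem comul_D : Coalgebra.comul (R := k) (D f b) = D f b ⊗ₜ[k] D f b :=
  lift_D (comulRelations f b)

theorem comul_Dinv : Coalgebra.comul (R := k) (Dinv f b) = Dinv f b ⊗ₜ[k] Dinv f b :=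
  lift_Dinv (comulRelations f b)

theorem counit_A (i j : Fin n) :
    Coalgebra.counit (R := k) (A f b i j) = if i = j then 1 else 0 :=
  (lift_A (counitRelations f b) i j).trans Matrix.one_apply

theorem counit_B (i j : Fin n) :
    Coalgebra.counit (R := k) (B f b i j) = if i = j then 1 else 0 :=
  (lift_B (counitRelations f b) i j).trans Matrix.one_apply

theorem counit_D : Coalgebra.counit (R := k) (D f b) = 1 := lift_D (counitRelations f b)

theorem counit_Dinv : Coalgebra.counit (R := k) (Dinv f b) = 1 := lift_Dinv (counitRelations f b)

/-- The antipode: `S(𝔸) = 𝔹`, `S(𝔹) = D⁻¹ Q⁻ᵀ 𝔸 Qᵀ D`, `S(D^{±1}) = D^{∓1}`. -/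
noncomputable def antipodeOp : HRight f b →ₐ[k] (HRight f b)ᵐᵒᵖ := lift (antipodeRelations f b)

/-- The antipode as a linear map. -/
noncomputable def antipodeLinear : HRight f b →ₗ[k] HRight f b :=
  (MulOpposite.opLinearEquiv k).symm.toLinearMap ∘ₗ (antipodeOp f b).toLinearMap

theorem antipode_axioms :
    (LinearMap.mul' k (HRight f b) ∘ₗ (antipodeLinear f b).rTensor (HRight f b) ∘ₗ
      Coalgebra.comul = Algebra.linearMap k (HRight f b) ∘ₗ Coalgebra.counit) ∧
    (LinearMap.mul' k (HRight f b) ∘ₗ (antipodeLinear f b).lTensor (HRight f b) ∘ₗ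
      Coalgebra.comul = Algebra.linearMap k (HRight f b) ∘ₗ Coalgebra.counit) := by
  refine PreregularQuantumGroup.antipode_axioms (antipodeOp f b) (Set.range (gen f b)) (adjoin_gen f b) ?_ ?_
  · rintro _ ⟨x, rfl⟩
    cases x with
    | a i j =>
      change LinearMap.mul' k _ (LinearMap.rTensor _ _ (Coalgebra.comul (A f b i j))) =
        algebraMap k _ (Coalgebra.counit (A f b i j))
      have := congrFun (congrFun (relations f b).mul_eq_one i) j
      rw [Matrix.mul_apply, Matrix.one_apply] at this
      rw [comul_A, counit_A]
      simpa [antipodeOp, apply_ite] using this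
    | b i j =>
      change LinearMap.mul' k _ (LinearMap.rTensor _ _ (Coalgebra.comul (B f b i j))) =
        algebraMap k _ (Coalgebra.counit (B f b i j))
      have := congrFun (congrFun (relations f b).twist_mul j) i
      rw [Matrix.mul_apply, Matrix.one_apply] at this
      rw [comul_B, counit_B]
      simpa [antipodeOp, apply_ite, eq_comm] using this
    | D =>
      change LinearMap.mul' k _ (LinearMap.rTensor _ _ (Coalgebra.comul (D f b))) =
        algebraMap k _ (Coalgebra.counit (D f b))
      rw [comul_D, counit_D]
      simpa [antipodeOp] using (relations f b).inv_mul
    | Dinv =>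
      change LinearMap.mul' k _ (LinearMap.rTensor _ _ (Coalgebra.comul (Dinv f b))) =
        algebraMap k _ (Coalgebra.counit (Dinv f b))
      rw [comul_Dinv, counit_Dinv]
      simpa [antipodeOp] using (relations f b).mul_inv
  · rintro _ ⟨x, rfl⟩
    cases x with
    | a i j =>
      change LinearMap.mul' k _ (LinearMap.lTensor _ _ (Coalgebra.comul (A f b i j))) =
        algebraMap k _ (Coalgebra.counit (A f b i j))
      have := congrFun (congrFun (relations f b).mul_inv_eq_one i) j
      rw [Matrix.mul_apply, Matrix.one_apply] at this
      rw [comul_A, counit_A]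
      simpa [antipodeOp, apply_ite] using this
    | b i j =>
      change LinearMap.mul' k _ (LinearMap.lTensor _ _ (Coalgebra.comul (B f b i j))) =
        algebraMap k _ (Coalgebra.counit (B f b i j))
      have := congrFun (congrFun (relations f b).mul_twist j) i
      rw [Matrix.mul_apply, Matrix.one_apply] at this
      rw [comul_B, counit_B]
      simpa [antipodeOp, apply_ite, eq_comm] using this
    | D =>
      change LinearMap.mul' k _ (LinearMap.lTensor _ _ (Coalgebra.comul (D f b))) =
        algebraMap k _ (Coalgebra.counit (D f b))
      rw [comul_D, counit_D]
      simpa [antipodeOp] using (relations f b).mul_inv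
    | Dinv =>
      change LinearMap.mul' k _ (LinearMap.lTensor _ _ (Coalgebra.comul (Dinv f b))) =
        algebraMap k _ (Coalgebra.counit (Dinv f b))
      rw [comul_Dinv, counit_Dinv]
      simpa [antipodeOp] using (relations f b).inv_mul

noncomputable instance : HopfAlgebra k (HRight f b) where
  antipode := antipodeLinear f b
  mul_antipode_rTensor_comul := (antipode_axioms f b).1
  mul_antipode_lTensor_comul := (antipode_axioms f b).2

theorem isGroupLikeElem_D : IsGroupLikeElem k (D f b) := ⟨counit_D f b, comul_D f b⟩

end HRight

end

/-! ### The quotients `S(e) = H(e)/(D_e - 1)` and `S(f) = H(f)/(D_f - 1)` -/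

section Quotient

variable {k : Type u} [Field k]

/-- The two-sided ideal `(g - 1)`. -/
def subOneIdeal {H : Type w} [Ring H] (g : H) : Ideal H :=
  TwoSidedIdeal.asIdeal (TwoSidedIdeal.span {g - 1})

instance {H : Type w} [Ring H] (g : H) : (subOneIdeal g).IsTwoSided := by
  unfold subOneIdeal; infer_instance

theorem subOneIdeal_le_ker {H : Type w} {K : Type w} [Ring H] [Ring K] (g : H) (φ : H →+* K)
    (hφ : φ g = 1) {x : H} (hx : x ∈ subOneIdeal g) : φ x = 0 := by
  have h : TwoSidedIdeal.span {g - 1} ≤ TwoSidedIdeal.ker φ := by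
    rw [TwoSidedIdeal.span_le]
    rintro _ rfl
    simp [TwoSidedIdeal.mem_ker, hφ]
  exact (TwoSidedIdeal.mem_ker φ).1 (h (TwoSidedIdeal.mem_asIdeal.1 hx))

theorem mk_subOneIdeal {H : Type w} [Ring H] (g : H) :
    Ideal.Quotient.mk (subOneIdeal g) g = 1 := by
  rw [← map_one (Ideal.Quotient.mk (subOneIdeal g)), Ideal.Quotient.eq]
  exact TwoSidedIdeal.mem_asIdeal.2 (TwoSidedIdeal.subset_span rfl)

theorem subOneIdeal_isHopfIdeal {H : Type u} [Ring H] [HopfAlgebra k H] {g : H}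
    (hg : IsGroupLikeElem k g) : (subOneIdeal g).IsHopfIdeal k where
  counit_eq_zero x hx := by
    exact subOneIdeal_le_ker g (Bialgebra.counitAlgHom k H).toRingHom hg.counit_eq_one hx
  map_mkQ_comul_eq_zero x hx := by
    refine subOneIdeal_le_ker g ((Algebra.TensorProduct.map
      (Ideal.Quotient.mkₐ k (subOneIdeal g)) (Ideal.Quotient.mkₐ k (subOneIdeal g))).comp
      (Bialgebra.comulAlgHom k H)).toRingHom ?_ hx
    change Algebra.TensorProduct.map (Ideal.Quotient.mkₐ k (subOneIdeal g))
      (Ideal.Quotient.mkₐ k (subOneIdeal g)) (Coalgebra.comul g) = 1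
    rw [hg.comul_eq_tmul_self, Algebra.TensorProduct.map_tmul, Ideal.Quotient.mkₐ_eq_mk,
      mk_subOneIdeal, Algebra.TensorProduct.one_def]
  antipode_mem x hx := by
    rw [← Ideal.Quotient.eq_zero_iff_mem]
    have h1 : Ideal.Quotient.mk (subOneIdeal g) (HopfAlgebra.antipode k g) = 1 := by
      have := HopfAlgebra.mul_antipode_rTensor_comul_apply (R := k) g
      rw [hg.comul_eq_tmul_self, hg.counit_eq_one] at this
      simp only [LinearMap.rTensor_tmul, LinearMap.mul'_apply, map_one] at this
      simpa [mk_subOneIdeal] using congrArg (Ideal.Quotient.mk (subOneIdeal g)) this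
    have := subOneIdeal_le_ker g ((RingHom.op (Ideal.Quotient.mk (subOneIdeal g))).comp
      (HopfAlgebra.antipodeAlgHomOp k H).toRingHom) (by simpa using h1) hx
    simpa using this

variable {Z : Type v} [AddCommGroup Z] [Module k Z] {r n : ℕ}

/-- `S(e) = H(e)/(D_e - 1)`. -/
def SLeft (e : PreregularForm k Z r) (b : Module.Basis (Fin n) k Z) : Type u :=
  HLeft e b ⧸ subOneIdeal (HLeft.D e b)

/-- `S(f) = H(f)/(D_f - 1)`. -/
def SRight (f : PreregularForm k Z r) (b : Module.Basis (Fin n) k Z) : Type u :=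
  HRight f b ⧸ subOneIdeal (HRight.D f b)

namespace SLeft

variable (e : PreregularForm k Z r) (b : Module.Basis (Fin n) k Z)

noncomputable instance : Ring (SLeft e b) :=
  inferInstanceAs (Ring (HLeft e b ⧸ subOneIdeal (HLeft.D e b)))

noncomputable instance : HopfAlgebra k (SLeft e b) :=
  haveI := subOneIdeal_isHopfIdeal (HLeft.isGroupLikeElem_D e b)
  inferInstanceAs (HopfAlgebra k (HLeft e b ⧸ subOneIdeal (HLeft.D e b)))

/-- The image of the matrix `(a_{ij})` in `S(e)`. -/
noncomputable def A : Matrix (Fin n) (Fin n) (SLeft e b) :=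
  (HLeft.A e b).map (Ideal.Quotient.mk (subOneIdeal (HLeft.D e b)))

end SLeft

namespace SRight

variable (f : PreregularForm k Z r) (b : Module.Basis (Fin n) k Z)

noncomputable instance : Ring (SRight f b) :=
  inferInstanceAs (Ring (HRight f b ⧸ subOneIdeal (HRight.D f b)))

noncomputable instance : HopfAlgebra k (SRight f b) :=
  haveI := subOneIdeal_isHopfIdeal (HRight.isGroupLikeElem_D f b)
  inferInstanceAs (HopfAlgebra k (HRight f b ⧸ subOneIdeal (HRight.D f b)))

/-- The image of the matrix `(a_{ij})` in `S(f)`. -/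
noncomputable def A : Matrix (Fin n) (Fin n) (SRight f b) :=
  (HRight.A f b).map (Ideal.Quotient.mk (subOneIdeal (HRight.D f b)))

end SRight

end Quotient

/-! ### Superpotential algebras -/

section Superpotential

variable {k : Type u} [Field k] {m n : ℕ}

/-- The multi-index `(i₁, …, i_{m-N}, j₁, …, j_N)`. -/
def splice {N : ℕ} (I : Fin (m - N) → Fin n) (J : Fin N → Fin n) : Fin m → Fin n :=
  fun s => if h : s.val < m - N then I ⟨s, h⟩ else J ⟨s - (m - N), by omega⟩

/-- The relations `∑_{j₁, …, j_N} c_{i₁ ⋯ i_{m-N} j₁ ⋯ j_N} x_{j₁} ⋯ x_{j_N} = 0`. -/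
inductive SuperpotentialRel (c : (Fin m → Fin n) → k) (N : ℕ) :
    FreeAlgebra k (Fin n) → FreeAlgebra k (Fin n) → Prop
  | rel (I : Fin (m - N) → Fin n) : SuperpotentialRel c N
      (∑ J : Fin N → Fin n, c (splice I J) • (List.ofFn fun s => FreeAlgebra.ι k (J s)).prod) 0

/-- The superpotential algebra `k⟨x₁, …, x_n⟩ / (∑_J c_{I J} x_{j₁} ⋯ x_{j_N})`; for the
coefficients `c` of an `m`-linear form `t` on `Z` this is `A(t, N) = T(Z*) / ∂^{m-N}(k t*)`,
with `x₁, …, x_n` the basis of `Z*` dual to the chosen basis of `Z`. -/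
def SuperpotentialAlgebra (c : (Fin m → Fin n) → k) (N : ℕ) : Type u :=
  RingQuot (SuperpotentialRel c N)

namespace SuperpotentialAlgebra

variable (c : (Fin m → Fin n) → k) (N : ℕ)

noncomputable instance : Ring (SuperpotentialAlgebra c N) := inferInstanceAs (Ring (RingQuot _))
noncomputable instance : Algebra k (SuperpotentialAlgebra c N) :=
  inferInstanceAs (Algebra k (RingQuot _))

/-- The generators `x_i`. -/
noncomputable def x (i : Fin n) : SuperpotentialAlgebra c N :=
  RingQuot.mkAlgHom k (SuperpotentialRel c N) (FreeAlgebra.ι k i)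

/-- The homogeneous component of degree `j`, spanned by the words of length `j`. -/
noncomputable def degreePart (j : ℕ) : Submodule k (SuperpotentialAlgebra c N) :=
  Submodule.span k (Set.range fun J : Fin j → Fin n => (List.ofFn fun s => x c N (J s)).prod)

/-- The augmentation `x_i ↦ 0`. -/
noncomputable def augmentation (hN : 2 ≤ N) : SuperpotentialAlgebra c N →ₐ[k] k :=
  RingQuot.liftAlgHom k ⟨FreeAlgebra.lift k fun _ => 0, by
    rintro _ _ ⟨I⟩
    obtain ⟨N, rfl⟩ : ∃ q, N = q + 1 := ⟨N - 1, by omega⟩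
    simp [map_list_prod, List.map_ofFn, Function.comp_def, List.ofFn_succ]⟩

end SuperpotentialAlgebra

end Superpotential

/-! ### Tor and Ext of an augmented algebra through the bar construction -/

section Bar

variable (k : Type u) [Field k] (A : Type u) [Ring A] [Algebra k A]

/-- `B_i = A ⊗ (A ⊗ (⋯ ⊗ k))` with `i` factors `A`. -/
noncomputable def bar : ℕ → ModuleCat.{u} k
  | 0 => ModuleCat.of k k
  | i + 1 => ModuleCat.of k (A ⊗[k] bar i)

variable {k A}

/-- The differentials of the bar resolution `⋯ → A ⊗ B₂ → A ⊗ B₁ → A ⊗ B₀ → k` of the trivial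
left module by free left modules, where `A ⊗ B_i = B_{i+1}`:
`a₀ ⊗ ⋯ ⊗ a_i ↦ ∑_j (-1)^j a₀ ⊗ ⋯ ⊗ a_j a_{j+1} ⊗ ⋯ ⊗ a_i + (-1)^i a₀ ⊗ ⋯ ⊗ a_{i-1} ε(a_i)`. -/
noncomputable def barRes (ε : A →ₐ[k] k) : (i : ℕ) → A ⊗[k] bar k A i →ₗ[k] bar k A i
  | 0 => (TensorProduct.lid k k).toLinearMap ∘ₗ ε.toLinearMap.rTensor k
  | i + 1 => show A ⊗[k] (A ⊗[k] bar k A i) →ₗ[k] A ⊗[k] bar k A i from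
      (LinearMap.mul' k A).rTensor (bar k A i) ∘ₗ
        (TensorProduct.assoc k A A (bar k A i)).symm.toLinearMap - (barRes ε i).lTensor A

/-- The differential of the bar complex `k ⊗_A (A ⊗ B_•) = B_•`:
`a₁ ⊗ ⋯ ⊗ a_{i+1} ↦ ε(a₁) a₂ ⊗ ⋯ ⊗ a_{i+1} - a₁ a₂ ⊗ ⋯ ⊗ a_{i+1} + ⋯`. -/
noncomputable def barD (ε : A →ₐ[k] k) (i : ℕ) : A ⊗[k] bar k A i →ₗ[k] bar k A i :=
  (TensorProduct.lid k (bar k A i)).toLinearMap ∘ₗ ε.toLinearMap.rTensor (bar k A i) - barRes ε i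

/-- The `i`-cycles of the bar complex. -/
noncomputable def barCycles (ε : A →ₐ[k] k) : (i : ℕ) → Submodule k (bar k A i)
  | 0 => ⊤
  | i + 1 => LinearMap.ker (barD ε i)

/-- The `i`-boundaries of the bar complex; `Tor_i^A(k, k)` is cycles modulo boundaries, and
`Ext^i_A(k, k)` is the space of linear forms on `B_i` vanishing on the boundaries, modulo those
vanishing on the cycles, that is, the dual of `Tor_i^A(k, k)`. -/
noncomputable def barBoundaries (ε : A →ₐ[k] k) (i : ℕ) : Submodule k (bar k A i) :=
  LinearMap.range (barD ε i)

/-- The part of `B_i` of internal degree `j`, for a grading `𝒜` of `A`. -/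
noncomputable def barDegree (𝒜 : ℕ → Submodule k A) : (i j : ℕ) → Submodule k (bar k A i)
  | 0, j => if j = 0 then ⊤ else ⊥
  | i + 1, j => Submodule.span k {y : A ⊗[k] bar k A i | ∃ p q : ℕ, p + q = j ∧
      ∃ a ∈ 𝒜 p, ∃ w ∈ barDegree 𝒜 i q, y = a ⊗ₜ[k] w}

end Bar

/-! ### Artin–Schelter regular and `N`-Koszul algebras -/

section Regular

variable {k : Type u} [Field k] {A : Type u} [Ring A] [Algebra k A]

/-- The trivial left module `k`. -/
noncomputable def trivialLeft (ε : A →ₐ[k] k) : ModuleCat.{u} A :=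
  (ModuleCat.restrictScalars (ε : A →+* k)).obj (ModuleCat.of k k)

/-- The trivial right module `k`, as a left module over the opposite algebra. -/
noncomputable def trivialRight (ε : A →ₐ[k] k) : ModuleCat.{u} Aᵐᵒᵖ :=
  (ModuleCat.restrictScalars ((ε : A →+* k).fromOpposite fun _ _ => Commute.all _ _)).obj
    (ModuleCat.of k k)

/-- `A = ⨁ 𝒜 j` is a connected `ℕ`-graded algebra with augmentation `ε`. -/
structure IsConnectedGraded (𝒜 : ℕ → Submodule k A) (ε : A →ₐ[k] k) : Prop where
  internal : DirectSum.IsInternal 𝒜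
  graded : SetLike.GradedMonoid 𝒜
  connected : 𝒜 0 = 1
  augmentation : ∀ j, 0 < j → ∀ a ∈ 𝒜 j, ε a = 0

/-- `A` is Artin–Schelter regular of dimension `d`: it is connected graded, has global dimension
`d` and injective dimension `d` on both sides, and `Ext^i_A(k, A)` is `k` for `i = d` and `0`
otherwise, both for left and for right modules. -/
structure IsASRegular (𝒜 : ℕ → Submodule k A) (ε : A →ₐ[k] k) (d : ℕ) : Prop where
  connectedGraded : IsConnectedGraded 𝒜 ε
  gldim_left : (⨆ M : ModuleCat.{u} A, projectiveDimension M) = (d : WithBot ℕ∞)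
  gldim_right : (⨆ M : ModuleCat.{u} Aᵐᵒᵖ, projectiveDimension M) = (d : WithBot ℕ∞)
  injdim_left : injectiveDimension (ModuleCat.of A A) = (d : WithBot ℕ∞)
  injdim_right : injectiveDimension (ModuleCat.of Aᵐᵒᵖ A) = (d : WithBot ℕ∞)
  ext_left : Nonempty (Abelian.Ext (trivialLeft ε) (ModuleCat.of A A) d ≃ₗ[k] k)
  ext_left_ne : ∀ i, i ≠ d → Subsingleton (Abelian.Ext (trivialLeft ε) (ModuleCat.of A A) i)
  ext_right : Nonempty (Abelian.Ext (trivialRight ε) (ModuleCat.of Aᵐᵒᵖ A) d ≃ₗ[k] k)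
  ext_right_ne : ∀ i, i ≠ d → Subsingleton (Abelian.Ext (trivialRight ε) (ModuleCat.of Aᵐᵒᵖ A) i)

/-- `ν_N(2i) = N i` and `ν_N(2i + 1) = N i + 1`. -/
def koszulDegree (N i : ℕ) : ℕ := if Even i then N * (i / 2) else N * (i / 2) + 1

/-- An `N`-homogeneous algebra is `N`-Koszul if `Tor_i^A(k, k)` is concentrated in internal degree
`ν_N(i)` for all `i`. -/
def IsNKoszul (𝒜 : ℕ → Submodule k A) (ε : A →ₐ[k] k) (N : ℕ) : Prop :=
  ∀ i j, j ≠ koszulDegree N i → barCycles ε i ⊓ barDegree 𝒜 i j ≤ barBoundaries ε i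

end Regular

/-! ### Coactions -/

section Coaction

variable (k : Type u) [Field k] (K : Type w) [Ring K] [HopfAlgebra k K]
  {A : Type u} [Ring A] [Algebra k A] (𝒜 : ℕ → Submodule k A)

/-- A left coaction of the Hopf algebra `K` on the algebra `A` preserving the grading `𝒜`, that
is, a structure of graded left `K`-comodule algebra on `A`. -/
structure LeftCoaction where
  toAlgHom : A →ₐ[k] K ⊗[k] A
  coassoc : ∀ a, TensorProduct.assoc k K K A (Coalgebra.comul.rTensor A (toAlgHom a)) =
    toAlgHom.toLinearMap.lTensor K (toAlgHom a)
  counit : ∀ a, TensorProduct.lid k A (Coalgebra.counit.rTensor A (toAlgHom a)) = a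
  graded : ∀ j, ∀ a ∈ 𝒜 j, toAlgHom a ∈ LinearMap.range ((𝒜 j).subtype.lTensor K)

/-- A right coaction of the Hopf algebra `K` on the algebra `A` preserving the grading `𝒜`, that
is, a structure of graded right `K`-comodule algebra on `A`. -/
structure RightCoaction where
  toAlgHom : A →ₐ[k] A ⊗[k] K
  coassoc : ∀ a, TensorProduct.assoc k A K K (toAlgHom.toLinearMap.rTensor K (toAlgHom a)) =
    Coalgebra.comul.lTensor A (toAlgHom a)
  counit : ∀ a, TensorProduct.rid k A (Coalgebra.counit.lTensor A (toAlgHom a)) = a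
  graded : ∀ j, ∀ a ∈ 𝒜 j, toAlgHom a ∈ LinearMap.range ((𝒜 j).subtype.rTensor K)

variable {k K 𝒜}

namespace LeftCoaction

/-- The diagonal coaction on the bar complex:
`a₁ ⊗ ⋯ ⊗ a_i ↦ (a₁)₍₋₁₎ ⋯ (a_i)₍₋₁₎ ⊗ ((a₁)₍₀₎ ⊗ ⋯ ⊗ (a_i)₍₀₎)`. -/
noncomputable def bar (ρ : LeftCoaction k K 𝒜) :
    (i : ℕ) → PreregularQuantumGroup.bar k A i →ₗ[k] K ⊗[k] PreregularQuantumGroup.bar k A i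
  | 0 => TensorProduct.mk k K k 1
  | i + 1 => show A ⊗[k] PreregularQuantumGroup.bar k A i →ₗ[k]
        K ⊗[k] (A ⊗[k] PreregularQuantumGroup.bar k A i) from
      (LinearMap.mul' k K).rTensor (A ⊗[k] PreregularQuantumGroup.bar k A i) ∘ₗ
        (TensorProduct.tensorTensorTensorComm k K A K
          (PreregularQuantumGroup.bar k A i)).toLinearMap ∘ₗ
        TensorProduct.map ρ.toAlgHom.toLinearMap (bar ρ i)

/-- `D` is the homological codeterminant of a left coaction on an Artin–Schelter regular algebra
of dimension `d`: `D` is grouplike and `K` coacts on the line `Tor_d^A(k, k)` by `z ↦ D ⊗ z`, so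
that, applying the antipode, it coacts on the dual line `Ext^d_A(k, k)` by `𝔢 ↦ 𝔢 ⊗ D⁻¹`. The
classes of `Ext^d_A(k, k)` are represented by cocycles `φ`. -/
def IsHomologicalCodeterminant (ρ : LeftCoaction k K 𝒜) (ε : A →ₐ[k] k) (d : ℕ) (D : K) : Prop :=
  IsGroupLikeElem k D ∧
  ∀ φ : PreregularQuantumGroup.bar k A d →ₗ[k] k, (∀ z ∈ barBoundaries ε d, φ z = 0) →
    ∀ z ∈ barCycles ε d, TensorProduct.rid k K (φ.lTensor K (ρ.bar d z)) = φ z • D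

/-- `K`, with its coaction `ρ`, is the left quantum general linear group of `A`: any left coaction
of a Hopf algebra on `A` is induced by a unique morphism of Hopf algebras from `K`. (A morphism of
Hopf algebras is a morphism of bialgebras; it automatically commutes with the antipodes.) -/
def IsQuantumGL (ρ : LeftCoaction k K 𝒜) : Prop :=
  ∀ (L : Type w') [Ring L] [HopfAlgebra k L] (ρL : LeftCoaction k L 𝒜),
    ∃! φ : K →ₐc[k] L, ∀ a, (φ : K →ₗ[k] L).rTensor A (ρ.toAlgHom a) = ρL.toAlgHom a

/-- `K`, with its coaction `ρ`, is the left quantum special linear group of `A`: it coacts with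
trivial homological codeterminant, and universally so. -/
def IsQuantumSL (ρ : LeftCoaction k K 𝒜) (ε : A →ₐ[k] k) (d : ℕ) : Prop :=
  ρ.IsHomologicalCodeterminant ε d 1 ∧
  ∀ (L : Type w') [Ring L] [HopfAlgebra k L] (ρL : LeftCoaction k L 𝒜),
    ρL.IsHomologicalCodeterminant ε d 1 →
    ∃! φ : K →ₐc[k] L, ∀ a, (φ : K →ₗ[k] L).rTensor A (ρ.toAlgHom a) = ρL.toAlgHom a

end LeftCoaction

namespace RightCoaction

/-- The diagonal coaction on the bar complex:
`a₁ ⊗ ⋯ ⊗ a_i ↦ ((a₁)₍₀₎ ⊗ ⋯ ⊗ (a_i)₍₀₎) ⊗ (a₁)₍₁₎ ⋯ (a_i)₍₁₎`. -/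
noncomputable def bar (ρ : RightCoaction k K 𝒜) :
    (i : ℕ) → PreregularQuantumGroup.bar k A i →ₗ[k] PreregularQuantumGroup.bar k A i ⊗[k] K
  | 0 => (TensorProduct.mk k k K).flip 1
  | i + 1 => show A ⊗[k] PreregularQuantumGroup.bar k A i →ₗ[k]
        (A ⊗[k] PreregularQuantumGroup.bar k A i) ⊗[k] K from
      (LinearMap.mul' k K).lTensor (A ⊗[k] PreregularQuantumGroup.bar k A i) ∘ₗ
        (TensorProduct.tensorTensorTensorComm k A K
          (PreregularQuantumGroup.bar k A i) K).toLinearMap ∘ₗ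
        TensorProduct.map ρ.toAlgHom.toLinearMap (bar ρ i)

/-- `D` is the homological codeterminant of a right coaction on an Artin–Schelter regular algebra
of dimension `d`: `D` is grouplike and `K` coacts on the line `Tor_d^A(k, k)` by `z ↦ z ⊗ D⁻¹`,
where `D⁻¹ = S(D)`, so that, applying the antipode, it coacts on the dual line `Ext^d_A(k, k)` by
`𝔢 ↦ D ⊗ 𝔢`. The classes of `Ext^d_A(k, k)` are represented by cocycles `φ`. -/
def IsHomologicalCodeterminant (ρ : RightCoaction k K 𝒜) (ε : A →ₐ[k] k) (d : ℕ) (D : K) : Prop :=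
  IsGroupLikeElem k D ∧
  ∀ φ : PreregularQuantumGroup.bar k A d →ₗ[k] k, (∀ z ∈ barBoundaries ε d, φ z = 0) →
    ∀ z ∈ barCycles ε d,
      TensorProduct.lid k K (φ.rTensor K (ρ.bar d z)) = φ z • HopfAlgebra.antipode k D

/-- `K`, with its coaction `ρ`, is the right quantum general linear group of `A`: any right
coaction of a Hopf algebra on `A` is induced by a unique morphism of Hopf algebras from `K`. -/
def IsQuantumGL (ρ : RightCoaction k K 𝒜) : Prop :=
  ∀ (L : Type w') [Ring L] [HopfAlgebra k L] (ρL : RightCoaction k L 𝒜),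
    ∃! φ : K →ₐc[k] L, ∀ a, (φ : K →ₗ[k] L).lTensor A (ρ.toAlgHom a) = ρL.toAlgHom a

/-- `K`, with its coaction `ρ`, is the right quantum special linear group of `A`: it coacts with
trivial homological codeterminant, and universally so. -/
def IsQuantumSL (ρ : RightCoaction k K 𝒜) (ε : A →ₐ[k] k) (d : ℕ) : Prop :=
  ρ.IsHomologicalCodeterminant ε d 1 ∧
  ∀ (L : Type w') [Ring L] [HopfAlgebra k L] (ρL : RightCoaction k L 𝒜),
    ρL.IsHomologicalCodeterminant ε d 1 →
    ∃! φ : K →ₐc[k] L, ∀ a, (φ : K →ₗ[k] L).lTensor A (ρ.toAlgHom a) = ρL.toAlgHom a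

end RightCoaction

end Coaction

end PreregularQuantumGroup

open PreregularQuantumGroup

/-! Everything rests on one fact: among the tensors of degree m all of whose subwords of length N
are relations (`potentials`), the superpotential is unique up to a scalar. It is such a tensor
because its last N slots give the defining relations and twisted cyclicity rotates any other N
consecutive slots to the end (`wordCoeff_mem_potentials`); it is nonzero by nondegeneracy
(`coeff_ne_zero_of_isASRegular`).

Uniqueness combines the two hypotheses on A. Cutting words into pieces of length 1 and N - 1 sends
potentials of degree ν_N(d) to cycles of the bar complex, and N-Koszulity makes the resulting map to
Tor_d(k, k) injective (`eq_zero_of_cutTensor_mem_barBoundaries`). Regularity bounds Tor_d(k, k) by a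
line: with A₊ the augmentation ideal, Ext^{d+1}(k, A₊) = 0, so the line Ext^d(k, A) maps onto
Ext^d(k, k) (`exists_combination_of_ext_line`).

A graded left coaction of K on A is given by a matrix α over K on the generators. Each linear form
on K turns the α-transform of the superpotential into a potential, hence into a multiple of the
superpotential; so α multiplies the superpotential by some g in K (`exists_factor`). Then g is
grouplike, and α, S(α), g, S(g) satisfy the relations of H(e), which yields the map H(e) → K. It is
unique because the a_{ij} determine D through a nonzero coefficient, and 𝔹 and D⁻¹ as inverses
(`HLeft.algHom_ext_A`).

Conversely, a matrix scaling the superpotential acts on A once its transpose has a left inverse,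
which strips the first m - N slots and leaves a statement about relations (`exists_coaction`). For
H(e) that inverse comes from the twist (`LeftRelations.exists_transpose_inverse`).

The class of the superpotential spans Tor_d(k, k), and the coaction multiplies it by the same g
(`coBar_top`). Trivial homological codeterminant therefore means g = 1, which is the universal
property of S(e). Right coactions are treated by exchanging the tensor factors and transposing the
matrix. -/

namespace PreregularQuantumGroup

/-! ### Dimension shifting along a projective resolution -/

section DimensionShift

open Abelian

variable {C : Type u} [Category.{v} C] [Abelian C] [HasExt.{w} C]
  {Z P : ℕ → C} {f : ∀ i, Z (i + 1) ⟶ P i} {g : ∀ i, P i ⟶ Z i} {zero : ∀ i, f i ≫ g i = 0}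

/-- The iterated extension class in `Ext^i(Z 0, Z i)` of short exact sequences
`0 → Z (i + 1) → P i → Z i → 0`. -/
noncomputable def syzygyClass (hS : ∀ i, (ShortComplex.mk (f i) (g i) (zero i)).ShortExact) :
    (i : ℕ) → Ext (Z 0) (Z i) i
  | 0 => Ext.mk₀ (𝟙 _)
  | i + 1 => (syzygyClass hS i).comp (hS i).extClass rfl

/-- Composition with the syzygy class is an iterate of the connecting maps from Ext^a(Z (i + 1), X)
to Ext^{a+1}(Z i, X). Each is injective for a ≥ 1 because Ext^a(P i, X) = 0; for a = 0 its kernel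
consists of the maps that extend to P i. -/
theorem eq_zero_of_syzygyClass_comp [∀ i, Projective (P i)]
    (hS : ∀ i, (ShortComplex.mk (f i) (g i) (zero i)).ShortExact) {X : C} (i : ℕ) :
    ∀ (a : ℕ), a ≠ 0 → ∀ x : Ext (Z i) X a, (syzygyClass hS i).comp x rfl = 0 → x = 0 := by
  induction i with
  | zero =>
    intro a _ x hx
    have h : 0 + a = a := zero_add a
    have := Ext.mk₀_id_comp x
    rw [← this]
    have key : ∀ (c : ℕ) (hc : 0 + a = c), (Ext.mk₀ (𝟙 (Z 0))).comp x hc = 0 := by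
      rintro c rfl
      exact hx
    exact key _ _
  | succ i ih =>
    intro a ha x hx
    -- The degrees i + 1 + a and i + (1 + a) are not definitionally equal, so associativity is
    -- stated in an arbitrary degree c equal to the first.
    have key : ∀ (c : ℕ) (hc : i + 1 + a = c), ((syzygyClass hS i).comp (hS i).extClass rfl).comp x hc =
        (syzygyClass hS i).comp ((hS i).extClass.comp x (rfl : 1 + a = 1 + a)) (by omega) := by
      rintro c hc
      rw [Ext.comp_assoc]
      omega
    have h0 : (hS i).extClass.comp x (rfl : 1 + a = 1 + a) = 0 := by
      refine ih (1 + a) (by omega) _ ?_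
      have h2 := key (i + (1 + a)) (by omega)
      rw [← h2]
      have : ∀ (c : ℕ) (hc : i + 1 + a = c),
        ((syzygyClass hS i).comp (hS i).extClass rfl).comp x hc = 0 := by
        rintro c rfl
        exact hx
      exact this _ _
    obtain ⟨y, hy⟩ := Ext.contravariant_sequence_exact₁ (hS i) X x rfl h0
    rw [← hy]
    have : y = 0 := Ext.eq_zero_of_hasProjectiveDimensionLT y 1 (by omega)
    rw [this, Ext.comp_zero]

/-- The obstruction to extending φ over P i is its image in Ext^1(Z i, X). Dimension shifting is
injective from degree 1 on, so the obstruction vanishes as soon as its image in Ext^{i+1}(Z 0, X)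
does. -/
theorem extends_of_syzygyClass_comp_eq_zero [∀ i, Projective (P i)]
    (hS : ∀ i, (ShortComplex.mk (f i) (g i) (zero i)).ShortExact) {X : C} {i : ℕ}
    (φ : Z (i + 1) ⟶ X) (hφ : (syzygyClass hS (i + 1)).comp (Ext.mk₀ φ) (add_zero _) = 0) :
    ∃ h : P i ⟶ X, f i ≫ h = φ := by
  have h0 : (hS i).extClass.comp (Ext.mk₀ φ) (add_zero 1) = 0 := by
    refine eq_zero_of_syzygyClass_comp hS i 1 one_ne_zero _ ?_
    rw [← hφ, syzygyClass, Ext.comp_assoc]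
    rfl
  obtain ⟨y, hy⟩ := Ext.contravariant_sequence_exact₁ (hS i) X (Ext.mk₀ φ) (add_zero 1) h0
  obtain ⟨h, rfl⟩ := (Ext.mk₀_bijective _ _).2 y
  refine ⟨h, (Ext.mk₀_bijective _ _).1 ?_⟩
  simpa using hy

/-- If `Ext^{i+1}(Z 0, Y)` is a line and `Ext^{i+2}(Z 0, K) = 0` for `0 → K → Y → X → 0`, then any
two maps from the `(i+1)`-st syzygy to `X` become dependent modulo maps that extend to `P i`. -/
theorem exists_extension_of_ext_line {k : Type w'} [Field k] [Linear k C] [∀ i, Projective (P i)]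
    (hS : ∀ i, (ShortComplex.mk (f i) (g i) (zero i)).ShortExact) {i : ℕ}
    {T : ShortComplex C} (hT : T.ShortExact) (h₁ : Subsingleton (Ext (Z 0) T.X₁ (i + 2)))
    (h₂ : Nonempty (Ext (Z 0) T.X₂ (i + 1) ≃ₗ[k] k)) (φ ψ : Z (i + 1) ⟶ T.X₃) :
    ∃ a b : k, (a ≠ 0 ∨ b ≠ 0) ∧ ∃ h : P i ⟶ T.X₃, f i ≫ h = a • φ + b • ψ := by
  obtain ⟨E⟩ := h₂
  -- Both classes lift to the line Ext^{i+1}(Z 0, T.X₂), the obstructions lying in the zero space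
  -- Ext^{i+2}(Z 0, T.X₁).
  obtain ⟨x, hx⟩ := Ext.covariant_sequence_exact₃ (Z 0) hT
    ((syzygyClass hS (i + 1)).comp (Ext.mk₀ φ) (add_zero _)) rfl (Subsingleton.elim _ _)
  obtain ⟨y, hy⟩ := Ext.covariant_sequence_exact₃ (Z 0) hT
    ((syzygyClass hS (i + 1)).comp (Ext.mk₀ ψ) (add_zero _)) rfl (Subsingleton.elim _ _)
  -- In a line with coordinate E the relation is E(y) x - E(x) y = 0; it is trivial only if E(x) =
  -- E(y) = 0, and when E(x) = 0 the element x already vanishes.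
  obtain ⟨a, b, hab, h⟩ : ∃ a b : k, (a ≠ 0 ∨ b ≠ 0) ∧ a • x + b • y = 0 := by
    by_cases hE : E x = 0
    · refine ⟨1, 0, Or.inl one_ne_zero, ?_⟩
      simp [E.map_eq_zero_iff.1 hE]
    · refine ⟨E y, - E x, Or.inr (neg_ne_zero.2 hE), E.injective ?_⟩
      simp [mul_comm]
  refine ⟨a, b, hab, extends_of_syzygyClass_comp_eq_zero hS _ ?_⟩
  rw [Ext.mk₀_add, Ext.mk₀_smul, Ext.mk₀_smul, Ext.comp_add, Ext.comp_smul, Ext.comp_smul, ← hx,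
    ← hy, ← Ext.smul_comp, ← Ext.smul_comp, ← Ext.add_comp, h, Ext.zero_comp]

end DimensionShift

/-! ### One step of the bar resolution -/

section BarStep

variable {k : Type u} [Field k] {A : Type u} [Ring A] [Algebra k A]
  {M : Type u} [AddCommGroup M] [Module k M]

/-- The action of `A` on `A ⊗ M`. -/
noncomputable def actLeft (M : Type u) [AddCommGroup M] [Module k M] :
    A ⊗[k] (A ⊗[k] M) →ₗ[k] A ⊗[k] M :=
  (LinearMap.mul' k A).rTensor M ∘ₗ (TensorProduct.assoc k A A M).symm.toLinearMap

@[simp] theorem actLeft_tmul (a b : A) (x : M) : actLeft M (a ⊗ₜ[k] (b ⊗ₜ[k] x)) = (a * b) ⊗ₜ x := by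
  simp [actLeft]

theorem actLeft_one_tmul (y : A ⊗[k] M) : actLeft M ((1 : A) ⊗ₜ[k] y) = y := by
  induction y with
  | zero => simp
  | tmul a x => simp
  | add y z hy hz => rw [TensorProduct.tmul_add, map_add, hy, hz]

theorem actLeft_mul_tmul (a b : A) (y : A ⊗[k] M) :
    actLeft M ((a * b) ⊗ₜ[k] y) = actLeft M (a ⊗ₜ[k] actLeft M (b ⊗ₜ[k] y)) := by
  induction y with
  | zero => simp
  | tmul a x => simp [mul_assoc]
  | add y z hy hz => simp only [TensorProduct.tmul_add, map_add, hy, hz]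

theorem actLeft_eq_smul (a : A) (y : A ⊗[k] M) : actLeft M (a ⊗ₜ[k] y) = a • y := by
  induction y with
  | zero => simp
  | tmul b x => simp [TensorProduct.smul_tmul']
  | add y z hy hz => rw [TensorProduct.tmul_add, map_add, hy, hz, smul_add]

/-- The augmentation `A ⊗ M → M`. -/
noncomputable def evalLeft (ε : A →ₐ[k] k) (M : Type u) [AddCommGroup M] [Module k M] :
    A ⊗[k] M →ₗ[k] M :=
  (TensorProduct.lid k M).toLinearMap ∘ₗ ε.toLinearMap.rTensor M

@[simp] theorem evalLeft_tmul (ε : A →ₐ[k] k) (a : A) (x : M) :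
    evalLeft ε M (a ⊗ₜ[k] x) = ε a • x := by
  simp [evalLeft]

/-- The differential of the bar resolution, given the previous one. -/
noncomputable def barStep (D : A ⊗[k] M →ₗ[k] M) : A ⊗[k] (A ⊗[k] M) →ₗ[k] A ⊗[k] M :=
  actLeft M - D.lTensor A

theorem barStep_tmul (D : A ⊗[k] M →ₗ[k] M) (a : A) (y : A ⊗[k] M) :
    barStep D (a ⊗ₜ[k] y) = actLeft M (a ⊗ₜ[k] y) - a ⊗ₜ[k] D y := by
  simp [barStep]

theorem barStep_one_tmul (D : A ⊗[k] M →ₗ[k] M) (y : A ⊗[k] M) :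
    barStep D ((1 : A) ⊗ₜ[k] y) = y - (1 : A) ⊗ₜ[k] D y := by
  rw [barStep_tmul, actLeft_one_tmul]

theorem barStep_actLeft_tmul (D : A ⊗[k] M →ₗ[k] M) (a : A) (y : A ⊗[k] (A ⊗[k] M)) :
    barStep D (actLeft _ (a ⊗ₜ[k] y)) = actLeft M (a ⊗ₜ[k] barStep D y) := by
  induction y with
  | zero => simp
  | tmul b x => simp [barStep_tmul, TensorProduct.tmul_sub, actLeft_mul_tmul]
  | add y z hy hz => simp only [TensorProduct.tmul_add, map_add, hy, hz]

/-- On a ⊗ y the A-linearity of `barStep D` makes the two terms a · `barStep D y` cancel, and a ⊗ `D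
(barStep D y)` is what remains. -/
theorem barStep_comp_barStep {D : A ⊗[k] M →ₗ[k] M} (hD : ∀ y, D (barStep D y) = 0)
    (y : A ⊗[k] (A ⊗[k] (A ⊗[k] M))) : barStep D (barStep (barStep D) y) = 0 := by
  induction y with
  | zero => simp
  | tmul a y =>
    rw [barStep_tmul (barStep D), map_sub, barStep_actLeft_tmul, barStep_tmul D a, hD]
    simp
  | add y z hy hz => simp [hy, hz]

variable {ε : A →ₐ[k] k}

theorem eval_barStep (y : A ⊗[k] (A ⊗[k] k)) : evalLeft ε k (barStep (evalLeft ε k) y) = 0 := by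
  induction y with
  | zero => simp
  | tmul a y =>
    induction y with
    | zero => simp
    | tmul b x => simp [barStep_tmul, mul_assoc]
    | add y z hy hz => rw [TensorProduct.tmul_add, map_add, map_add, hy, hz, add_zero]
  | add y z hy hz => rw [map_add, map_add, hy, hz, add_zero]

theorem barRes_zero : barRes ε 0 = evalLeft ε k := rfl

theorem barD_eq (i : ℕ) : barD ε i = evalLeft ε (bar k A i) - barRes ε i := rfl

theorem barRes_barRes (i : ℕ) (y : A ⊗[k] (A ⊗[k] bar k A i)) :
    barRes ε i (barStep (barRes ε i) y) = 0 := by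
  induction i with
  | zero => exact eval_barStep y
  | succ i ih => exact barStep_comp_barStep ih y

/-- A lifting property of tensor products over a field. -/
theorem lTensor_mem_range {X Y X' : Type*} [AddCommGroup X] [AddCommGroup Y] [AddCommGroup X']
    [Module k X] [Module k Y] [Module k X'] (f : X →ₗ[k] Y) (r : X →ₗ[k] X) (g : X' →ₗ[k] X)
    (h : ∀ x, f x = 0 → r x ∈ LinearMap.range g) (y : A ⊗[k] X) (hy : f.lTensor A y = 0) :
    ∃ y' : A ⊗[k] X', g.lTensor A y' = r.lTensor A y := by
  -- Flatness over the field identifies the kernel of id ⊗ f with A ⊗ ker f.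
  have h1 : y ∈ LinearMap.range ((LinearMap.ker f).subtype.lTensor A) := by
    exact (Module.Flat.lTensor_exact A (LinearMap.exact_subtype_ker_map f) y).1 hy
  obtain ⟨v, rfl⟩ := h1
  let r' : LinearMap.ker f →ₗ[k] LinearMap.range g :=
    (r ∘ₗ (LinearMap.ker f).subtype).codRestrict _ fun x => h x x.2
  -- A linear section of g onto its range makes the choice of preimages linear, so that it can be
  -- tensored with A.
  obtain ⟨s, hs⟩ := g.rangeRestrict.exists_rightInverse_of_surjective (LinearMap.range_rangeRestrict g)
  refine ⟨(s ∘ₗ r').lTensor A v, ?_⟩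
  have : g ∘ₗ (s ∘ₗ r') = r ∘ₗ (LinearMap.ker f).subtype := by
    ext x
    exact congrArg Subtype.val (LinearMap.congr_fun hs (r' x))
  rw [← LinearMap.comp_apply, ← LinearMap.lTensor_comp, this, LinearMap.lTensor_comp,
    LinearMap.comp_apply]

end BarStep

/-! ### Homogeneous components -/

section Components

open Finset.HasAntidiagonal (antidiagonal mem_antidiagonal)

variable {k : Type u} [Field k] {A : Type u} [Ring A] [Algebra k A]
  {𝒜 : ℕ → Submodule k A} {ε : A →ₐ[k] k}

/-- The projection to the component of degree `p`. -/
noncomputable def component (h : DirectSum.IsInternal 𝒜) (p : ℕ) : A →ₗ[k] A :=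
  (𝒜 p).subtype ∘ₗ DirectSum.component k ℕ (fun j => 𝒜 j) p ∘ₗ
    (LinearEquiv.ofBijective (DirectSum.coeLinearMap 𝒜)
      (show Function.Bijective (DirectSum.coeLinearMap 𝒜) from h)).symm.toLinearMap

theorem component_mem (h : DirectSum.IsInternal 𝒜) (p : ℕ) (a : A) : component h p a ∈ 𝒜 p := by
  simp [component]

theorem component_of_mem (h : DirectSum.IsInternal 𝒜) (p q : ℕ) {a : A} (ha : a ∈ 𝒜 q) :
    component h p a = if p = q then a else 0 := by
  have : (LinearEquiv.ofBijective (DirectSum.coeLinearMap 𝒜)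
      (show Function.Bijective (DirectSum.coeLinearMap 𝒜) from h)).symm a =
      DirectSum.lof k ℕ (fun j => 𝒜 j) q ⟨a, ha⟩ :=
    (LinearEquiv.symm_apply_eq _).2 (DirectSum.coeLinearMap_lof 𝒜 q ⟨a, ha⟩).symm
  simp only [component, LinearMap.comp_apply, LinearEquiv.coe_coe, this]
  split_ifs with hpq
  · subst hpq
    simp [DirectSum.component.lof_self]
  · rw [DirectSum.component.of, dif_neg (Ne.symm hpq)]
    simp

@[elab_as_elim]
theorem homogeneous_induction (h : DirectSum.IsInternal 𝒜) {motive : A → Prop} (a : A)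
    (mem : ∀ p, ∀ a ∈ 𝒜 p, motive a) (zero : motive 0)
    (add : ∀ a b, motive a → motive b → motive (a + b)) : motive a := by
  have ha : a ∈ ⨆ p, 𝒜 p := by rw [h.submodule_iSup_eq_top]; trivial
  exact Submodule.iSup_induction 𝒜 (motive := motive) ha mem zero add

theorem component_component (h : DirectSum.IsInternal 𝒜) (p q : ℕ) (a : A) :
    component h p (component h q a) = if p = q then component h p a else 0 := by
  rw [component_of_mem h p q (component_mem h q a)]
  split_ifs with hpq
  · rw [hpq]
  · rfl

theorem component_mul (h : IsConnectedGraded 𝒜 ε) (p : ℕ) (a b : A) :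
    component h.internal p (a * b) = ∑ q ∈ antidiagonal p,
      component h.internal q.1 a * component h.internal q.2 b := by
  have := h.graded
  refine homogeneous_induction h.internal a ?_ (by simp) ?_
  · intro i a ha
    refine homogeneous_induction h.internal b ?_ (by simp) ?_
    · intro j b hb
      rw [component_of_mem _ _ _ (SetLike.GradedMul.mul_mem ha hb)]
      simp only [component_of_mem h.internal _ _ ha, component_of_mem h.internal _ _ hb]
      split_ifs with hp
      · rw [Finset.sum_eq_single (i, j)]
        · simp
        · rintro ⟨x, y⟩ _ hxy
          by_cases hx : x = i
          · have hy : y ≠ j := fun hy => hxy (by rw [hx, hy])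
            simp [hy]
          · simp [hx]
        · intro hn
          exact absurd (mem_antidiagonal.2 hp.symm) hn
      · symm
        refine Finset.sum_eq_zero ?_
        rintro ⟨x, y⟩ hxy
        rw [mem_antidiagonal] at hxy
        by_cases hx : x = i
        · have hy : y ≠ j := fun hy => hp (by rw [← hxy, hx, hy])
          simp [hy]
        · simp [hx]
    · intro b b' hb hb'
      simp only [mul_add, map_add, hb, hb', Finset.sum_add_distrib]
  · intro b b' hb hb'
    simp only [add_mul, map_add, hb, hb', Finset.sum_add_distrib]

/-- Connectedness makes degree 0 the scalars, and ε vanishes in positive degrees; this is how ε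
enters the lowest components of the differentials. -/
theorem component_zero (h : IsConnectedGraded 𝒜 ε) (a : A) :
    component h.internal 0 a = algebraMap k A (ε a) := by
  refine homogeneous_induction h.internal a ?_ (by simp) ?_
  · intro p a ha
    rw [component_of_mem _ _ _ ha]
    split_ifs with hp
    · subst hp
      rw [h.connected] at ha
      obtain ⟨c, rfl⟩ := Submodule.mem_one.1 ha
      simp
    · rw [h.augmentation p (by omega) a ha, map_zero]
  · intro a b ha hb
    simp only [map_add, ha, hb]

variable {M : Type u} [AddCommGroup M] [Module k M]

/-- The projection of `A ⊗ M` to the part of total degree `j`, for projections `P q` of `M` to the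
part of degree `q`. -/
noncomputable def totalComponent (h : DirectSum.IsInternal 𝒜) (P : ℕ → M →ₗ[k] M) (j : ℕ) :
    A ⊗[k] M →ₗ[k] A ⊗[k] M :=
  ∑ q ∈ antidiagonal j, TensorProduct.map (component h q.1) (P q.2)

theorem totalComponent_tmul (h : DirectSum.IsInternal 𝒜) (P : ℕ → M →ₗ[k] M) (j : ℕ) (a : A)
    (x : M) : totalComponent h P j (a ⊗ₜ[k] x) =
      ∑ q ∈ antidiagonal j, component h q.1 a ⊗ₜ[k] P q.2 x := by
  simp [totalComponent, LinearMap.sum_apply]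

theorem totalComponent_map (h : DirectSum.IsInternal 𝒜) {P : ℕ → M →ₗ[k] M}
    (hP : ∀ j x, P j (P j x) = P j x) (p q : ℕ) (y : A ⊗[k] M) :
    totalComponent h P (p + q) (TensorProduct.map (component h p) (P q) y) =
      TensorProduct.map (component h p) (P q) y := by
  induction y with
  | zero => simp
  | tmul a x =>
    rw [TensorProduct.map_tmul, totalComponent_tmul, Finset.sum_eq_single (p, q)]
    · rw [component_component, if_pos rfl, hP]
    · rintro ⟨i, j⟩ hij hne
      rw [component_component, if_neg, TensorProduct.zero_tmul]
      rintro rfl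
      rw [mem_antidiagonal] at hij
      exact hne (by simp at hij; simp [hij])
    · simp
  | add y z hy hz => simp only [map_add, hy, hz]

theorem totalComponent_idem (h : DirectSum.IsInternal 𝒜) {P : ℕ → M →ₗ[k] M}
    (hP : ∀ j x, P j (P j x) = P j x) (j : ℕ) (y : A ⊗[k] M) :
    totalComponent h P j (totalComponent h P j y) = totalComponent h P j y := by
  conv_lhs => enter [2]; rw [totalComponent, LinearMap.sum_apply]
  rw [map_sum, totalComponent, LinearMap.sum_apply]
  refine Finset.sum_congr rfl ?_
  rintro ⟨p, q⟩ hpq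
  rw [mem_antidiagonal] at hpq
  have := totalComponent_map h hP p q y
  simp only at hpq
  rw [hpq] at this
  exact this

theorem map_component_totalComponent (h : DirectSum.IsInternal 𝒜) (P : ℕ → M →ₗ[k] M) (p q : ℕ)
    (y : A ⊗[k] M) :
    (component h p).rTensor M (totalComponent h P (p + q) y) =
      TensorProduct.map (component h p) (P q) y := by
  induction y with
  | zero => simp
  | tmul a x =>
    rw [TensorProduct.map_tmul, totalComponent_tmul, map_sum, Finset.sum_eq_single (p, q)]
    · simp [component_component]
    · rintro ⟨i, j⟩ hij hne
      rw [LinearMap.rTensor_tmul, component_component, if_neg, TensorProduct.zero_tmul]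
      rintro rfl
      rw [mem_antidiagonal] at hij
      exact hne (by simp at hij; simp [hij])
    · simp
  | add y z hy hz => simp only [map_add, hy, hz]

theorem totalComponent_actLeft (h : IsConnectedGraded 𝒜 ε) (P : ℕ → M →ₗ[k] M) (j : ℕ)
    (y : A ⊗[k] (A ⊗[k] M)) :
    totalComponent h.internal P j (actLeft M y) =
      actLeft M (totalComponent h.internal (totalComponent h.internal P) j y) := by
  induction y with
  | zero => simp
  | tmul a y =>
    induction y with
    | zero => simp
    | tmul b x =>
      rw [actLeft_tmul, totalComponent_tmul, totalComponent_tmul, map_sum]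
      simp only [component_mul h, totalComponent_tmul, TensorProduct.sum_tmul,
        TensorProduct.tmul_sum, map_sum, actLeft_tmul]
      -- Both sides sum over triples of degrees with total j; the bijection rebrackets (p + q) + r
      -- as p + (q + r).
      rw [Finset.sum_sigma', Finset.sum_sigma']
      refine Finset.sum_nbij' (fun t => ⟨(t.2.1, t.2.2 + t.1.2), (t.2.2, t.1.2)⟩)
        (fun t => ⟨(t.1.1 + t.2.1, t.2.2), (t.1.1, t.2.1)⟩) ?_ ?_ ?_ ?_ ?_
      · rintro ⟨⟨u, v⟩, ⟨x, y⟩⟩ ht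
        simp at ht ⊢
        omega
      · rintro ⟨⟨u, v⟩, ⟨x, y⟩⟩ ht
        simp at ht ⊢
        omega
      · rintro ⟨⟨u, v⟩, ⟨x, y⟩⟩ ht
        simp at ht ⊢
        omega
      · rintro ⟨⟨u, v⟩, ⟨x, y⟩⟩ ht
        simp at ht ⊢
        omega
      · rintro ⟨⟨u, v⟩, ⟨x, y⟩⟩ ht
        rfl
    | add y z hy hz => simp only [TensorProduct.tmul_add, map_add, hy, hz]
  | add y z hy hz => simp only [map_add, hy, hz]

theorem totalComponent_barStep (h : IsConnectedGraded 𝒜 ε) {P : ℕ → M →ₗ[k] M}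
    {D : A ⊗[k] M →ₗ[k] M} (hD : ∀ j y, P j (D y) = D (totalComponent h.internal P j y)) (j : ℕ)
    (y : A ⊗[k] (A ⊗[k] M)) :
    totalComponent h.internal P j (barStep D y) =
      barStep D (totalComponent h.internal (totalComponent h.internal P) j y) := by
  rw [barStep, LinearMap.sub_apply, LinearMap.sub_apply, map_sub, totalComponent_actLeft h]
  congr 1
  induction y with
  | zero => simp
  | tmul a y =>
    rw [LinearMap.lTensor_tmul, totalComponent_tmul, totalComponent_tmul, map_sum]
    simp only [LinearMap.lTensor_tmul, hD]
  | add y z hy hz => simp only [map_add, hy, hz]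

theorem totalComponent_evalLeft (h : IsConnectedGraded 𝒜 ε) (P : ℕ → M →ₗ[k] M) (j : ℕ)
    (y : A ⊗[k] M) :
    P j (evalLeft ε M y) = evalLeft ε M (totalComponent h.internal P j y) := by
  induction y with
  | zero => simp
  | tmul a x =>
    rw [evalLeft_tmul, totalComponent_tmul, map_sum, Finset.sum_eq_single (0, j)]
    · simp [component_zero h]
    · rintro ⟨p, q⟩ hpq hne
      rw [mem_antidiagonal] at hpq
      have hp : 0 < p := by
        rcases Nat.eq_zero_or_pos p with rfl | hp
        · simp at hpq
          exact absurd (by simp [hpq]) hne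
        · exact hp
      rw [evalLeft_tmul, h.augmentation p hp _ (component_mem _ _ _), zero_smul]
    · simp
  | add y z hy hz => simp only [map_add, hy, hz]

/-- The lowest component of `barStep D y` with respect to the first tensor factor. -/
theorem component_barStep (h : IsConnectedGraded 𝒜 ε) (D : A ⊗[k] M →ₗ[k] M) (p : ℕ)
    (y : A ⊗[k] (A ⊗[k] M))
    (hy : ∀ q < p, (component h.internal q).rTensor (A ⊗[k] M) y = 0) :
    (component h.internal p).rTensor M (barStep D y) =
      (evalLeft ε M - D).lTensor A ((component h.internal p).rTensor (A ⊗[k] M) y) := by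
  have key : ∀ y : A ⊗[k] (A ⊗[k] M), (component h.internal p).rTensor M (actLeft M y) =
      ∑ q ∈ antidiagonal p, actLeft M ((component h.internal q.2).rTensor M |>.lTensor A
        ((component h.internal q.1).rTensor (A ⊗[k] M) y)) := by
    intro y
    induction y with
    | zero => simp
    | tmul a y =>
      induction y with
      | zero => simp
      | tmul b x => simp [component_mul h, TensorProduct.sum_tmul]
      | add y z hy hz =>
        simp only [TensorProduct.tmul_add, map_add, hy, hz, Finset.sum_add_distrib]
    | add y z hy hz => simp only [map_add, hy, hz, Finset.sum_add_distrib]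
  have key2 : ∀ y : A ⊗[k] (A ⊗[k] M),
      actLeft M ((component h.internal 0).rTensor M |>.lTensor A y) =
        (evalLeft ε M).lTensor A y := by
    intro y
    induction y with
    | zero => simp
    | tmul a y =>
      induction y with
      | zero => simp
      | tmul b x =>
        simp [component_zero h, Algebra.algebraMap_eq_smul_one, TensorProduct.smul_tmul]
      | add y z hy hz => simp only [TensorProduct.tmul_add, map_add, hy, hz]
    | add y z hy hz => simp only [map_add, hy, hz]
  -- In the degree p part of a product the pairs (q, p - q) with q < p drop out by `hy`. The pair
  -- (p, 0) remains, and the degree 0 part of the second factor acts through ε.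
  rw [barStep, LinearMap.sub_apply, map_sub, key, Finset.sum_eq_single (p, 0), key2,
    LinearMap.lTensor_sub, LinearMap.sub_apply]
  · congr 1
    rw [← LinearMap.comp_apply, ← LinearMap.comp_apply, LinearMap.rTensor_comp_lTensor,
      LinearMap.lTensor_comp_rTensor]
  · rintro ⟨i, j⟩ hij hne
    rw [mem_antidiagonal] at hij
    have : i < p := by
      rcases Nat.lt_or_ge i p with h | h
      · exact h
      · simp only at hij
        exact absurd (by ext <;> simp <;> omega) hne
    simp [hy i this]
  · simp

end Components

/-! ### Boundaries of the bar complex over an N-Koszul algebra -/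

section Elimination

open Finset.HasAntidiagonal (antidiagonal mem_antidiagonal)

variable {k : Type u} [Field k] {A : Type u} [Ring A] [Algebra k A]
  {𝒜 : ℕ → Submodule k A} {ε : A →ₐ[k] k} {M : Type u} [AddCommGroup M] [Module k M]

theorem component_one (h : IsConnectedGraded 𝒜 ε) (p : ℕ) :
    component h.internal p 1 = if p = 0 then 1 else 0 :=
  have := h.graded
  component_of_mem _ _ _ SetLike.GradedOne.one_mem

theorem totalComponent_one_tmul (h : IsConnectedGraded 𝒜 ε) (P : ℕ → M →ₗ[k] M) (j : ℕ) (x : M) :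
    totalComponent h.internal P j ((1 : A) ⊗ₜ[k] x) = 1 ⊗ₜ[k] P j x := by
  rw [totalComponent_tmul, Finset.sum_eq_single (0, j)]
  · simp [component_one h]
  · rintro ⟨p, q⟩ hpq hne
    rw [mem_antidiagonal] at hpq
    have hp : p ≠ 0 := by
      rintro rfl
      simp at hpq
      exact hne (by simp [hpq])
    simp [component_one h, hp]
  · simp

theorem component_zero_rTensor (h : IsConnectedGraded 𝒜 ε) (y : A ⊗[k] M) :
    (component h.internal 0).rTensor M y = 1 ⊗ₜ[k] evalLeft ε M y := by
  induction y with
  | zero => simp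
  | tmul a x =>
    simp [component_zero h, Algebra.algebraMap_eq_smul_one, TensorProduct.smul_tmul]
  | add y z hy hz => simp only [map_add, hy, hz, TensorProduct.tmul_add]

theorem component_map_of_ne (h : DirectSum.IsInternal 𝒜) (P : M →ₗ[k] M) {p q : ℕ} (hpq : p ≠ q)
    (y : A ⊗[k] M) :
    (component h p).rTensor M (TensorProduct.map (component h q) P y) = 0 := by
  induction y with
  | zero => simp
  | tmul a x => simp [component_component, hpq]
  | add y z hy hz => simp only [map_add, hy, hz, add_zero]

theorem component_map_self (h : DirectSum.IsInternal 𝒜) (P : M →ₗ[k] M) (q : ℕ)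
    (y : A ⊗[k] M) :
    (component h q).rTensor M (TensorProduct.map (component h q) P y) =
      TensorProduct.map (component h q) P y := by
  induction y with
  | zero => simp
  | tmul a x => simp [component_component]
  | add y z hy hz => simp only [map_add, hy, hz]

theorem map_component_idem (h : DirectSum.IsInternal 𝒜) {P : M →ₗ[k] M}
    (hP : ∀ x, P (P x) = P x) (q : ℕ) (y : A ⊗[k] M) :
    TensorProduct.map (component h q) P (TensorProduct.map (component h q) P y) =
      TensorProduct.map (component h q) P y := by
  induction y with
  | zero => simp
  | tmul a x => simp [component_component, hP]
  | add y z hy hz => simp only [map_add, hy, hz]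

theorem lTensor_map_component (h : DirectSum.IsInternal 𝒜) {P : M →ₗ[k] M}
    (hP : ∀ x, P (P x) = P x) (q : ℕ) (y : A ⊗[k] M) :
    P.lTensor A (TensorProduct.map (component h q) P y) =
      TensorProduct.map (component h q) P y := by
  induction y with
  | zero => simp
  | tmul a x => simp [hP]
  | add y z hy hz => simp only [map_add, hy, hz]

theorem lTensor_map_comm {M' : Type*} [AddCommGroup M'] [Module k M'] (π : A →ₗ[k] A)
    {P : M →ₗ[k] M} {P' : M' →ₗ[k] M'} {g : M' →ₗ[k] M} (hg : ∀ x, g (P' x) = P (g x))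
    (y : A ⊗[k] M') :
    g.lTensor A (TensorProduct.map π P' y) = TensorProduct.map π P (g.lTensor A y) := by
  induction y with
  | zero => simp
  | tmul a x => simp [hg]
  | add y z hy hz => simp only [map_add, hy, hz]

/-- If cycles of `A ⊗ M` are boundaries outside degree `m`, then a boundary of degree `m` whose
first tensor factor has degree `s` lies in `A ⊗ im`. -/
theorem exists_lTensor_eq (h : IsConnectedGraded 𝒜 ε) {P : ℕ → M →ₗ[k] M}
    (hP : ∀ j x, P j (P j x) = P j x) {D : A ⊗[k] M →ₗ[k] M}
    (hD : ∀ j y, P j (D y) = D (totalComponent h.internal P j y))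
    (hDD : ∀ y, D (barStep D y) = 0) {m s : ℕ} (hs : 1 ≤ s) (hsm : s ≤ m)
    (hK : ∀ j, j ≠ m → ∀ x, (evalLeft ε M - D) x = 0 →
      totalComponent h.internal P j x ∈ LinearMap.range (evalLeft ε (A ⊗[k] M) - barStep D))
    {z : A ⊗[k] M} (hz : D z = 0) (hzm : totalComponent h.internal P m z = z)
    (hzs : ∀ p < s, (component h.internal p).rTensor M z = 0)
    (hzs' : (component h.internal s).rTensor M z = z)
    (hzb : z ∈ LinearMap.range (evalLeft ε (A ⊗[k] M) - barStep D)) :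
    ∃ t, (evalLeft ε M - D).lTensor A t = z := by
  set P' := totalComponent h.internal P with hP'
  set T := totalComponent h.internal P' with hT
  have hP'i : ∀ j x, P' j (P' j x) = P' j x := totalComponent_idem h.internal hP
  have hTi : ∀ j x, T j (T j x) = T j x := totalComponent_idem h.internal hP'i
  have hE : ∀ j y, P' j (barStep D y) = barStep D (T j y) := totalComponent_barStep h hD
  have hev : ∀ j y, P' j (evalLeft ε (A ⊗[k] M) y) = evalLeft ε (A ⊗[k] M) (T j y) :=
    totalComponent_evalLeft h P'
  -- The preimage t of z under `barStep D` is improved until its first tensor factor has no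
  -- component of degree below s.
  have main : ∀ p, p + 1 ≤ s → ∃ t, T m t = t ∧
      (∀ q < p + 1, (component h.internal q).rTensor (A ⊗[k] M) t = 0) ∧ barStep D t = z := by
    intro p
    induction p with
    | zero =>
      intro _
      obtain ⟨y, hy⟩ := hzb
      have hy1 : evalLeft ε (A ⊗[k] M) (T m y) - barStep D (T m y) = z := by
        rw [← hzm, ← hy, LinearMap.sub_apply, map_sub, hev, hE]
      have hd : D (evalLeft ε (A ⊗[k] M) (T m y)) = 0 := by
        rw [← sub_add_cancel (evalLeft ε (A ⊗[k] M) (T m y)) (barStep D (T m y)), hy1, map_add, hz,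
          hDD, add_zero]
      -- Adding the homotopy term 1 ⊗ ε(y) trades `evalLeft` minus `barStep D` for `barStep D`
      -- alone, up to 1 ⊗ D(ε(y)), which is zero by `hd`. It also cancels the degree 0 component of
      -- y.
      refine ⟨(1 : A) ⊗ₜ[k] evalLeft ε (A ⊗[k] M) (T m y) - T m y, ?_, ?_, ?_⟩
      · rw [map_sub, hTi]
        conv_lhs => rw [hT]
        rw [totalComponent_one_tmul h, hev, hTi]
      · intro q hq
        obtain rfl : q = 0 := by omega
        rw [map_sub, component_zero_rTensor h, component_zero_rTensor h, evalLeft_tmul]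
        simp
      · rw [map_sub, barStep_one_tmul, hd, TensorProduct.tmul_zero, sub_zero, hy1]
    | succ p ih =>
      intro hp
      obtain ⟨t, ht, htq, htz⟩ := ih (by omega)
      have hpm : (p + 1) + (m - (p + 1)) = m := by omega
      set j := m - (p + 1) with hj
      set u := (component h.internal (p + 1)).rTensor (A ⊗[k] M) t with hu
      have hu' : u = TensorProduct.map (component h.internal (p + 1)) (P' j) t := by
        rw [← map_component_totalComponent, hpm, ← hT, ht]
      -- The lowest component of `barStep D t` is computed from u alone; it vanishes because z has
      -- no component of degree p + 1 < s.
      have hu0 : (evalLeft ε M - D).lTensor A u = 0 := by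
        rw [hu, ← component_barStep h D (p + 1) t htq, htz, hzs _ (by omega)]
      -- The second factor of u consists of cycles of degree j = m - (p + 1), which differs from m,
      -- so by `hK` they are boundaries. Projecting the preimage by `T j` afterwards keeps it
      -- homogeneous.
      obtain ⟨y', hy'⟩ := lTensor_mem_range (evalLeft ε M - D) (P' j)
        (evalLeft ε (A ⊗[k] M) - barStep D) (hK j (by omega)) u hu0
      set y := TensorProduct.map (component h.internal (p + 1)) (T j) y' with hy
      have hyu : (evalLeft ε (A ⊗[k] M) - barStep D).lTensor A y = u := by
        rw [hy, lTensor_map_comm (P := P' j) _ (fun x => by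
          rw [LinearMap.sub_apply, LinearMap.sub_apply, map_sub, hev, hE]), hy', hu',
          lTensor_map_component _ (hP'i j), map_component_idem _ (hP'i j)]
      -- The correction is killed by `barStep D`, so z is unaffected, and its lowest component is
      -- exactly u.
      refine ⟨t - barStep (barStep D) y, ?_, ?_, ?_⟩
      · rw [map_sub, ht, hT, totalComponent_barStep h hE, ← hT]
        congr 2
        have := totalComponent_map h.internal hTi (p + 1) j y'
        rw [hpm] at this
        exact this
      · intro q hq
        have hyq : ∀ q' < q, (component h.internal q').rTensor (A ⊗[k] (A ⊗[k] M)) y = 0 :=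
          fun q' hq' => component_map_of_ne _ _ (by omega) _
        rw [map_sub, component_barStep h (barStep D) q y hyq]
        rcases Nat.lt_or_ge q (p + 1) with hq' | hq'
        · rw [htq q hq', hy, component_map_of_ne _ _ (by omega)]
          simp
        · obtain rfl : q = p + 1 := by omega
          rw [hy, component_map_self, ← hy, hyu, sub_self]
      · rw [map_sub, htz, barStep_comp_barStep hDD, sub_zero]
  obtain ⟨t, -, htq, htz⟩ := main (s - 1) (by omega)
  -- Now t starts in degree s, so comparing degree s components in `barStep D t = z` writes z as the
  -- image of the degree s part of t.
  refine ⟨(component h.internal s).rTensor (A ⊗[k] M) t, ?_⟩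
  rw [← component_barStep h D s t (by rwa [Nat.sub_add_cancel hs] at htq), htz, hzs']

/-- The projections of the bar complex to its parts of given internal degree. -/
noncomputable def barComponent (h : DirectSum.IsInternal 𝒜) :
    (i : ℕ) → ℕ → bar k A i →ₗ[k] bar k A i
  | 0 => fun j => if j = 0 then LinearMap.id else 0
  | i + 1 => totalComponent h (barComponent h i)

theorem barComponent_idem (h : DirectSum.IsInternal 𝒜) (i : ℕ) :
    ∀ j x, barComponent h i j (barComponent h i j x) = barComponent h i j x := by
  induction i with
  | zero =>
    intro j x
    simp only [barComponent]
    split_ifs <;> simp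
  | succ i ih => exact totalComponent_idem h ih

theorem barRes_barComponent (h : IsConnectedGraded 𝒜 ε) (i : ℕ) :
    ∀ j y, barComponent h.internal i j (barRes ε i y) =
      barRes ε i (totalComponent h.internal (barComponent h.internal i) j y) := by
  induction i with
  | zero => exact totalComponent_evalLeft h _
  | succ i ih => exact totalComponent_barStep h ih

theorem barComponent_mem (h : DirectSum.IsInternal 𝒜) (i : ℕ) :
    ∀ j x, barComponent h i j x ∈ barDegree 𝒜 i j := by
  induction i with
  | zero =>
    intro j x
    simp only [barComponent, barDegree]
    split_ifs <;> simp
  | succ i ih =>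
    intro j x
    change totalComponent h (barComponent h i) j x ∈ Submodule.span k {y : A ⊗[k] bar k A i |
      ∃ p q : ℕ, p + q = j ∧ ∃ a ∈ 𝒜 p, ∃ w ∈ barDegree 𝒜 i q, y = a ⊗ₜ[k] w}
    change A ⊗[k] bar k A i at x
    induction x with
    | zero => rw [map_zero]; exact zero_mem _
    | tmul a x =>
      rw [totalComponent_tmul]
      refine Submodule.sum_mem _ fun q hq => Submodule.subset_span ?_
      exact ⟨q.1, q.2, mem_antidiagonal.1 hq, _, component_mem _ _ _, _, ih _ _, rfl⟩
    | add x y hx hy => rw [map_add]; exact add_mem hx hy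

/-- Contraction of the first tensor factor with a linear form. -/
noncomputable def contractLeft (l : A →ₗ[k] k) (M : Type u) [AddCommGroup M] [Module k M] :
    A ⊗[k] M →ₗ[k] M :=
  (TensorProduct.lid k M).toLinearMap ∘ₗ l.rTensor M

@[simp] theorem contractLeft_tmul (l : A →ₗ[k] k) (a : A) (x : M) :
    contractLeft l M (a ⊗ₜ[k] x) = l a • x := by
  simp [contractLeft]

theorem contractLeft_lTensor {M' : Type u} [AddCommGroup M'] [Module k M'] (l : A →ₗ[k] k)
    (f : M →ₗ[k] M') (y : A ⊗[k] M) :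
    contractLeft l M' (f.lTensor A y) = f (contractLeft l M y) := by
  induction y with
  | zero => simp
  | tmul a x => simp
  | add y z hy hz => simp only [map_add, hy, hz]

/-- Over an `N`-Koszul algebra, contracting the first factor of a suitable boundary of the bar
complex yields boundaries. -/
theorem contractLeft_mem_barBoundaries (h : IsConnectedGraded 𝒜 ε) {N : ℕ}
    (hK : IsNKoszul 𝒜 ε N) {i s : ℕ} (hs : 1 ≤ s) (hsm : s ≤ koszulDegree N (i + 1))
    {z : A ⊗[k] bar k A i} (hz : barRes ε i z = 0)
    (hzm : totalComponent h.internal (barComponent h.internal i) (koszulDegree N (i + 1)) z = z)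
    (hzs : ∀ p, (component h.internal p).rTensor (bar k A i) z = if p = s then z else 0)
    (hzb : z ∈ barBoundaries ε (i + 1)) (l : A →ₗ[k] k) :
    contractLeft l _ z ∈ barBoundaries ε i := by
  obtain ⟨t, rfl⟩ := exists_lTensor_eq (z := z) h (barComponent_idem h.internal i)
    (barRes_barComponent h i) (barRes_barRes i) hs hsm (by
      -- Both parts of the differential preserve the internal degree, so the homogeneous parts of a
      -- cycle are cycles and Koszulity applies to each of them.
      intro j hj x hx
      refine hK (i + 1) j hj (Submodule.mem_inf.2 ⟨?_, barComponent_mem h.internal (i + 1) j x⟩)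
      change (evalLeft ε (bar k A i) - barRes ε i)
        (totalComponent h.internal (barComponent h.internal i) j x) = 0
      rw [LinearMap.sub_apply, ← totalComponent_evalLeft h, ← barRes_barComponent h, ← map_sub,
        ← LinearMap.sub_apply, hx, map_zero]) hz hzm
      (fun p hp => by rw [hzs, if_neg hp.ne]) (by rw [hzs, if_pos rfl]) hzb
  rw [contractLeft_lTensor]
  exact ⟨_, rfl⟩

end Elimination

/-! ### The bar resolution computes `Ext` -/

section BarResolution

variable {k : Type u} [Field k] {A : Type u} [Ring A] [Algebra k A] (ε : A →ₐ[k] k)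

/-- The targets of the differentials of the augmented bar resolution. -/
noncomputable def barTarget : ℕ → ModuleCat.{u} A
  | 0 => trivialLeft ε
  | i + 1 => ModuleCat.of A (A ⊗[k] bar k A i)

/-- The differentials of the augmented bar resolution as module maps. -/
noncomputable def barHom : (i : ℕ) → A ⊗[k] bar k A i →ₗ[A] barTarget ε i
  | 0 => show A ⊗[k] k →ₗ[A] trivialLeft ε from
    { toFun := fun y => evalLeft ε k y
      map_add' := fun x y => map_add _ x y
      map_smul' := fun a y => by
        change evalLeft ε k (a • y) = ε a * evalLeft ε k y
        induction y with
        | zero => simp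
        | tmul b x => simp [TensorProduct.smul_tmul', mul_assoc]
        | add y z hy hz => rw [smul_add, map_add, hy, hz, map_add, mul_add] }
  | i + 1 => show A ⊗[k] (A ⊗[k] bar k A i) →ₗ[A] A ⊗[k] bar k A i from
    { toFun := fun y => barStep (barRes ε i) y
      map_add' := fun x y => map_add _ x y
      map_smul' := fun a y => by
        simp only [RingHom.id_apply]
        rw [← actLeft_eq_smul, ← actLeft_eq_smul, barStep_actLeft_tmul] }

theorem barHom_eq_zero_iff (i : ℕ) (y : A ⊗[k] bar k A i) :
    barHom ε i y = 0 ↔ barRes ε i y = 0 := by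
  cases i <;> exact Iff.rfl

theorem barHom_barHom (i : ℕ) (y : A ⊗[k] (A ⊗[k] bar k A i)) :
    barHom ε i (barHom ε (i + 1) y : A ⊗[k] bar k A i) = 0 :=
  (barHom_eq_zero_iff ε i _).2 (barRes_barRes i y)

/-- The syzygies of the trivial module in the bar resolution. -/
noncomputable def barSyzygy : ℕ → ModuleCat.{u} A
  | 0 => trivialLeft ε
  | i + 1 => ModuleCat.of A (LinearMap.ker (barHom ε i))

/-- The inclusion of a syzygy into a free module. -/
noncomputable def barSyzygyι (i : ℕ) :
    barSyzygy ε (i + 1) ⟶ ModuleCat.of A (A ⊗[k] bar k A i) :=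
  ModuleCat.ofHom (LinearMap.ker (barHom ε i)).subtype

/-- The projection of a free module onto a syzygy. -/
noncomputable def barSyzygyπ : (i : ℕ) → (ModuleCat.of A (A ⊗[k] bar k A i) ⟶ barSyzygy ε i)
  | 0 => ConcreteCategory.ofHom (C := ModuleCat.{u} A) (X := ModuleCat.of A (A ⊗[k] bar k A 0))
      (Y := trivialLeft ε) (barHom ε 0)
  | i + 1 => ModuleCat.ofHom (show A ⊗[k] (A ⊗[k] bar k A i) →ₗ[A] LinearMap.ker (barHom ε i) from
      LinearMap.codRestrict _ (barHom ε (i + 1)) (barHom_barHom ε i))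

theorem barSyzygyπ_eq_zero_iff (i : ℕ) (y : A ⊗[k] bar k A i) :
    (barSyzygyπ ε i).hom y = 0 ↔ barHom ε i y = 0 := by
  cases i with
  | zero => exact Iff.rfl
  | succ i => exact Subtype.ext_iff

theorem barSyzygyι_π (i : ℕ) : barSyzygyι ε i ≫ barSyzygyπ ε i = 0 := by
  ext y
  exact (barSyzygyπ_eq_zero_iff ε i _).2 y.2

/-- Surjectivity onto the syzygy comes from the contracting homotopy y ↦ 1 ⊗ y: its differential is
y - 1 ⊗ D y, which equals y on the kernel of D. -/
theorem barSyzygy_shortExact (i : ℕ) :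
    (ShortComplex.mk (barSyzygyι ε i) (barSyzygyπ ε i) (barSyzygyι_π ε i)).ShortExact := by
  refine ModuleCat.shortComplex_shortExact _ ?_ ?_ ?_
  · intro y
    constructor
    · intro hy
      exact ⟨⟨y, (barSyzygyπ_eq_zero_iff ε i y).1 hy⟩, rfl⟩
    · rintro ⟨x, rfl⟩
      exact (barSyzygyπ_eq_zero_iff ε i _).2 x.2
  · exact Subtype.val_injective
  · cases i with
    | zero =>
      intro c
      refine ⟨(1 : A) ⊗ₜ[k] (show k from c), ?_⟩
      change evalLeft ε k ((1 : A) ⊗ₜ[k] (show k from c)) = c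
      rw [evalLeft_tmul, map_one, one_smul]
    | succ i =>
      rintro ⟨y, hy⟩
      refine ⟨(1 : A) ⊗ₜ[k] (show A ⊗[k] bar k A i from y), Subtype.ext ?_⟩
      change barStep (barRes ε i) ((1 : A) ⊗ₜ[k] (show A ⊗[k] bar k A i from y)) = y
      rw [barStep_one_tmul]
      have : barRes ε i y = 0 := (barHom_eq_zero_iff ε i y).1 hy
      exact (congrArg (fun x => y - (1 : A) ⊗ₜ[k] x) this).trans (by simp)

instance (i : ℕ) : Projective (ModuleCat.of A (A ⊗[k] bar k A i)) :=
  ModuleCat.projective_of_categoryTheory_projective _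

variable {ε}

/-- A cocycle of the bar complex gives a map from a syzygy to the trivial module. -/
noncomputable def cocycleHom {i : ℕ} (φ : bar k A (i + 1) →ₗ[k] k)
    (hφ : ∀ z ∈ barBoundaries ε (i + 1), φ z = 0) : barSyzygy ε (i + 1) ⟶ trivialLeft ε :=
  ConcreteCategory.ofHom (C := ModuleCat.{u} A) (X := barSyzygy ε (i + 1)) (Y := trivialLeft ε)
    (show LinearMap.ker (barHom ε i) →ₗ[A] trivialLeft ε from
    { toFun := fun y => φ y.1
      map_add' := fun x y => map_add φ x.1 y.1
      map_smul' := fun a y => by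
        change φ (a • y.1) = ε a * φ y.1
        -- For y in the kernel of the resolution differential, the boundary of a ⊗ y is ε(a) y - a
        -- y; vanishing of φ there is A-linearity.
        have h := hφ _ ⟨a ⊗ₜ[k] (show bar k A (i + 1) from y.1), rfl⟩
        have hy : barRes ε i y.1 = 0 := (barHom_eq_zero_iff ε i y.1).1 y.2
        change φ ((evalLeft ε (A ⊗[k] bar k A i) - barStep (barRes ε i)) (a ⊗ₜ[k] y.1)) = 0 at h
        rw [LinearMap.sub_apply, barStep_tmul, hy, TensorProduct.tmul_zero, sub_zero,
          evalLeft_tmul, actLeft_eq_smul] at h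
        have h2 := (map_sub φ (ε a • y.1) (a • y.1)).symm.trans h
        rw [sub_eq_zero] at h2
        exact h2.symm.trans (map_smul φ (ε a) y.1) })

/-- Since A acts on k through ε, a and ε(a) act alike after h; a map from a free module to k only
sees the augmentation of its argument. -/
theorem hom_trivialLeft_apply {M : Type u} [AddCommGroup M] [Module k M]
    (h : A ⊗[k] M →ₗ[A] trivialLeft ε) (y : A ⊗[k] M) :
    h y = h ((1 : A) ⊗ₜ[k] evalLeft ε M y) := by
  induction y with
  | zero => simp
  | tmul a x =>
    have h1 : a ⊗ₜ[k] x = a • ((1 : A) ⊗ₜ[k] x) := by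
      rw [TensorProduct.smul_tmul', smul_eq_mul, mul_one]
    have h2 : (1 : A) ⊗ₜ[k] (ε a • x) = algebraMap k A (ε a) • ((1 : A) ⊗ₜ[k] x) := by
      rw [TensorProduct.smul_tmul', smul_eq_mul, mul_one, Algebra.algebraMap_eq_smul_one,
        TensorProduct.smul_tmul]
    rw [evalLeft_tmul, h2, h1, map_smul, map_smul]
    change ε a * _ = ε (algebraMap k A (ε a)) * _
    rw [AlgHom.commutes]
    rfl
  | add y z hy hz => rw [map_add, hy, hz, map_add, TensorProduct.tmul_add, map_add]

theorem exists_augmentation_kernel : ∃ (X : ModuleCat.{u} A) (ι : X ⟶ ModuleCat.of A A)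
    (p : ModuleCat.of A A ⟶ trivialLeft ε) (zero : ι ≫ p = 0),
    (ShortComplex.mk ι p zero).ShortExact := by
  let f : A →ₗ[A] trivialLeft ε :=
    { toFun := fun a => ε a
      map_add' := fun x y => map_add ε x y
      map_smul' := fun a b => map_mul ε a b }
  refine ⟨_, _, _, f.shortComplexKer.zero, LinearMap.shortExact_shortComplexKer ?_⟩
  intro c
  exact ⟨algebraMap k A c, AlgHom.commutes ε c⟩

/-- If `Ext^{i+1}_A(k, A)` is a line and `k` has projective dimension at most `i + 1`, then
`Tor_{i+1}^A(k, k)` is at most a line. -/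
theorem exists_combination_of_ext_line {i : ℕ}
    (hpd : HasProjectiveDimensionLT (trivialLeft ε) (i + 2))
    (hext : Nonempty (Abelian.Ext (trivialLeft ε) (ModuleCat.of A A) (i + 1) ≃ₗ[k] k))
    (φ ψ : bar k A (i + 1) →ₗ[k] k) (hφ : ∀ z ∈ barBoundaries ε (i + 1), φ z = 0)
    (hψ : ∀ z ∈ barBoundaries ε (i + 1), ψ z = 0) :
    ∃ a b : k, (a ≠ 0 ∨ b ≠ 0) ∧ ∀ z ∈ barCycles ε (i + 1), a * φ z + b * ψ z = 0 := by
  obtain ⟨X₁, ι, p, zero, hT⟩ := exists_augmentation_kernel (ε := ε)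
  -- The sequence used is the augmentation A → k with its kernel; Ext^{i+2}(k, -) vanishes by the
  -- bound on the projective dimension.
  obtain ⟨a, b, hab, h, hh⟩ := exists_extension_of_ext_line (barSyzygy_shortExact ε) (i := i) hT
    (HasProjectiveDimensionLT.subsingleton (trivialLeft ε) (i + 2) (i + 2) le_rfl X₁) hext
    (cocycleHom φ hφ) (cocycleHom ψ hψ)
  refine ⟨a, b, hab, fun z hz => ?_⟩
  change A ⊗[k] bar k A i at z
  have hz' : evalLeft ε (bar k A i) z - barRes ε i z = 0 := hz
  -- Here z' = z - 1 ⊗ D z lies in the syzygy, and z - z' is the boundary of 1 ⊗ z, so cocycles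
  -- agree on z and z'. The extension h kills z': h(z) = h(1 ⊗ ε(z)), and ε(z) = D z because z is a
  -- cycle.
  set z' := barStep (barRes ε i) ((1 : A) ⊗ₜ[k] z) with hz'_def
  have hmem : barHom ε i z' = 0 := barHom_barHom ε i _
  have hzz' : ∀ χ : bar k A (i + 1) →ₗ[k] k, (∀ z ∈ barBoundaries ε (i + 1), χ z = 0) →
      χ z = χ z' := by
    intro χ hχ
    have := hχ _ ⟨(1 : A) ⊗ₜ[k] (show bar k A (i + 1) from z), rfl⟩
    change χ ((evalLeft ε (A ⊗[k] bar k A i) - barStep (barRes ε i)) ((1 : A) ⊗ₜ[k] z)) = 0 at this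
    rw [LinearMap.sub_apply, evalLeft_tmul, map_one, one_smul, ← hz'_def] at this
    exact sub_eq_zero.1 ((map_sub χ z z').symm.trans this)
  rw [hzz' φ hφ, hzz' ψ hψ]
  have key := congrArg (fun F => F.hom (show LinearMap.ker (barHom ε i) from ⟨z', hmem⟩)) hh
  have hl : h.hom z' = 0 := by
    rw [hz'_def, barStep_one_tmul, map_sub, hom_trivialLeft_apply h.hom z, ← map_sub,
      ← TensorProduct.tmul_sub, hz', TensorProduct.tmul_zero, map_zero]
  have hr : (show k from (ModuleCat.Hom.hom (a • cocycleHom φ hφ + b • cocycleHom ψ hψ))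
      (show LinearMap.ker (barHom ε i) from ⟨z', hmem⟩)) = a * φ z' + b * ψ z' := by
    change ε (algebraMap k A a) * φ z' + ε (algebraMap k A b) * ψ z' = _
    rw [AlgHom.commutes, AlgHom.commutes]
    rfl
  rw [← hr, ← key]
  exact hl

end BarResolution

/-! ### Sums over words -/

section Words

variable {n : ℕ}

/-- The sum of `F l` over all words `l` of length `m`. -/
def sumWords {M : Type*} [AddCommMonoid M] (m : ℕ) (F : List (Fin n) → M) : M :=
  ∑ I : Fin m → Fin n, F (List.ofFn I)

variable {M : Type*} [AddCommMonoid M]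

theorem sumWords_zero (F : List (Fin n) → M) : sumWords 0 F = F [] := by
  simp [sumWords]

theorem sumWords_succ (m : ℕ) (F : List (Fin n) → M) :
    sumWords (m + 1) F = ∑ i, sumWords m fun l => F (i :: l) := by
  rw [sumWords, sum_cons]
  simp [sumWords, List.ofFn_succ]

theorem sumWords_add (m m' : ℕ) (F : List (Fin n) → M) :
    sumWords (m + m') F = sumWords m fun l => sumWords m' fun l' => F (l ++ l') := by
  induction m generalizing F with
  | zero => simp [sumWords_zero]
  | succ m ih => simp [Nat.succ_add, sumWords_succ, ih]

theorem sumWords_congr {m : ℕ} {F G : List (Fin n) → M} (h : ∀ l, l.length = m → F l = G l) :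
    sumWords m F = sumWords m G :=
  Finset.sum_congr rfl fun _ _ => h _ (by simp)

theorem sumWords_comm (m m' : ℕ) (F : List (Fin n) → List (Fin n) → M) :
    (sumWords m fun l => sumWords m' fun l' => F l l') =
      sumWords m' fun l' => sumWords m fun l => F l l' :=
  Finset.sum_comm

theorem map_sumWords {M' : Type*} [AddCommMonoid M'] {G : Type*} [FunLike G M M']
    [AddMonoidHomClass G M M'] (f : G) (m : ℕ) (F : List (Fin n) → M) :
    f (sumWords m F) = sumWords m fun l => f (F l) :=
  map_sum f _ _

theorem sumWords_eq_single {m : ℕ} {F : List (Fin n) → M} (l₀ : List (Fin n)) (h : l₀.length = m)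
    (hF : ∀ l, l.length = m → l ≠ l₀ → F l = 0) : sumWords m F = F l₀ := by
  subst h
  rw [sumWords, Finset.sum_eq_single l₀.get]
  · rw [List.ofFn_get]
  · intro I _ hI
    refine hF _ (by simp) fun h => hI ?_
    apply List.ofFn_injective
    rw [h, List.ofFn_get]
  · simp

theorem sumWords_zero_fun (m : ℕ) : (sumWords m fun _ : List (Fin n) => (0 : M)) = 0 := by
  simp [sumWords]

/-- The product of the letters of a word. -/
def wordProd {R : Type*} [Monoid R] (x : Fin n → R) (l : List (Fin n)) : R := (l.map x).prod

@[simp] theorem wordProd_nil {R : Type*} [Monoid R] (x : Fin n → R) : wordProd x [] = 1 := rfl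

@[simp] theorem wordProd_cons {R : Type*} [Monoid R] (x : Fin n → R) (i : Fin n)
    (l : List (Fin n)) : wordProd x (i :: l) = x i * wordProd x l := by
  simp [wordProd]

theorem wordProd_append {R : Type*} [Monoid R] (x : Fin n → R) (l l' : List (Fin n)) :
    wordProd x (l ++ l') = wordProd x l * wordProd x l' := by
  simp [wordProd]

end Words

/-! ### Potentials and the cycles they define -/

section Potentials

variable {k : Type u} [Field k] {A : Type u} [Ring A] [Algebra k A] {n : ℕ} (x : Fin n → A)

/-- The tensors `∑ w l • l` of degree `m` all of whose subwords of length `N` become relations. -/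
def potentials (k : Type u) [Field k] {A : Type u} [Ring A] [Algebra k A] {n : ℕ} (x : Fin n → A)
    (N m : ℕ) : Submodule k (List (Fin n) → k) where
  carrier := {w | ∀ P S, P.length + N + S.length = m →
    (sumWords N fun J => w (P ++ J ++ S) • wordProd x J) = 0}
  zero_mem' := by
    intro P S _
    simp [sumWords]
  add_mem' := by
    intro w w' hw hw' P S h
    have h1 := hw P S h
    have h2 := hw' P S h
    simp only [sumWords, Pi.add_apply, add_smul, Finset.sum_add_distrib] at h1 h2 ⊢
    rw [h1, h2, add_zero]
  smul_mem' := by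
    intro a w hw P S h
    have h1 := hw P S h
    simp only [sumWords, Pi.smul_apply, smul_eq_mul, mul_smul, ← Finset.smul_sum] at h1 ⊢
    rw [h1, smul_zero]

variable {x}

theorem slice_mem_potentials {N s m : ℕ} {w : List (Fin n) → k} (hw : w ∈ potentials k x N (s + m))
    {u : List (Fin n)} (hu : u.length = s) : (fun l => w (u ++ l)) ∈ potentials k x N m := by
  intro P S h
  have := hw (u ++ P) S (by simp; omega)
  simpa using this

/-- The difference `ν_N(i + 1) - ν_N(i)`. -/
def koszulStep (N i : ℕ) : ℕ := if Even i then 1 else N - 1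

theorem koszulDegree_zero (N : ℕ) : koszulDegree N 0 = 0 := by simp [koszulDegree]

theorem koszulDegree_succ {N : ℕ} (hN : 2 ≤ N) (i : ℕ) :
    koszulDegree N (i + 1) = koszulStep N i + koszulDegree N i := by
  rcases Nat.even_or_odd' i with ⟨j, rfl | rfl⟩
  · have h1 : ¬ Even (2 * j + 1) := by simp
    have h2 : (2 * j + 1) / 2 = j := by omega
    simp [koszulDegree, koszulStep, h2]
    omega
  · have h2 : (2 * j + 1 + 1) / 2 = j + 1 := by omega
    have h3 : (2 * j + 1) / 2 = j := by omega
    have h1 : Even (2 * j + 1 + 1) := ⟨j + 1, by omega⟩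
    simp [koszulDegree, koszulStep, h2, h3, h1, mul_add]
    omega

theorem koszulStep_pos {N : ℕ} (hN : 2 ≤ N) (i : ℕ) : 1 ≤ koszulStep N i := by
  rw [koszulStep]; split_ifs <;> omega

theorem koszulStep_lt {N : ℕ} (hN : 2 ≤ N) (i : ℕ) : koszulStep N i < N := by
  rw [koszulStep]; split_ifs <;> omega

/-- Consecutive steps are 1 and N - 1 in some order, so two adjacent pieces of a cut word multiply
to a word of the length of the relations. -/
theorem koszulStep_add {N : ℕ} (hN : 2 ≤ N) (i : ℕ) :
    koszulStep N (i + 1) + koszulStep N i = N := by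
  simp only [koszulStep, Nat.even_add_one]
  split_ifs <;> omega

variable (x)

/-- The pure tensor in `B_i` obtained by cutting a word of length `ν_N(i)` into pieces of length
`1` and `N - 1`. -/
noncomputable def cutWord (k : Type u) [Field k] {A : Type u} [Ring A] [Algebra k A] {n : ℕ}
    (x : Fin n → A) (N : ℕ) : (i : ℕ) → List (Fin n) → bar k A i
  | 0, _ => (1 : k)
  | i + 1, l => show A ⊗[k] bar k A i from
      wordProd x (l.take (koszulStep N i)) ⊗ₜ[k] cutWord k x N i (l.drop (koszulStep N i))

/-- The element of `B_i` defined by a tensor of degree `ν_N(i)`. -/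
noncomputable def cutTensor (N i : ℕ) (w : List (Fin n) → k) : bar k A i :=
  sumWords (koszulDegree N i) fun l => w l • cutWord k x N i l

theorem cutTensor_sub_smul (N i : ℕ) (w w' : List (Fin n) → k) (a : k) :
    cutTensor x N i (w - a • w') = cutTensor x N i w - a • cutTensor x N i w' := by
  simp [cutTensor, sumWords, sub_smul, mul_smul, Finset.smul_sum]

theorem cutTensor_zero (N : ℕ) (w : List (Fin n) → k) : cutTensor x N 0 w = w [] • (1 : k) := by
  rw [cutTensor, koszulDegree_zero, sumWords_zero]
  rfl

theorem cutWord_append (N i : ℕ) {u : List (Fin n)} (hu : u.length = koszulStep N i)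
    (v : List (Fin n)) : cutWord k x N (i + 1) (u ++ v) =
      (wordProd x u ⊗ₜ[k] cutWord k x N i v : A ⊗[k] bar k A i) := by
  rw [cutWord, ← hu, List.take_left, List.drop_left]

theorem cutTensor_succ {N : ℕ} (hN : 2 ≤ N) (i : ℕ) (w : List (Fin n) → k) :
    cutTensor x N (i + 1) w = (sumWords (koszulStep N i) fun u =>
      wordProd x u ⊗ₜ[k] cutTensor x N i fun l => w (u ++ l) : A ⊗[k] bar k A i) := by
  rw [cutTensor, koszulDegree_succ hN, sumWords_add]
  refine sumWords_congr fun u hu => ?_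
  rw [cutTensor]
  change _ = TensorProduct.mk k A (bar k A i) (wordProd x u) _
  rw [map_sumWords]
  refine sumWords_congr fun v hv => ?_
  rw [cutWord_append x N i hu, map_smul]
  rfl

variable {x} {ε : A →ₐ[k] k}

theorem augmentation_wordProd (hε : ∀ i, ε (x i) = 0) {l : List (Fin n)} (hl : 1 ≤ l.length) :
    ε (wordProd x l) = 0 := by
  cases l with
  | nil => simp at hl
  | cons i l => simp [hε]

theorem evalLeft_cutTensor (hε : ∀ i, ε (x i) = 0) {N : ℕ} (hN : 2 ≤ N) (i : ℕ)
    (w : List (Fin n) → k) :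
    evalLeft ε (bar k A i) (cutTensor x N (i + 1) w) = 0 := by
  rw [cutTensor_succ x hN]
  refine (map_sumWords (evalLeft ε (bar k A i)) _ _).trans ?_
  rw [← sumWords_zero_fun (n := n) (koszulStep N i)]
  refine sumWords_congr fun u hu => ?_
  rw [evalLeft_tmul, augmentation_wordProd hε (by rw [hu]; exact koszulStep_pos hN i), zero_smul]

/-- By induction applied to the slices of w, the only term that could survive is the product of the
first two pieces. Those products run over words of length N, and summed against w they are
relations. -/
theorem barRes_cutTensor (hε : ∀ i, ε (x i) = 0) {N : ℕ} (hN : 2 ≤ N) (i : ℕ) :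
    ∀ w ∈ potentials k x N (koszulDegree N (i + 1)),
      barRes ε i (cutTensor x N (i + 1) w) = 0 := by
  induction i with
  | zero => exact fun w _ => evalLeft_cutTensor hε hN 0 w
  | succ i ih =>
    intro w hw
    rw [koszulDegree_succ hN] at hw
    rw [cutTensor_succ x hN]
    refine (map_sumWords (barStep (barRes ε i)) _ _).trans ?_
    have h1 : ∀ u : List (Fin n), u.length = koszulStep N (i + 1) →
        barStep (barRes ε i) (wordProd x u ⊗ₜ[k] (cutTensor x N (i + 1) fun l => w (u ++ l) :
          A ⊗[k] bar k A i)) =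
        sumWords (koszulStep N i) fun u' => wordProd x (u ++ u') ⊗ₜ[k]
          cutTensor x N i fun l => w (u ++ u' ++ l) := by
      intro u hu
      refine (barStep_tmul (barRes ε i) (wordProd x u) _).trans ?_
      rw [ih _ (slice_mem_potentials hw hu), TensorProduct.tmul_zero, sub_zero,
        cutTensor_succ x hN]
      change (actLeft (bar k A i) ∘ₗ TensorProduct.mk k A (A ⊗[k] bar k A i) (wordProd x u)) _ = _
      rw [map_sumWords]
      refine sumWords_congr fun u' _ => ?_
      simp [wordProd_append]
    refine (sumWords_congr h1).trans ?_
    rw [← sumWords_add (koszulStep N (i + 1)) (koszulStep N i) fun J =>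
      wordProd x J ⊗ₜ[k] cutTensor x N i fun l => w (J ++ l), koszulStep_add hN]
    have h2 : ∀ J : List (Fin n), (wordProd x J ⊗ₜ[k] cutTensor x N i fun l => w (J ++ l)) =
        sumWords (koszulDegree N i) fun S =>
          (w (J ++ S) • wordProd x J) ⊗ₜ[k] cutWord k x N i S := by
      intro J
      rw [cutTensor]
      refine (map_sumWords (TensorProduct.mk k A (bar k A i) (wordProd x J)) _ _).trans ?_
      refine sumWords_congr fun S _ => ?_
      rw [map_smul, TensorProduct.mk_apply, TensorProduct.smul_tmul']
    rw [sumWords_congr fun J _ => h2 J, sumWords_comm, ← sumWords_zero_fun (n := n)]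
    refine sumWords_congr fun S hS => ?_
    rw [koszulDegree_succ hN, ← add_assoc, koszulStep_add hN] at hw
    have := hw [] S (by simp [hS])
    refine (map_sumWords ((TensorProduct.mk k A (bar k A i)).flip (cutWord k x N i S)) N
      (fun J => w (J ++ S) • wordProd x J)).symm.trans ?_
    simp only [List.nil_append] at this
    rw [this]
    exact map_zero _

theorem cutTensor_mem_barCycles (hε : ∀ i, ε (x i) = 0) {N : ℕ} (hN : 2 ≤ N) (i : ℕ)
    {w : List (Fin n) → k} (hw : w ∈ potentials k x N (koszulDegree N (i + 1))) :
    cutTensor x N (i + 1) w ∈ barCycles ε (i + 1) := by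
  change evalLeft ε (bar k A i) (cutTensor x N (i + 1) w) -
    barRes ε i (cutTensor x N (i + 1) w) = 0
  rw [evalLeft_cutTensor hε hN, barRes_cutTensor hε hN i w hw, sub_zero]

variable {𝒜 : ℕ → Submodule k A}

open Finset.HasAntidiagonal (antidiagonal mem_antidiagonal)

theorem totalComponent_tmul_of_mem {M : Type u} [AddCommGroup M] [Module k M]
    (h : DirectSum.IsInternal 𝒜) {P : ℕ → M →ₗ[k] M} {p q : ℕ} {a : A} (ha : a ∈ 𝒜 p) {y : M}
    (hy : P q y = y) : totalComponent h P (p + q) (a ⊗ₜ[k] y) = a ⊗ₜ[k] y := by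
  have := totalComponent_tmul h P (p + q) a y
  rw [this, Finset.sum_eq_single (p, q)]
  · rw [component_of_mem h _ _ ha, if_pos rfl, hy]
  · rintro ⟨i, j⟩ hij hne
    rw [component_of_mem h _ _ ha, if_neg, TensorProduct.zero_tmul]
    rintro rfl
    rw [mem_antidiagonal] at hij
    exact hne (by simp at hij; simp [hij])
  · simp

theorem barComponent_cutWord (h : DirectSum.IsInternal 𝒜)
    (hx : ∀ l : List (Fin n), wordProd x l ∈ 𝒜 l.length) {N : ℕ} (hN : 2 ≤ N) (i : ℕ) :
    ∀ l : List (Fin n), l.length = koszulDegree N i →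
      barComponent h i (koszulDegree N i) (cutWord k x N i l) = cutWord k x N i l := by
  induction i with
  | zero =>
    intro l _
    rw [koszulDegree_zero]
    rfl
  | succ i ih =>
    intro l hl
    rw [koszulDegree_succ hN] at hl ⊢
    have h1 := hx (l.take (koszulStep N i))
    rw [List.length_take, min_eq_left (by omega)] at h1
    exact totalComponent_tmul_of_mem h h1 (ih _ (by simp; omega))

theorem totalComponent_cutTensor (h : DirectSum.IsInternal 𝒜)
    (hx : ∀ l : List (Fin n), wordProd x l ∈ 𝒜 l.length) {N : ℕ} (hN : 2 ≤ N) (i : ℕ)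
    (w : List (Fin n) → k) :
    totalComponent h (barComponent h i) (koszulDegree N (i + 1)) (cutTensor x N (i + 1) w) =
      cutTensor x N (i + 1) w := by
  change barComponent h (i + 1) _ _ = _
  rw [cutTensor, map_sumWords]
  refine sumWords_congr fun l hl => ?_
  rw [map_smul, barComponent_cutWord h hx hN _ l hl]

theorem component_cutTensor (h : DirectSum.IsInternal 𝒜)
    (hx : ∀ l : List (Fin n), wordProd x l ∈ 𝒜 l.length) {N : ℕ} (hN : 2 ≤ N) (i : ℕ)
    (w : List (Fin n) → k) (p : ℕ) :
    (component h p).rTensor (bar k A i) (cutTensor x N (i + 1) w) =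
      if p = koszulStep N i then cutTensor x N (i + 1) w else 0 := by
  rw [cutTensor_succ x hN]
  refine (map_sumWords ((component h p).rTensor (bar k A i)) _ _).trans ?_
  have : ∀ u : List (Fin n), u.length = koszulStep N i → ∀ y : bar k A i,
      (component h p).rTensor (bar k A i) (wordProd x u ⊗ₜ[k] y) =
        if p = koszulStep N i then wordProd x u ⊗ₜ[k] y else 0 := by
    intro u hu y
    have h1 := hx u
    rw [hu] at h1
    rw [LinearMap.rTensor_tmul, component_of_mem h _ _ h1]
    split_ifs <;> simp
  refine (sumWords_congr fun u hu => this u hu _).trans ?_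
  by_cases hp : p = koszulStep N i
  · refine Eq.trans ?_ (if_pos hp).symm
    simp only [hp, if_true]
  · refine Eq.trans ?_ (if_neg hp).symm
    simp only [hp, if_false]
    exact sumWords_zero_fun _

/-- Over an `N`-Koszul algebra, tensors of degree `ν_N(i)` in the Koszul dual coalgebra embed into
`Tor_i`. -/
theorem eq_zero_of_cutTensor_mem_barBoundaries (h : IsConnectedGraded 𝒜 ε)
    (hx : ∀ l : List (Fin n), wordProd x l ∈ 𝒜 l.length) (hε : ∀ i, ε (x i) = 0)
    {N : ℕ} (hN : 2 ≤ N) (hK : IsNKoszul 𝒜 ε N)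
    (hl : ∀ u : List (Fin n), u.length < N → ∃ l : A →ₗ[k] k, ∀ u' : List (Fin n),
      u'.length = u.length → l (wordProd x u') = if u' = u then 1 else 0) (i : ℕ) :
    ∀ w ∈ potentials k x N (koszulDegree N i), cutTensor x N i w ∈ barBoundaries ε i →
      ∀ l, l.length = koszulDegree N i → w l = 0 := by
  induction i with
  | zero =>
    rintro w - ⟨y, hy⟩ l hl
    rw [koszulDegree_zero, List.length_eq_zero_iff] at hl
    subst hl
    -- The differential into degree 0 is the difference of two copies of the augmentation, so the
    -- only boundary there is 0.
    have : barD ε 0 y = 0 := by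
      rw [barD_eq, barRes_zero]
      exact sub_self (evalLeft ε k y)
    rw [this, cutTensor_zero] at hy
    have h2 : (0 : k) = w [] * 1 := hy
    rw [← mul_one (w []), ← h2]
  | succ i ih =>
    intro w hw hb l hl'
    obtain ⟨u, v, rfl, hu⟩ : ∃ u v, l = u ++ v ∧ u.length = koszulStep N i := by
      refine ⟨l.take (koszulStep N i), l.drop (koszulStep N i), by simp, ?_⟩
      rw [koszulDegree_succ hN] at hl'
      simp
      omega
    -- The first piece is shorter than N, hence untouched by relations, and a linear form isolates
    -- the word u. Contracting with it turns the boundary into the tensor of the slice at u, again a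
    -- boundary, now in B_i.
    obtain ⟨φ, hφ⟩ := hl u (by rw [hu]; exact koszulStep_lt hN i)
    have key := contractLeft_mem_barBoundaries h hK (koszulStep_pos hN i)
      (by rw [koszulDegree_succ hN]; omega) (barRes_cutTensor hε hN i w hw)
      (totalComponent_cutTensor h.internal hx hN i w)
      (component_cutTensor h.internal hx hN i w) hb φ
    have h1 : contractLeft φ (bar k A i) (cutTensor x N (i + 1) w) =
        cutTensor x N i fun l => w (u ++ l) := by
      rw [cutTensor_succ x hN]
      refine (map_sumWords (contractLeft φ (bar k A i)) _ _).trans ?_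
      rw [sumWords_eq_single u hu]
      · rw [contractLeft_tmul, hφ u rfl, if_pos rfl, one_smul]
      · intro u' hu' hne
        rw [contractLeft_tmul, hφ u' (hu'.trans hu.symm), if_neg hne, zero_smul]
    rw [h1] at key
    rw [koszulDegree_succ hN] at hw
    refine ih _ (slice_mem_potentials hw hu) key v ?_
    rw [koszulDegree_succ hN] at hl'
    simp at hl'
    omega

end Potentials

/-! ### The top Tor space is spanned by the potential -/

section TopTor

variable {k : Type u} [Field k] {A : Type u} [Ring A] [Algebra k A] {n : ℕ} {x : Fin n → A}
  {ε : A →ₐ[k] k} {𝒜 : ℕ → Submodule k A}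

theorem exists_cocycle_of_notMem {X : Type*} [AddCommGroup X] [Module k X] {p : Submodule k X}
    {y : X} (hy : y ∉ p) : ∃ φ : X →ₗ[k] k, (∀ z ∈ p, φ z = 0) ∧ φ y = 1 := by
  obtain ⟨φ, h1, h2⟩ := Submodule.exists_le_ker_of_notMem hy
  refine ⟨(φ y)⁻¹ • φ, fun z hz => ?_, ?_⟩
  · have : φ z = 0 := h2 hz
    simp [this]
  · simp [h1]

/-- A cocycle `φ` detecting a nonzero potential `w₀`, when `Tor_{i+1}` is at most a line. -/
theorem exists_dual_cocycle (h : IsConnectedGraded 𝒜 ε)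
    (hx : ∀ l : List (Fin n), wordProd x l ∈ 𝒜 l.length) (hε : ∀ i, ε (x i) = 0)
    {N : ℕ} (hN : 2 ≤ N) (hK : IsNKoszul 𝒜 ε N)
    (hl : ∀ u : List (Fin n), u.length < N → ∃ l : A →ₗ[k] k, ∀ u' : List (Fin n),
      u'.length = u.length → l (wordProd x u') = if u' = u then 1 else 0) {i : ℕ}
    (hpd : HasProjectiveDimensionLT (trivialLeft ε) (i + 2))
    (hext : Nonempty (Abelian.Ext (trivialLeft ε) (ModuleCat.of A A) (i + 1) ≃ₗ[k] k))
    {w₀ : List (Fin n) → k} (hw₀ : w₀ ∈ potentials k x N (koszulDegree N (i + 1)))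
    {l₀ : List (Fin n)} (hl₀ : l₀.length = koszulDegree N (i + 1)) (hne : w₀ l₀ ≠ 0) :
    ∃ φ : bar k A (i + 1) →ₗ[k] k, (∀ z ∈ barBoundaries ε (i + 1), φ z = 0) ∧
      φ (cutTensor x N (i + 1) w₀) = 1 ∧ ∀ y ∈ barCycles ε (i + 1),
        y - φ y • cutTensor x N (i + 1) w₀ ∈ barBoundaries ε (i + 1) := by
  have hz : cutTensor x N (i + 1) w₀ ∉ barBoundaries ε (i + 1) := fun hb =>
    hne (eq_zero_of_cutTensor_mem_barBoundaries h hx hε hN hK hl _ _ hw₀ hb _ hl₀)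
  obtain ⟨φ, hφ, hφ1⟩ := exists_cocycle_of_notMem hz
  refine ⟨φ, hφ, hφ1, fun y hy => ?_⟩
  -- If the difference were not a boundary, a second cocycle ψ would take the value 1 on it. A
  -- relation a φ + b ψ = 0 on cycles, evaluated there and at the cycle of w₀, forces b = 0 and then
  -- a = 0.
  by_contra hy'
  obtain ⟨ψ, hψ, hψ1⟩ := exists_cocycle_of_notMem hy'
  obtain ⟨a, b, hab, H⟩ := exists_combination_of_ext_line hpd hext φ ψ hφ hψ
  have hzc := cutTensor_mem_barCycles hε hN i hw₀
  have h1 := H _ (sub_mem hy ((barCycles ε (i + 1)).smul_mem (φ y) hzc))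
  rw [hψ1, map_sub, map_smul, hφ1] at h1
  have h2 := H _ hzc
  rw [hφ1] at h2
  simp at h1
  subst h1
  simp at h2
  subst h2
  simp at hab

/-- The potentials of degree `ν_N(d)` form a line, when `Tor_d` does. -/
theorem potential_eq_smul (h : IsConnectedGraded 𝒜 ε)
    (hx : ∀ l : List (Fin n), wordProd x l ∈ 𝒜 l.length) (hε : ∀ i, ε (x i) = 0)
    {N : ℕ} (hN : 2 ≤ N) (hK : IsNKoszul 𝒜 ε N)
    (hl : ∀ u : List (Fin n), u.length < N → ∃ l : A →ₗ[k] k, ∀ u' : List (Fin n),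
      u'.length = u.length → l (wordProd x u') = if u' = u then 1 else 0) {i : ℕ}
    (hpd : HasProjectiveDimensionLT (trivialLeft ε) (i + 2))
    (hext : Nonempty (Abelian.Ext (trivialLeft ε) (ModuleCat.of A A) (i + 1) ≃ₗ[k] k))
    {w₀ : List (Fin n) → k} (hw₀ : w₀ ∈ potentials k x N (koszulDegree N (i + 1)))
    {l₀ : List (Fin n)} (hl₀ : l₀.length = koszulDegree N (i + 1)) (hne : w₀ l₀ ≠ 0)
    {w : List (Fin n) → k} (hw : w ∈ potentials k x N (koszulDegree N (i + 1))) :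
    ∃ a : k, ∀ l, l.length = koszulDegree N (i + 1) → w l = a * w₀ l := by
  obtain ⟨φ, -, -, H⟩ := exists_dual_cocycle h hx hε hN hK hl hpd hext hw₀ hl₀ hne
  refine ⟨φ (cutTensor x N (i + 1) w), fun l hl' => ?_⟩
  have h1 := H _ (cutTensor_mem_barCycles hε hN i hw)
  rw [← cutTensor_sub_smul] at h1
  have := eq_zero_of_cutTensor_mem_barBoundaries h hx hε hN hK hl (i + 1) _
    (sub_mem hw (Submodule.smul_mem _ _ hw₀)) h1 l hl'
  simpa [sub_eq_zero] using this

end TopTor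

/-! ### Algebra maps `A → K ⊗ A` and the bar complex -/

section CoBar

variable {k : Type u} [Field k] {A : Type u} [Ring A] [Algebra k A] {K : Type w} [Ring K]
  [Algebra k K] {M : Type u} [AddCommGroup M] [Module k M]

theorem sumWords_tmul {X Y : Type*} [AddCommGroup X] [Module k X] [AddCommGroup Y] [Module k Y]
    {n : ℕ} (m : ℕ) (F : List (Fin n) → X) (y : Y) :
    sumWords m F ⊗ₜ[k] y = sumWords m fun l => F l ⊗ₜ[k] y :=
  TensorProduct.sum_tmul _ _ _

theorem tmul_sumWords {X Y : Type*} [AddCommGroup X] [Module k X] [AddCommGroup Y] [Module k Y]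
    {n : ℕ} (m : ℕ) (F : List (Fin n) → X) (y : Y) :
    y ⊗ₜ[k] sumWords m F = sumWords m fun l => y ⊗ₜ[k] F l :=
  TensorProduct.tmul_sum _ _ _

/-- The product `(p ⊗ a) (q ⊗ y) = p q ⊗ (a ⊗ y)`. -/
noncomputable def mulPair (k : Type u) [Field k] (A : Type u) [Ring A] [Algebra k A] (K : Type w)
    [Ring K] [Algebra k K] (M : Type u) [AddCommGroup M] [Module k M] :
    (K ⊗[k] A) ⊗[k] (K ⊗[k] M) →ₗ[k] K ⊗[k] (A ⊗[k] M) :=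
  (LinearMap.mul' k K).rTensor (A ⊗[k] M) ∘ₗ
    (TensorProduct.tensorTensorTensorComm k K A K M).toLinearMap

@[simp] theorem mulPair_tmul (p q : K) (a : A) (y : M) :
    mulPair k A K M ((p ⊗ₜ a) ⊗ₜ (q ⊗ₜ y)) = (p * q) ⊗ₜ (a ⊗ₜ y) := by
  simp [mulPair]

theorem mulPair_mul (s t : K ⊗[k] A) (y : K ⊗[k] M) :
    mulPair k A K M ((s * t) ⊗ₜ y) = (actLeft M).lTensor K
      (mulPair k A K (A ⊗[k] M) (s ⊗ₜ mulPair k A K M (t ⊗ₜ y))) := by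
  induction s with
  | zero => simp
  | add s s' hs hs' => simp only [add_mul, TensorProduct.add_tmul, map_add, hs, hs']
  | tmul p a =>
    induction t with
    | zero => simp
    | add s s' hs hs' =>
      simp only [mul_add, TensorProduct.tmul_add, TensorProduct.add_tmul, map_add, hs, hs']
    | tmul q b =>
      induction y with
      | zero => simp
      | add s s' hs hs' => simp only [TensorProduct.tmul_add, map_add, hs, hs']
      | tmul r y => simp [Algebra.TensorProduct.tmul_mul_tmul, mul_assoc]

theorem mulPair_lTensor {M' : Type u} [AddCommGroup M'] [Module k M'] (f : M →ₗ[k] M')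
    (s : K ⊗[k] A) (y : K ⊗[k] M) :
    mulPair k A K M' (s ⊗ₜ f.lTensor K y) =
      (f.lTensor A).lTensor K (mulPair k A K M (s ⊗ₜ y)) := by
  induction s with
  | zero => simp
  | add s s' hs hs' => simp only [TensorProduct.add_tmul, map_add, hs, hs']
  | tmul p a =>
    induction y with
    | zero => simp
    | add s s' hs hs' => simp only [TensorProduct.tmul_add, map_add, hs, hs']
    | tmul r y => simp

theorem evalLeft_mulPair (ε : A →ₐ[k] k) (s : K ⊗[k] A) (y : K ⊗[k] M) :
    (evalLeft ε M).lTensor K (mulPair k A K M (s ⊗ₜ y)) =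
      (LinearMap.mulLeft k (TensorProduct.rid k K (ε.toLinearMap.lTensor K s))).rTensor M y := by
  induction y with
  | zero => simp
  | add s s' hs hs' => simp only [TensorProduct.tmul_add, map_add, hs, hs']
  | tmul r y =>
    induction s with
    | zero => simp
    | add s s' hs hs' =>
      simp only [TensorProduct.add_tmul, map_add, hs, hs', LinearMap.rTensor_tmul,
        LinearMap.mulLeft_apply, add_mul]
    | tmul p a => simp [TensorProduct.smul_tmul']

/-- The extension of an algebra map `A → K ⊗ A` and a linear map `M → K ⊗ M` to `A ⊗ M`. -/
noncomputable def coStep (δ : A →ₐ[k] K ⊗[k] A) (co : M →ₗ[k] K ⊗[k] M) :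
    A ⊗[k] M →ₗ[k] K ⊗[k] (A ⊗[k] M) :=
  mulPair k A K M ∘ₗ TensorProduct.map δ.toLinearMap co

theorem coStep_tmul (δ : A →ₐ[k] K ⊗[k] A) (co : M →ₗ[k] K ⊗[k] M) (a : A) (y : M) :
    coStep δ co (a ⊗ₜ y) = mulPair k A K M (δ a ⊗ₜ co y) := rfl

theorem coStep_actLeft (δ : A →ₐ[k] K ⊗[k] A) (co : M →ₗ[k] K ⊗[k] M) (y : A ⊗[k] (A ⊗[k] M)) :
    coStep δ co (actLeft M y) = (actLeft M).lTensor K (coStep δ (coStep δ co) y) := by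
  induction y with
  | zero => simp
  | add s s' hs hs' => simp only [map_add, hs, hs']
  | tmul a y =>
    induction y with
    | zero => simp
    | add s s' hs hs' => simp only [TensorProduct.tmul_add, map_add, hs, hs']
    | tmul b y => rw [actLeft_tmul, coStep_tmul, coStep_tmul, coStep_tmul, map_mul, mulPair_mul]

theorem coStep_lTensor {M' : Type u} [AddCommGroup M'] [Module k M'] (δ : A →ₐ[k] K ⊗[k] A)
    {co : M →ₗ[k] K ⊗[k] M} {co' : M' →ₗ[k] K ⊗[k] M'} {f : M →ₗ[k] M'}
    (hf : ∀ y, co' (f y) = f.lTensor K (co y)) (y : A ⊗[k] M) :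
    coStep δ co' (f.lTensor A y) = (f.lTensor A).lTensor K (coStep δ co y) := by
  induction y with
  | zero => simp
  | add s s' hs hs' => simp only [map_add, hs, hs']
  | tmul a y => rw [LinearMap.lTensor_tmul, coStep_tmul, coStep_tmul, hf, mulPair_lTensor]

theorem coStep_evalLeft {δ : A →ₐ[k] K ⊗[k] A} {ε : A →ₐ[k] k}
    (hδ : ∀ a, TensorProduct.rid k K (ε.toLinearMap.lTensor K (δ a)) = algebraMap k K (ε a))
    (co : M →ₗ[k] K ⊗[k] M) (y : A ⊗[k] M) :
    co (evalLeft ε M y) = (evalLeft ε M).lTensor K (coStep δ co y) := by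
  induction y with
  | zero => simp
  | add s s' hs hs' => simp only [map_add, hs, hs']
  | tmul a y =>
    rw [coStep_tmul, evalLeft_mulPair, hδ, evalLeft_tmul, map_smul]
    induction co y with
    | zero => simp
    | add s s' hs hs' => simp only [map_add, smul_add, hs, hs']
    | tmul p y => simp [TensorProduct.smul_tmul', Algebra.smul_def]

/-- Multiplicativity of δ handles the action term and `hD` the other, so compatibility with the
differential propagates up the bar resolution. -/
theorem coStep_barStep (δ : A →ₐ[k] K ⊗[k] A) {co : M →ₗ[k] K ⊗[k] M} {D : A ⊗[k] M →ₗ[k] M}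
    (hD : ∀ y, co (D y) = D.lTensor K (coStep δ co y)) (y : A ⊗[k] (A ⊗[k] M)) :
    coStep δ co (barStep D y) = (barStep D).lTensor K (coStep δ (coStep δ co) y) := by
  rw [barStep, LinearMap.sub_apply, map_sub, coStep_actLeft, coStep_lTensor δ hD,
    LinearMap.lTensor_sub, LinearMap.sub_apply]

/-- The diagonal extension of an algebra map `A → K ⊗ A` to the bar complex. -/
noncomputable def coBar (δ : A →ₐ[k] K ⊗[k] A) : (i : ℕ) → bar k A i →ₗ[k] K ⊗[k] bar k A i
  | 0 => TensorProduct.mk k K k 1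
  | i + 1 => coStep δ (coBar δ i)

theorem coBar_barRes {δ : A →ₐ[k] K ⊗[k] A} {ε : A →ₐ[k] k}
    (hδ : ∀ a, TensorProduct.rid k K (ε.toLinearMap.lTensor K (δ a)) = algebraMap k K (ε a))
    (i : ℕ) : ∀ y : A ⊗[k] bar k A i,
      coBar δ i (barRes ε i y) = (barRes ε i).lTensor K (coStep δ (coBar δ i) y) := by
  induction i with
  | zero => exact coStep_evalLeft hδ _
  | succ i ih => exact coStep_barStep δ ih

/-- This makes the diagonal map pass to Tor: boundaries go to K ⊗ boundaries. -/
theorem coBar_barD {δ : A →ₐ[k] K ⊗[k] A} {ε : A →ₐ[k] k}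
    (hδ : ∀ a, TensorProduct.rid k K (ε.toLinearMap.lTensor K (δ a)) = algebraMap k K (ε a))
    (i : ℕ) (y : A ⊗[k] bar k A i) :
    coBar δ i (barD ε i y) = (barD ε i).lTensor K (coStep δ (coBar δ i) y) := by
  rw [barD_eq, LinearMap.sub_apply, map_sub, coBar_barRes hδ, coStep_evalLeft hδ,
    LinearMap.lTensor_sub, LinearMap.sub_apply]

/-! ### Products of matrix entries along words -/

variable {n : ℕ}

/-- `γ_{i₁ j₁} γ_{i₂ j₂} ⋯` for words `i₁ i₂ ⋯` and `j₁ j₂ ⋯`. -/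
def pairProd {K : Type w} [Monoid K] (γ : Matrix (Fin n) (Fin n) K) (I J : List (Fin n)) : K :=
  (List.zipWith (fun i j => γ i j) I J).prod

theorem pairProd_append {K : Type w} [Monoid K] (γ : Matrix (Fin n) (Fin n) K)
    {I J : List (Fin n)} (h : I.length = J.length) (I' J' : List (Fin n)) :
    pairProd γ (I ++ I') (J ++ J') = pairProd γ I J * pairProd γ I' J' := by
  rw [pairProd, List.zipWith_append h, List.prod_append]
  rfl

theorem pairProd_ofFn {K : Type w} [Monoid K] (γ : Matrix (Fin n) (Fin n) K) {m : ℕ}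
    (I J : Fin m → Fin n) : pairProd γ (List.ofFn I) (List.ofFn J) = prodPow γ I J := by
  induction m with
  | zero => simp [pairProd]
  | succ m ih =>
    refine Fin.consCases (fun i I => ?_) I
    refine Fin.consCases (fun j J => ?_) J
    rw [prodPow_cons, ← ih]
    simp [pairProd, List.ofFn_succ]

variable {x : Fin n → A} {γ : Matrix (Fin n) (Fin n) K} {δ : A →ₐ[k] K ⊗[k] A}

theorem wordProd_sum_tmul {m : ℕ} (I : List (Fin n)) (hI : I.length = m) :
    wordProd (fun i => ∑ j, γ i j ⊗ₜ[k] x j) I =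
      sumWords m fun J => pairProd γ I J ⊗ₜ wordProd x J := by
  subst hI
  induction I with
  | nil => simp [sumWords_zero, pairProd, Algebra.TensorProduct.one_def]
  | cons i I ih =>
    rw [wordProd_cons, ih, List.length_cons, sumWords_succ, sumWords, Finset.sum_mul_sum]
    simp [sumWords, pairProd, Algebra.TensorProduct.tmul_mul_tmul]

theorem map_wordProd {R S F : Type*} [Monoid R] [Monoid S] [FunLike F R S] [MonoidHomClass F R S]
    (f : F) (y : Fin n → R) (l : List (Fin n)) :
    f (wordProd y l) = wordProd (fun i => f (y i)) l := by
  simp [wordProd, map_list_prod, Function.comp_def]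

theorem coaction_wordProd (hδ : ∀ i, δ (x i) = ∑ j, γ i j ⊗ₜ x j) {m : ℕ} (I : List (Fin n))
    (hI : I.length = m) :
    δ (wordProd x I) = sumWords m fun J => pairProd γ I J ⊗ₜ wordProd x J := by
  simp only [map_wordProd, hδ, wordProd_sum_tmul I hI]

/-- Both sides are algebra maps in a that vanish on the generators. This is the compatibility of δ
with ε that the bar complex requires. -/
theorem coaction_augmentation {ε : A →ₐ[k] k} (hε : ∀ i, ε (x i) = 0)
    (hadj : Algebra.adjoin k (Set.range x) = ⊤) (hδ : ∀ i, δ (x i) = ∑ j, γ i j ⊗ₜ x j) (a : A) :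
    TensorProduct.rid k K (ε.toLinearMap.lTensor K (δ a)) = algebraMap k K (ε a) := by
  have : ((Algebra.TensorProduct.rid k k K).toAlgHom.comp
      (Algebra.TensorProduct.map (AlgHom.id k K) ε)).comp δ = (Algebra.ofId k K).comp ε := by
    refine AlgHom.ext_of_adjoin_eq_top hadj ?_
    rintro _ ⟨i, rfl⟩
    simp [hδ, hε]
  exact DFunLike.congr_fun this a

theorem coBar_cutWord (hδ : ∀ i, δ (x i) = ∑ j, γ i j ⊗ₜ x j) {N : ℕ} (hN : 2 ≤ N) (i : ℕ) :
    ∀ I : List (Fin n), I.length = koszulDegree N i →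
      coBar δ i (cutWord k x N i I) =
        sumWords (koszulDegree N i) fun J => pairProd γ I J ⊗ₜ cutWord k x N i J := by
  induction i with
  | zero =>
    intro I hI
    rw [koszulDegree_zero] at hI ⊢
    rw [List.length_eq_zero_iff] at hI
    subst hI
    rw [sumWords_zero]
    rfl
  | succ i ih =>
    intro I hI
    rw [koszulDegree_succ hN] at hI
    have hu : (I.take (koszulStep N i)).length = koszulStep N i := by simp; omega
    have hv : (I.drop (koszulStep N i)).length = koszulDegree N i := by simp; omega
    rw [← List.take_append_drop (koszulStep N i) I]
    generalize I.take (koszulStep N i) = u at hu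
    generalize I.drop (koszulStep N i) = v at hv
    rw [cutWord_append x N i hu]
    refine (coStep_tmul δ (coBar δ i) _ _).trans ?_
    rw [coaction_wordProd hδ u hu, ih v hv, koszulDegree_succ hN, sumWords_add]
    rw [sumWords_tmul, map_sumWords]
    refine sumWords_congr fun u' hu' => ?_
    rw [tmul_sumWords, map_sumWords]
    refine sumWords_congr fun v' _ => ?_
    rw [mulPair_tmul, pairProd_append γ (hu.trans hu'.symm), cutWord_append x N i hu']
    rfl

/-- After the two sums over words are exchanged, the coefficient in K of each cut word J is the left
side of `hg`. -/
theorem coBar_cutTensor (hδ : ∀ i, δ (x i) = ∑ j, γ i j ⊗ₜ x j) {N : ℕ} (hN : 2 ≤ N) (i : ℕ)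
    {w : List (Fin n) → k} {g : K}
    (hg : ∀ J : List (Fin n), J.length = koszulDegree N i →
      (sumWords (koszulDegree N i) fun I => w I • pairProd γ I J) = w J • g) :
    coBar δ i (cutTensor x N i w) = g ⊗ₜ cutTensor x N i w := by
  rw [cutTensor, map_sumWords]
  have h1 : ∀ I : List (Fin n), I.length = koszulDegree N i →
      coBar δ i (w I • cutWord k x N i I) = sumWords (koszulDegree N i) fun J =>
        (w I • pairProd γ I J) ⊗ₜ cutWord k x N i J := by
    intro I hI
    rw [map_smul, coBar_cutWord hδ hN i I hI, sumWords, Finset.smul_sum]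
    simp only [TensorProduct.smul_tmul']
    rfl
  rw [sumWords_congr h1, sumWords_comm]
  have h2 : ∀ J : List (Fin n), J.length = koszulDegree N i →
      (sumWords (koszulDegree N i) fun I => (w I • pairProd γ I J) ⊗ₜ[k] cutWord k x N i J) =
        g ⊗ₜ (w J • cutWord k x N i J) := by
    intro J hJ
    rw [← sumWords_tmul, hg J hJ, TensorProduct.smul_tmul]
  rw [sumWords_congr h2, tmul_sumWords]

/-- A linear form on `K` takes the transform of a potential to a potential. -/
theorem transform_mem_potentials (hδ : ∀ i, δ (x i) = ∑ j, γ i j ⊗ₜ x j) {N m : ℕ}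
    {w : List (Fin n) → k} (hw : w ∈ potentials k x N m) (f : K →ₗ[k] k) :
    (fun J => f (sumWords m fun I => w I • pairProd γ I J)) ∈ potentials k x N m := by
  intro P S hm
  -- The vanishing holds in K ⊗ A, before any linear form is applied.
  have h0 : (sumWords N fun J =>
      (sumWords m fun I => w I • pairProd γ I (P ++ J ++ S)) ⊗ₜ[k] wordProd x J) = 0 := by
    have h1 : ∀ J : List (Fin n), J.length = N →
        (sumWords m fun I => w I • pairProd γ I (P ++ J ++ S)) ⊗ₜ[k] wordProd x J =
        sumWords P.length fun P' => sumWords S.length fun S' => sumWords N fun J' =>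
          w (P' ++ J' ++ S') • ((pairProd γ P' P ⊗ₜ[k] (1 : A)) *
            (pairProd γ J' J ⊗ₜ[k] wordProd x J) * (pairProd γ S' S ⊗ₜ[k] (1 : A))) := by
      intro J hJ
      rw [← hm, sumWords_add, sumWords_add]
      change (TensorProduct.mk k K A).flip (wordProd x J) _ = _
      rw [map_sumWords]
      refine sumWords_congr fun P' hP' => ?_
      rw [map_sumWords, sumWords_comm]
      refine sumWords_congr fun J' hJ' => ?_
      rw [map_sumWords]
      refine sumWords_congr fun S' hS' => ?_
      rw [pairProd_append γ (by simp [hP', hJ', hJ]), pairProd_append γ hP']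
      simp [Algebra.TensorProduct.tmul_mul_tmul, TensorProduct.smul_tmul']
    rw [sumWords_congr h1, sumWords_comm, ← sumWords_zero_fun (n := n) P.length]
    refine sumWords_congr fun P' hP' => ?_
    rw [sumWords_comm, ← sumWords_zero_fun (n := n) S.length]
    refine sumWords_congr fun S' hS' => ?_
    rw [sumWords_comm]
    -- Summing over the middle word J reassembles δ of the monomial J' between two factors from K.
    -- Summing then over J' gives δ of a relation, because w is a potential.
    have h2 : ∀ J' : List (Fin n), J'.length = N → (sumWords N fun J =>
        w (P' ++ J' ++ S') • ((pairProd γ P' P ⊗ₜ[k] (1 : A)) *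
            (pairProd γ J' J ⊗ₜ[k] wordProd x J) * (pairProd γ S' S ⊗ₜ[k] (1 : A)))) =
        (pairProd γ P' P ⊗ₜ[k] (1 : A)) * δ (w (P' ++ J' ++ S') • wordProd x J') *
          (pairProd γ S' S ⊗ₜ[k] (1 : A)) := by
      intro J' hJ'
      rw [map_smul, coaction_wordProd hδ J' hJ']
      simp only [sumWords, Finset.mul_sum, Finset.sum_mul, Finset.smul_sum, mul_smul_comm,
        smul_mul_assoc]
    rw [sumWords_congr h2]
    simp only [sumWords]
    rw [← Finset.sum_mul, ← Finset.mul_sum, ← map_sum]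
    have := hw P' S' (by omega)
    rw [sumWords] at this
    rw [this, map_zero, mul_zero, zero_mul]
  have h3 := congrArg (fun t => TensorProduct.lid k A (f.rTensor A t)) h0
  simp only [map_sumWords, map_zero, LinearMap.rTensor_tmul, TensorProduct.lid_tmul] at h3
  simpa [map_sumWords] using h3

/-- Linear forms separate the points of K, so proportionality over k after every form is
proportionality with a factor in K, read off at l₀. This carries the uniqueness of the potential
from k to K. -/
theorem exists_eq_smul_of_forall_linearForm {X : Type*} {K : Type*} [AddCommGroup K] [Module k K]
    (u : X → K) (w : X → k) {l₀ : X} (hne : w l₀ ≠ 0)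
    (h : ∀ f : K →ₗ[k] k, ∃ a : k, ∀ l, f (u l) = a * w l) : ∃ g : K, ∀ l, u l = w l • g := by
  refine ⟨(w l₀)⁻¹ • u l₀, fun l => ?_⟩
  rw [← sub_eq_zero]
  refine (Module.forall_dual_apply_eq_zero_iff k _).1 fun f => ?_
  obtain ⟨a, ha⟩ := h f
  rw [map_sub, map_smul, map_smul, ha, ha]
  simp only [smul_eq_mul]
  field_simp
  ring

end CoBar

/-! ### Words in superpotential algebras -/

namespace SuperpotentialAlgebra

variable {k : Type u} [Field k] {m n : ℕ} (c : (Fin m → Fin n) → k) (N : ℕ)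

theorem prod_ofFn_eq_wordProd {R : Type*} [Monoid R] {j : ℕ} (y : Fin n → R) (J : Fin j → Fin n) :
    (List.ofFn fun s => y (J s)).prod = wordProd y (List.ofFn J) := by
  simp [wordProd, List.map_ofFn, Function.comp_def]

theorem adjoin_x : Algebra.adjoin k (Set.range (x c N)) = ⊤ := by
  have : Set.range (x c N) =
      RingQuot.mkAlgHom k (SuperpotentialRel c N) '' Set.range (FreeAlgebra.ι k) := by
    rw [← Set.range_comp]; rfl
  rw [this]
  refine (AlgHom.map_adjoin (RingQuot.mkAlgHom k (SuperpotentialRel c N)) _).symm.trans ?_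
  rw [FreeAlgebra.adjoin_range_ι, Algebra.map_top]
  exact (AlgHom.range_eq_top _).2 (RingQuot.mkAlgHom_surjective k _)

theorem wordProd_mem_degreePart (l : List (Fin n)) :
    wordProd (x c N) l ∈ degreePart c N l.length := by
  refine Submodule.subset_span ⟨l.get, ?_⟩
  simp only
  rw [prod_ofFn_eq_wordProd, List.ofFn_get]

theorem augmentation_x (hN : 2 ≤ N) (i : Fin n) : augmentation c N hN (x c N i) = 0 :=
  (RingQuot.liftAlgHom_mkAlgHom_apply _ _ _ _).trans (FreeAlgebra.lift_ι_apply _ _)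

theorem relation (I : Fin (m - N) → Fin n) :
    ∑ J : Fin N → Fin n, c (splice I J) • wordProd (x c N) (List.ofFn J) = 0 := by
  have h := RingQuot.mkAlgHom_rel k (SuperpotentialRel.rel (c := c) (N := N) I)
  simp only [map_sum, map_smul, map_zero, map_list_prod, List.map_ofFn, Function.comp_def] at h
  simp only [← prod_ofFn_eq_wordProd]
  exact h

variable {c N}

/-- The algebra map out of a superpotential algebra determined by elements satisfying the
relations. -/
noncomputable def lift {B : Type w} [Ring B] [Algebra k B] (y : Fin n → B)
    (hy : ∀ I : Fin (m - N) → Fin n,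
      ∑ J : Fin N → Fin n, c (splice I J) • wordProd y (List.ofFn J) = 0) :
    SuperpotentialAlgebra c N →ₐ[k] B :=
  RingQuot.liftAlgHom k ⟨FreeAlgebra.lift k y, by
    rintro _ _ ⟨I⟩
    simp only [← prod_ofFn_eq_wordProd] at hy
    simpa [map_list_prod, List.map_ofFn, Function.comp_def] using hy I⟩

theorem lift_x {B : Type w} [Ring B] [Algebra k B] (y : Fin n → B)
    (hy : ∀ I : Fin (m - N) → Fin n,
      ∑ J : Fin N → Fin n, c (splice I J) • wordProd y (List.ofFn J) = 0) (i : Fin n) :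
    lift y hy (x c N i) = y i :=
  (RingQuot.liftAlgHom_mkAlgHom_apply _ _ _ _).trans (FreeAlgebra.lift_ι_apply _ _)

/-- The operator prepending a letter to words, truncated at length `N`. -/
noncomputable def prependTruncated (k : Type u) [Field k] {n : ℕ} (N : ℕ) (i : Fin n) :
    Module.End k (List (Fin n) →₀ k) :=
  Finsupp.linearCombination k fun l => if l.length + 1 < N then Finsupp.single (i :: l) 1 else 0

/-- The case u = [] is separate because the empty product is the identity even on words that are
already too long. -/
theorem wordProd_prependTruncated {N : ℕ} (u l : List (Fin n)) :
    wordProd (prependTruncated k N) u (Finsupp.single l 1) =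
      if u = [] ∨ u.length + l.length < N then Finsupp.single (u ++ l) 1 else 0 := by
  induction u with
  | nil => simp
  | cons i u ih =>
    rw [wordProd_cons, Module.End.mul_apply, ih]
    by_cases hu : u = []
    · subst hu
      simp [prependTruncated, add_comm]
    · by_cases h : u.length + l.length < N
      · rw [if_pos (Or.inr h)]
        simp only [prependTruncated, Finsupp.linearCombination_single, one_smul,
          List.length_append, List.length_cons, reduceCtorEq, false_or, List.cons_append]
        congr 1
        simp only [eq_iff_iff]
        omega
      · rw [if_neg (by tauto), if_neg (by simp; omega), map_zero]

/-- Words of length less than `N` are linearly independent in a superpotential algebra. -/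
theorem exists_dual_word (hN : 2 ≤ N) (u : List (Fin n)) (hu : u.length < N) :
    ∃ l : SuperpotentialAlgebra c N →ₗ[k] k, ∀ u' : List (Fin n), u'.length = u.length →
      l (wordProd (x c N) u') = if u' = u then 1 else 0 := by
  -- Truncation makes every product of N letters act as zero, so the algebra acts on the truncated
  -- words whatever its coefficients c are.
  have hy : ∀ I : Fin (m - N) → Fin n, ∑ J : Fin N → Fin n,
      c (splice I J) • wordProd (prependTruncated k N) (List.ofFn J) = 0 := by
    intro I
    refine Finset.sum_eq_zero fun J _ => ?_
    have : wordProd (prependTruncated k N) (List.ofFn J) = 0 := by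
      refine Finsupp.lhom_ext' fun l => LinearMap.ext_ring ?_
      refine (wordProd_prependTruncated _ _).trans ?_
      rw [if_neg]
      · simp
      · simp
        omega
    rw [this, smul_zero]
  -- The form acts on the empty word and reads the coefficient of u.
  refine ⟨Finsupp.lapply u ∘ₗ LinearMap.applyₗ (Finsupp.single [] 1) ∘ₗ
    (lift (prependTruncated k N) hy).toLinearMap, fun u' hu' => ?_⟩
  have h1 : lift (prependTruncated k N) hy (wordProd (x c N) u') =
      wordProd (prependTruncated k N) u' := by
    rw [map_wordProd]
    simp only [lift_x]
  simp only [LinearMap.comp_apply, AlgHom.toLinearMap_apply, h1, LinearMap.applyₗ_apply_apply,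
    Finsupp.lapply_apply]
  rw [wordProd_prependTruncated, if_pos (Or.inr (by simp; omega)), List.append_nil,
    Finsupp.single_apply]

/-- Linear independence of the generators over any space of coefficients. -/
theorem tmul_x_injective (hN : 2 ≤ N) {X : Type w} [AddCommGroup X] [Module k X]
    {a a' : Fin n → X} (h : ∑ j, a j ⊗ₜ[k] x c N j = ∑ j, a' j ⊗ₜ[k] x c N j) : a = a' := by
  funext i
  obtain ⟨l, hl⟩ := exists_dual_word (c := c) hN [i] (by simp; omega)
  have h1 : ∀ j, l (x c N j) = if j = i then 1 else 0 := by
    intro j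
    have := hl [j] rfl
    simpa using this
  have h2 := congrArg (fun t => TensorProduct.rid k X (l.lTensor X t)) h
  simpa [h1] using h2

/-! ### Coefficients as functions on words -/

variable (c)

/-- The coefficients of a tensor as a function on words. -/
def wordCoeff (l : List (Fin n)) : k :=
  if h : l.length = m then c fun s => l.get (s.cast h.symm) else 0

variable {c}

theorem wordCoeff_ofFn (I : Fin m → Fin n) : wordCoeff c (List.ofFn I) = c I := by
  rw [wordCoeff, dif_pos (by simp)]
  congr 1
  funext s
  simp

theorem ofFn_splice (hNm : N ≤ m) (I : Fin (m - N) → Fin n) (J : Fin N → Fin n) :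
    List.ofFn (splice I J) = List.ofFn I ++ List.ofFn J := by
  refine List.ext_getElem (by simp; omega) fun s h1 h2 => ?_
  rw [List.getElem_append, List.getElem_ofFn]
  simp only [splice, List.length_ofFn, List.getElem_ofFn]

theorem wordCoeff_append (hNm : N ≤ m) (I : Fin (m - N) → Fin n) (J : Fin N → Fin n) :
    wordCoeff c (List.ofFn I ++ List.ofFn J) = c (splice I J) := by
  rw [← ofFn_splice hNm, wordCoeff_ofFn]

theorem sum_smul_prodPow {K : Type w} [Ring K] [Algebra k K] (γ : Matrix (Fin n) (Fin n) K)
    (J : Fin m → Fin n) :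
    ∑ I, c I • prodPow γ I J =
      sumWords m fun I => wordCoeff c I • pairProd γ I (List.ofFn J) := by
  simp only [sumWords, wordCoeff_ofFn, pairProd_ofFn]

theorem sum_smul_prodPow_splice (hNm : N ≤ m) {K : Type w} [Ring K] [Algebra k K]
    (γ : Matrix (Fin n) (Fin n) K) (Q : Fin (m - N) → Fin n) (L : Fin N → Fin n) :
    ∑ I, c I • prodPow γ I (splice Q L) = ∑ P : Fin (m - N) → Fin n,
      prodPow γ P Q * ∑ J : Fin N → Fin n, c (splice P J) • prodPow γ J L := by
  have hm : m - N + N = m := Nat.sub_add_cancel hNm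
  rw [sum_smul_prodPow, ofFn_splice hNm]
  have : ∀ F : List (Fin n) → K, sumWords m F = sumWords (m - N + N) F := by rw [hm]; simp
  rw [this, sumWords_add]
  simp only [sumWords]
  refine Finset.sum_congr rfl fun P _ => ?_
  rw [Finset.mul_sum]
  refine Finset.sum_congr rfl fun J _ => ?_
  rw [wordCoeff_append hNm, pairProd_append γ (by simp), pairProd_ofFn, pairProd_ofFn,
    mul_smul_comm]

/-- Matrices preserving the superpotential up to a factor act on the superpotential algebra. -/
theorem exists_coaction (hNm : N ≤ m) {K : Type w} [Ring K] [Algebra k K]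
    {γ W : Matrix (Fin n) (Fin n) K} {g : K}
    (hγ : ∀ J, ∑ I, c I • prodPow γ I J = c J • g) (hW : W * γ.transpose = 1) :
    ∃ δ : SuperpotentialAlgebra c N →ₐ[k] K ⊗[k] SuperpotentialAlgebra c N,
      ∀ i, δ (x c N i) = ∑ j, γ i j ⊗ₜ x c N j := by
  refine ⟨lift (fun i => ∑ j, γ i j ⊗ₜ x c N j) fun P => ?_, lift_x _ _⟩
  -- Invariance involves all m slots. The first m - N matrix factors stand on the left and are
  -- summed over their row indices; reversed products of the left inverse W of the transpose remove
  -- them one slot at a time.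
  have h1 : ∀ L : Fin N → Fin n, ∑ J : Fin N → Fin n, c (splice P J) • prodPow γ J L =
      ∑ Q, c (splice Q L) • (revPow W P Q * g) := by
    intro L
    calc _ = ∑ P', (∑ Q, revPow W P Q * prodPow γ.transpose Q P') *
          ∑ J : Fin N → Fin n, c (splice P' J) • prodPow γ J L := by
          simp [revPow_mul_prodPow hW]
      _ = ∑ Q, revPow W P Q * ∑ P', prodPow γ P' Q *
          ∑ J : Fin N → Fin n, c (splice P' J) • prodPow γ J L := by
          simp only [Finset.sum_mul]
          rw [Finset.sum_comm]
          refine Finset.sum_congr rfl fun Q _ => ?_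
          rw [Finset.mul_sum]
          refine Finset.sum_congr rfl fun P' _ => ?_
          rw [mul_assoc]
          rfl
      _ = _ := by
          refine Finset.sum_congr rfl fun Q _ => ?_
          rw [← sum_smul_prodPow_splice hNm, hγ, mul_smul_comm]
  -- The image of the relation indexed by P becomes a combination, with coefficients in K, of the
  -- relations indexed by Q.
  calc _ = ∑ L : Fin N → Fin n, (∑ J : Fin N → Fin n, c (splice P J) • prodPow γ J L) ⊗ₜ[k]
          wordProd (x c N) (List.ofFn L) := by
        simp only [TensorProduct.sum_tmul]
        rw [Finset.sum_comm]
        refine Finset.sum_congr rfl fun J _ => ?_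
        rw [wordProd_sum_tmul (m := N) _ (by simp), sumWords, Finset.smul_sum]
        refine Finset.sum_congr rfl fun L _ => ?_
        rw [pairProd_ofFn, TensorProduct.smul_tmul']
    _ = ∑ Q, (revPow W P Q * g) ⊗ₜ[k]
          ∑ L : Fin N → Fin n, c (splice Q L) • wordProd (x c N) (List.ofFn L) := by
        simp only [h1, TensorProduct.sum_tmul, TensorProduct.tmul_sum]
        rw [Finset.sum_comm]
        simp only [TensorProduct.smul_tmul]
    _ = 0 := by simp only [relation, TensorProduct.tmul_zero, Finset.sum_const_zero]

/-! ### Superpotentials of preregular forms are potentials -/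

section Preregular

variable {Z : Type v} [AddCommGroup Z] [Module k Z] {r : ℕ} (t : PreregularForm k Z r)
  (b : Module.Basis (Fin n) k Z)

theorem wordCoeff_concat (L : List (Fin n)) (hL : L.length = r) (l : Fin n) :
    wordCoeff (t.coeff b) (L ++ [l]) =
      ∑ i, t.twistMatrix b i l * wordCoeff (t.coeff b) (i :: L) := by
  subst hL
  have h1 : L ++ [l] = List.ofFn (Fin.snoc L.get l : Fin (L.length + 1) → Fin n) := by
    simp [List.ofFn_succ', -List.ofFn_succ, -List.get_eq_getElem]
  have h2 : ∀ i, i :: L = List.ofFn (Fin.cons i L.get : Fin (L.length + 1) → Fin n) := by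
    intro i
    simp [List.ofFn_succ, -List.get_eq_getElem]
  rw [h1, wordCoeff_ofFn, t.coeff_snoc]
  refine Finset.sum_congr rfl fun i _ => ?_
  rw [h2, wordCoeff_ofFn]

/-- The superpotential is a potential: all its cyclic slices are relations. -/
theorem wordCoeff_mem_potentials (hNm : N ≤ r + 1) :
    wordCoeff (t.coeff b) ∈ potentials k (x (t.coeff b) N) N (r + 1) := by
  intro P S
  -- The induction shortens the suffix: twisted cyclicity moves its last letter to the front of the
  -- prefix, at the cost of the twist matrix. With empty suffix the claim is a defining relation.
  induction S using List.reverseRecOn generalizing P with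
  | nil =>
    intro h
    simp only [List.length_nil, add_zero] at h
    have hP : P.length = r + 1 - N := by omega
    obtain ⟨I, rfl⟩ : ∃ I : Fin (r + 1 - N) → Fin n, P = List.ofFn I :=
      ⟨fun s => P.get (s.cast hP.symm), by
        refine List.ext_getElem (by simp [hP]) fun s h1 h2 => ?_
        simp⟩
    simp only [sumWords, List.append_nil, wordCoeff_append hNm]
    exact relation _ _ I
  | append_singleton S l ih =>
    intro h
    simp only [List.length_append, List.length_cons, List.length_nil, zero_add] at h
    have h1 : ∀ J : List (Fin n), J.length = N →
        wordCoeff (t.coeff b) (P ++ J ++ (S ++ [l])) • wordProd (x (t.coeff b) N) J =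
        ∑ i, t.twistMatrix b i l • (wordCoeff (t.coeff b) ((i :: P) ++ J ++ S) •
          wordProd (x (t.coeff b) N) J) := by
      intro J hJ
      rw [← List.append_assoc, wordCoeff_concat t b _ (by simp; omega), Finset.sum_smul]
      simp [mul_smul]
    rw [sumWords_congr h1, sumWords, Finset.sum_comm]
    refine Finset.sum_eq_zero fun i _ => ?_
    rw [← Finset.smul_sum]
    have := ih (i :: P) (by simp; omega)
    rw [sumWords] at this
    rw [this, smul_zero]

theorem exists_coeff_ne_zero [NeZero n] : ∃ J, t.coeff b J ≠ 0 := by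
  obtain ⟨p, hp⟩ := t.exists_polar_right b
  by_contra! h
  have := hp 0 0
  simp [h] at this

end Preregular

end SuperpotentialAlgebra

/-! ### Consequences of Artin–Schelter regularity -/

section RegularConsequences

open SuperpotentialAlgebra

theorem IsASRegular.hasProjectiveDimensionLT {k : Type u} [Field k] {A : Type u} [Ring A]
    [Algebra k A] {𝒜 : ℕ → Submodule k A} {ε : A →ₐ[k] k} {d : ℕ} (h : IsASRegular 𝒜 ε d) :
    HasProjectiveDimensionLT (trivialLeft ε) (d + 1) := by
  refine (projectiveDimension_le_iff (trivialLeft ε) d).1 ?_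
  rw [← h.gldim_left]
  exact le_iSup (fun M : ModuleCat.{u} A => projectiveDimension M) (trivialLeft ε)

/-- Without generators A would be k, so the trivial module would be projective and Ext^d(k, A) would
vanish for d ≥ 1, although it is a line. Having a generator is what gives the superpotential a
nonzero coefficient. -/
theorem IsASRegular.exists_generator {k : Type u} [Field k] {A : Type u} [Ring A]
    [Algebra k A] {𝒜 : ℕ → Submodule k A} {ε : A →ₐ[k] k} {d : ℕ} (h : IsASRegular 𝒜 ε d)
    (hd : d ≠ 0) {n : ℕ} (x : Fin n → A) (hx : Algebra.adjoin k (Set.range x) = ⊤) : n ≠ 0 := by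
  rintro rfl
  have hbot : (⊥ : Subalgebra k A) = ⊤ := by
    rw [← hx, Set.range_eq_empty, Algebra.adjoin_empty]
  have hinj : Function.Injective ε := by
    intro a a' haa'
    obtain ⟨s, rfl⟩ := Algebra.mem_bot.1 (show a ∈ (⊥ : Subalgebra k A) from hbot ▸ Algebra.mem_top)
    obtain ⟨s', rfl⟩ :=
      Algebra.mem_bot.1 (show a' ∈ (⊥ : Subalgebra k A) from hbot ▸ Algebra.mem_top)
    rw [AlgHom.commutes, AlgHom.commutes] at haa'
    exact congrArg (algebraMap k A) haa'
  let f : A →ₗ[A] trivialLeft ε :=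
    { toFun := fun a => ε a
      map_add' := fun x y => map_add ε x y
      map_smul' := fun a b => map_mul ε a b }
  have hf : Function.Bijective f :=
    ⟨hinj, fun s => ⟨algebraMap k A s, AlgHom.commutes ε s⟩⟩
  have hproj : Projective (trivialLeft ε) :=
    Projective.of_iso (LinearEquiv.ofBijective f hf).toModuleIso
      (ModuleCat.projective_of_categoryTheory_projective (ModuleCat.of A A))
  obtain ⟨E⟩ := h.ext_left
  have : Subsingleton (Abelian.Ext (trivialLeft ε) (ModuleCat.of A A) d) :=
    HasProjectiveDimensionLT.subsingleton (trivialLeft ε) 1 d (by omega) _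
  exact one_ne_zero (α := k) (E.symm.injective (Subsingleton.elim _ _))

variable {k : Type u} [Field k] {n : ℕ} {Z : Type v} [AddCommGroup Z] [Module k Z] {r : ℕ}
  {t : PreregularForm k Z r} {b : Module.Basis (Fin n) k Z} {N d : ℕ} {hN : 2 ≤ N}

theorem degree_ne_zero (hd : koszulDegree N d = r + 1) : d ≠ 0 := by
  rintro rfl
  rw [koszulDegree_zero] at hd
  omega

theorem coeff_ne_zero_of_isASRegular (hd : koszulDegree N d = r + 1)
    (hA : IsASRegular (degreePart (t.coeff b) N) (augmentation (t.coeff b) N hN) d) :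
    ∃ J, t.coeff b J ≠ 0 :=
  have : NeZero n := ⟨hA.exists_generator (degree_ne_zero hd) (x (t.coeff b) N) (adjoin_x _ _)⟩
  exists_coeff_ne_zero t b

/-- An algebra map `A → K ⊗ A` multiplies the superpotential by an element of `K`. -/
theorem exists_factor (hNm : N ≤ r + 1) (hd : koszulDegree N d = r + 1)
    (hA : IsASRegular (degreePart (t.coeff b) N) (augmentation (t.coeff b) N hN) d)
    (hK : IsNKoszul (degreePart (t.coeff b) N) (augmentation (t.coeff b) N hN) N)
    {K : Type w} [Ring K] [Algebra k K] {γ : Matrix (Fin n) (Fin n) K}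
    {δ : SuperpotentialAlgebra (t.coeff b) N →ₐ[k] K ⊗[k] SuperpotentialAlgebra (t.coeff b) N}
    (hδ : ∀ i, δ (x (t.coeff b) N i) = ∑ j, γ i j ⊗ₜ x (t.coeff b) N j) :
    ∃ g : K, ∀ J, ∑ I, t.coeff b I • prodPow γ I J = t.coeff b J • g := by
  obtain ⟨J₀, hJ₀⟩ := coeff_ne_zero_of_isASRegular hd hA
  -- For each form f on K the transformed superpotential is a potential of degree ν_N(d), hence a
  -- scalar multiple of the superpotential.
  refine exists_eq_smul_of_forall_linearForm _ _ hJ₀ fun f => ?_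
  obtain ⟨i, rfl⟩ := Nat.exists_eq_succ_of_ne_zero (degree_ne_zero hd)
  have hw := wordCoeff_mem_potentials t b hNm
  have hw' : wordCoeff (t.coeff b) ∈
      potentials k (x (t.coeff b) N) N (koszulDegree N (i + 1)) := by
    rw [hd]
    exact hw
  have hf : (fun J => f (sumWords (r + 1) fun I =>
      wordCoeff (t.coeff b) I • pairProd γ I J)) ∈
      potentials k (x (t.coeff b) N) N (koszulDegree N (i + 1)) := by
    rw [hd]
    exact transform_mem_potentials hδ hw f
  obtain ⟨a, ha⟩ := potential_eq_smul hA.connectedGraded (wordProd_mem_degreePart _ _)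
    (augmentation_x _ _ hN) hN hK (exists_dual_word hN) hA.hasProjectiveDimensionLT hA.ext_left
    hw' (l₀ := List.ofFn J₀) (by simp [hd]) (by rwa [wordCoeff_ofFn]) hf
  refine ⟨a, fun J => ?_⟩
  have := ha (List.ofFn J) (by simp [hd])
  rw [wordCoeff_ofFn] at this
  rw [sum_smul_prodPow, ← this]

/-- The top Tor space is a line spanned by the class of the superpotential. -/
theorem exists_top_cocycle (hNm : N ≤ r + 1) (hd : koszulDegree N d = r + 1)
    (hA : IsASRegular (degreePart (t.coeff b) N) (augmentation (t.coeff b) N hN) d)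
    (hK : IsNKoszul (degreePart (t.coeff b) N) (augmentation (t.coeff b) N hN) N) :
    ∃ φ : bar k (SuperpotentialAlgebra (t.coeff b) N) d →ₗ[k] k,
      (∀ z ∈ barBoundaries (augmentation (t.coeff b) N hN) d, φ z = 0) ∧
      cutTensor (x (t.coeff b) N) N d (wordCoeff (t.coeff b)) ∈
        barCycles (augmentation (t.coeff b) N hN) d ∧
      φ (cutTensor (x (t.coeff b) N) N d (wordCoeff (t.coeff b))) = 1 ∧
      ∀ y ∈ barCycles (augmentation (t.coeff b) N hN) d,
        y - φ y • cutTensor (x (t.coeff b) N) N d (wordCoeff (t.coeff b)) ∈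
          barBoundaries (augmentation (t.coeff b) N hN) d := by
  obtain ⟨J₀, hJ₀⟩ := coeff_ne_zero_of_isASRegular hd hA
  obtain ⟨i, rfl⟩ := Nat.exists_eq_succ_of_ne_zero (degree_ne_zero hd)
  have hw : wordCoeff (t.coeff b) ∈
      potentials k (x (t.coeff b) N) N (koszulDegree N (i + 1)) := by
    rw [hd]
    exact wordCoeff_mem_potentials t b hNm
  obtain ⟨φ, h1, h2, h3⟩ := exists_dual_cocycle hA.connectedGraded (wordProd_mem_degreePart _ _)
    (augmentation_x _ _ hN) hN hK (exists_dual_word hN) hA.hasProjectiveDimensionLT hA.ext_left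
    hw (l₀ := List.ofFn J₀) (by simp [hd]) (by rwa [wordCoeff_ofFn])
  exact ⟨φ, h1, cutTensor_mem_barCycles (augmentation_x _ _ hN) hN i hw, h2, h3⟩

/-- An algebra map `A → K ⊗ A` multiplies the top Tor space by the factor of the superpotential. -/
theorem coBar_top (hNm : N ≤ r + 1) (hd : koszulDegree N d = r + 1)
    (hA : IsASRegular (degreePart (t.coeff b) N) (augmentation (t.coeff b) N hN) d)
    (hK : IsNKoszul (degreePart (t.coeff b) N) (augmentation (t.coeff b) N hN) N)
    {K : Type w} [Ring K] [Algebra k K] {γ : Matrix (Fin n) (Fin n) K} {g : K}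
    {δ : SuperpotentialAlgebra (t.coeff b) N →ₐ[k] K ⊗[k] SuperpotentialAlgebra (t.coeff b) N}
    (hδ : ∀ i, δ (x (t.coeff b) N i) = ∑ j, γ i j ⊗ₜ x (t.coeff b) N j)
    (hg : ∀ J, ∑ I, t.coeff b I • prodPow γ I J = t.coeff b J • g)
    (φ : bar k (SuperpotentialAlgebra (t.coeff b) N) d →ₗ[k] k)
    (hφ : ∀ z ∈ barBoundaries (augmentation (t.coeff b) N hN) d, φ z = 0) :
    ∀ z ∈ barCycles (augmentation (t.coeff b) N hN) d,
      TensorProduct.rid k K (φ.lTensor K (coBar δ d z)) = φ z • g := by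
  intro z hz
  -- Write z as a boundary plus φ₀(z) times the superpotential cycle. Since `coBar` commutes with
  -- the differential and φ kills boundaries, only the second term counts, and `coBar` multiplies it
  -- by g.
  obtain ⟨φ₀, -, -, -, H⟩ := exists_top_cocycle hNm hd hA hK
  obtain ⟨y, hy⟩ := H z hz
  have hz' : z = barD (augmentation (t.coeff b) N hN) d y + φ₀ z •
      cutTensor (x (t.coeff b) N) N d (wordCoeff (t.coeff b)) := by
    rw [hy, sub_add_cancel]
  have h1 : coBar δ d (cutTensor (x (t.coeff b) N) N d (wordCoeff (t.coeff b))) =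
      g ⊗ₜ cutTensor (x (t.coeff b) N) N d (wordCoeff (t.coeff b)) := by
    refine coBar_cutTensor hδ hN d fun J hJ => ?_
    rw [hd] at hJ ⊢
    obtain ⟨J, rfl⟩ : ∃ J' : Fin (r + 1) → Fin n, J = List.ofFn J' := by
      refine ⟨fun s => J.get (s.cast hJ.symm), List.ext_getElem (by simp [hJ]) fun s h1 h2 => ?_⟩
      rw [List.getElem_ofFn]
      rfl
    rw [← sum_smul_prodPow, hg, wordCoeff_ofFn]
  have hδε := coaction_augmentation (augmentation_x _ _ hN) (adjoin_x _ _) hδ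
  have h2 : φ ∘ₗ barD (augmentation (t.coeff b) N hN) d = 0 :=
    LinearMap.ext fun y => hφ _ ⟨y, rfl⟩
  rw [hz', map_add, map_smul, coBar_barD hδε, h1]
  have h4 : ∀ y', φ.lTensor K ((barD (augmentation (t.coeff b) N hN) d).lTensor K y') = 0 := by
    intro y'
    rw [← LinearMap.comp_apply, ← LinearMap.lTensor_comp, h2, LinearMap.lTensor_zero,
      LinearMap.zero_apply]
  have h3 := LinearMap.congr_fun h2 y
  simp only [LinearMap.comp_apply, LinearMap.zero_apply] at h3
  simp [h3, h4, mul_smul]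

end RegularConsequences

/-! ### Coactions given by matrices -/

section MatrixCoactions

open SuperpotentialAlgebra

/-- The matrix `α` spans a quotient of the comatrix coalgebra. -/
structure IsComatrix (k : Type u) [Field k] {n : ℕ} {K : Type w} [Ring K] [HopfAlgebra k K]
    (α : Matrix (Fin n) (Fin n) K) : Prop where
  comul : ∀ i j, Coalgebra.comul (R := k) (α i j) = ∑ l, α i l ⊗ₜ[k] α l j
  counit : ∀ i j, Coalgebra.counit (R := k) (α i j) = if i = j then 1 else 0

variable {k : Type u} [Field k] {m n : ℕ} {c : (Fin m → Fin n) → k} {N : ℕ}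

theorem SuperpotentialAlgebra.algHom_ext {B : Type*} [Semiring B] [Algebra k B]
    {f g : SuperpotentialAlgebra c N →ₐ[k] B} (h : ∀ i, f (x c N i) = g (x c N i)) : f = g :=
  AlgHom.ext_of_adjoin_eq_top (adjoin_x c N) (by rintro _ ⟨i, rfl⟩; exact h i)

theorem SuperpotentialAlgebra.x_mem_degreePart (i : Fin n) : x c N i ∈ degreePart c N 1 := by
  simpa using wordProd_mem_degreePart c N [i]

theorem SuperpotentialAlgebra.exists_eq_sum_smul_x {y : SuperpotentialAlgebra c N}
    (hy : y ∈ degreePart c N 1) : ∃ s : Fin n → k, y = ∑ j, s j • x c N j := by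
  have h : degreePart c N 1 ≤ Submodule.span k (Set.range (x c N)) := by
    refine Submodule.span_le.2 ?_
    rintro _ ⟨J, rfl⟩
    exact Submodule.subset_span ⟨J 0, by simp [List.ofFn_succ]⟩
  obtain ⟨s, hs⟩ := (Submodule.mem_span_range_iff_exists_fun k).1 (h hy)
  exact ⟨s, hs.symm⟩

variable {K : Type w} [Ring K] [HopfAlgebra k K]

theorem SuperpotentialAlgebra.map_degreePart {γ : Matrix (Fin n) (Fin n) K}
    {δ : SuperpotentialAlgebra c N →ₐ[k] K ⊗[k] SuperpotentialAlgebra c N}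
    (hδ : ∀ i, δ (x c N i) = ∑ j, γ i j ⊗ₜ x c N j) (j : ℕ) (a : SuperpotentialAlgebra c N)
    (ha : a ∈ degreePart c N j) :
    δ a ∈ LinearMap.range ((degreePart c N j).subtype.lTensor K) := by
  induction ha using Submodule.span_induction with
  | zero => simp
  | add a a' _ _ h h' => rw [map_add]; exact add_mem h h'
  | smul s a _ h => rw [map_smul]; exact Submodule.smul_mem _ _ h
  | mem a ha =>
    obtain ⟨J, rfl⟩ := ha
    simp only
    rw [prod_ofFn_eq_wordProd, coaction_wordProd hδ (m := j) _ (by simp), sumWords]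
    refine Submodule.sum_mem _ fun L _ => ?_
    exact ⟨_ ⊗ₜ ⟨wordProd (x c N) (List.ofFn L), by
      simpa using wordProd_mem_degreePart c N (List.ofFn L)⟩, rfl⟩

theorem IsComatrix.exists_leftCoaction {α : Matrix (Fin n) (Fin n) K} (hα : IsComatrix k α)
    {δ : SuperpotentialAlgebra c N →ₐ[k] K ⊗[k] SuperpotentialAlgebra c N}
    (hδ : ∀ i, δ (x c N i) = ∑ j, α i j ⊗ₜ x c N j) :
    ∃ ρ : LeftCoaction k K (degreePart c N), ρ.toAlgHom = δ := by
  have h1 : (Algebra.TensorProduct.assoc k k k K K (SuperpotentialAlgebra c N)).toAlgHom.comp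
      ((Algebra.TensorProduct.map (Bialgebra.comulAlgHom k K)
        (AlgHom.id k (SuperpotentialAlgebra c N))).comp δ) =
      (Algebra.TensorProduct.map (AlgHom.id k K) δ).comp δ := by
    refine SuperpotentialAlgebra.algHom_ext fun i => ?_
    simp only [AlgHom.comp_apply, hδ, map_sum, Algebra.TensorProduct.map_tmul, AlgHom.id_apply,
      Bialgebra.comulAlgHom_apply, hα.comul, TensorProduct.sum_tmul, TensorProduct.tmul_sum]
    rw [Finset.sum_comm]
    rfl
  have h2 : (Algebra.TensorProduct.lid k (SuperpotentialAlgebra c N)).toAlgHom.comp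
      ((Algebra.TensorProduct.map (Bialgebra.counitAlgHom k K)
        (AlgHom.id k (SuperpotentialAlgebra c N))).comp δ) = AlgHom.id k _ := by
    refine SuperpotentialAlgebra.algHom_ext fun i => ?_
    simp [hδ, hα.counit]
  exact ⟨⟨δ, fun a => DFunLike.congr_fun h1 a, fun a => DFunLike.congr_fun h2 a,
    map_degreePart hδ⟩, rfl⟩

theorem IsComatrix.exists_rightCoaction {α : Matrix (Fin n) (Fin n) K} (hα : IsComatrix k α)
    {δ : SuperpotentialAlgebra c N →ₐ[k] SuperpotentialAlgebra c N ⊗[k] K}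
    (hδ : ∀ j, δ (x c N j) = ∑ i, x c N i ⊗ₜ α i j) :
    ∃ ρ : RightCoaction k K (degreePart c N), ρ.toAlgHom = δ := by
  have h1 : (Algebra.TensorProduct.assoc k k k (SuperpotentialAlgebra c N) K K).toAlgHom.comp
      ((Algebra.TensorProduct.map δ (AlgHom.id k K)).comp δ) =
      (Algebra.TensorProduct.map (AlgHom.id k (SuperpotentialAlgebra c N))
        (Bialgebra.comulAlgHom k K)).comp δ := by
    refine SuperpotentialAlgebra.algHom_ext fun i => ?_
    simp only [AlgHom.comp_apply, hδ, map_sum, Algebra.TensorProduct.map_tmul, AlgHom.id_apply,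
      Bialgebra.comulAlgHom_apply, hα.comul, TensorProduct.sum_tmul, TensorProduct.tmul_sum]
    rw [Finset.sum_comm]
    rfl
  have h2 : (Algebra.TensorProduct.rid k k (SuperpotentialAlgebra c N)).toAlgHom.comp
      ((Algebra.TensorProduct.map (AlgHom.id k (SuperpotentialAlgebra c N))
        (Bialgebra.counitAlgHom k K)).comp δ) = AlgHom.id k _ := by
    refine SuperpotentialAlgebra.algHom_ext fun i => ?_
    simp [hδ, hα.counit]
  have h3 : ∀ i, ((Algebra.TensorProduct.comm k (SuperpotentialAlgebra c N) K).toAlgHom.comp δ)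
      (x c N i) = ∑ j, α.transpose i j ⊗ₜ x c N j := by
    intro i
    simp [hδ]
  refine ⟨⟨δ, fun a => DFunLike.congr_fun h1 a, fun a => DFunLike.congr_fun h2 a,
    fun j a ha => ?_⟩, rfl⟩
  -- Preservation of the grading is transported from the left-handed version by exchanging the
  -- tensor factors.
  obtain ⟨z, hz⟩ := map_degreePart h3 j a ha
  refine ⟨TensorProduct.comm k K _ z, ?_⟩
  apply (TensorProduct.comm k (SuperpotentialAlgebra c N) K).injective
  refine Eq.trans ?_ hz
  rw [← LinearMap.comm_comp_rTensor_comp_comm_eq]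
  simp

/-- Preservation of degree 1 gives the entries. Since N ≥ 2 the generators are independent over any
coefficient space, so coassociativity and counit can be compared entry by entry. -/
theorem LeftCoaction.exists_matrix (hN : 2 ≤ N) (ρ : LeftCoaction k K (degreePart c N)) :
    ∃ α : Matrix (Fin n) (Fin n) K, IsComatrix k α ∧
      ∀ i, ρ.toAlgHom (x c N i) = ∑ j, α i j ⊗ₜ x c N j := by
  have h : ∀ i, ∃ a : Fin n → K, ρ.toAlgHom (x c N i) = ∑ j, a j ⊗ₜ x c N j := by
    intro i
    obtain ⟨z, hz⟩ := ρ.graded 1 _ (x_mem_degreePart i)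
    rw [← hz]
    clear hz
    induction z with
    | zero => exact ⟨0, by simp⟩
    | add z z' hz hz' =>
      obtain ⟨a, ha⟩ := hz
      obtain ⟨a', ha'⟩ := hz'
      exact ⟨a + a', by simp [ha, ha', TensorProduct.add_tmul, Finset.sum_add_distrib]⟩
    | tmul κ y =>
      obtain ⟨s, hs⟩ := exists_eq_sum_smul_x y.2
      exact ⟨fun j => s j • κ, by simp [hs, TensorProduct.tmul_sum, TensorProduct.smul_tmul]⟩
  choose α hα using h
  refine ⟨α, ⟨fun i => ?_, fun i => ?_⟩, hα⟩
  · refine congrFun (tmul_x_injective (c := c) hN ?_)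
    have := ρ.coassoc (x c N i)
    simp only [hα, map_sum, LinearMap.rTensor_tmul, LinearMap.lTensor_tmul,
      AlgHom.toLinearMap_apply, TensorProduct.tmul_sum] at this
    apply (TensorProduct.assoc k K K (SuperpotentialAlgebra c N)).injective
    simp only [map_sum, this, TensorProduct.sum_tmul, TensorProduct.assoc_tmul]
    rw [Finset.sum_comm]
  · refine congrFun (tmul_x_injective (c := c) hN ?_)
    have := ρ.counit (x c N i)
    simp only [hα, map_sum, LinearMap.rTensor_tmul] at this
    apply (TensorProduct.lid k (SuperpotentialAlgebra c N)).injective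
    simp only [map_sum, this]
    simp

theorem RightCoaction.exists_matrix (hN : 2 ≤ N) (ρ : RightCoaction k K (degreePart c N)) :
    ∃ α : Matrix (Fin n) (Fin n) K, IsComatrix k α ∧
      ∀ j, ρ.toAlgHom (x c N j) = ∑ i, x c N i ⊗ₜ α i j := by
  have h : ∀ i, ∃ a : Fin n → K, ρ.toAlgHom (x c N i) = ∑ j, x c N j ⊗ₜ a j := by
    intro i
    obtain ⟨z, hz⟩ := ρ.graded 1 _ (x_mem_degreePart i)
    rw [← hz]
    clear hz
    induction z with
    | zero => exact ⟨0, by simp⟩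
    | add z z' hz hz' =>
      obtain ⟨a, ha⟩ := hz
      obtain ⟨a', ha'⟩ := hz'
      exact ⟨a + a', by simp [ha, ha', TensorProduct.tmul_add, Finset.sum_add_distrib]⟩
    | tmul y κ =>
      obtain ⟨s, hs⟩ := exists_eq_sum_smul_x y.2
      exact ⟨fun j => s j • κ, by simp [hs, TensorProduct.sum_tmul, TensorProduct.smul_tmul]⟩
  choose α hα using h
  -- The chosen family is indexed by the generator first, so it is transposed to match the
  -- convention for right coactions.
  refine ⟨fun i j => α j i, ⟨fun i j => ?_, fun i j => ?_⟩, hα⟩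
  · refine congrFun (tmul_x_injective (c := c) hN
      (a := fun i => Coalgebra.comul (α j i)) (a' := fun i => ∑ l, α l i ⊗ₜ α j l) ?_) i
    have := ρ.coassoc (x c N j)
    simp only [hα, map_sum, LinearMap.rTensor_tmul, LinearMap.lTensor_tmul,
      AlgHom.toLinearMap_apply, TensorProduct.sum_tmul, TensorProduct.assoc_tmul] at this
    apply (TensorProduct.comm k (K ⊗[k] K) (SuperpotentialAlgebra c N)).injective
    simp only [map_sum, TensorProduct.comm_tmul, ← this, TensorProduct.tmul_sum]
    rw [Finset.sum_comm]
  · refine congrFun (tmul_x_injective (c := c) hN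
      (a := fun i => Coalgebra.counit (α j i)) (a' := fun i => if i = j then (1 : k) else 0) ?_) i
    have := ρ.counit (x c N j)
    simp only [hα, map_sum, LinearMap.lTensor_tmul, TensorProduct.rid_tmul] at this
    apply (TensorProduct.lid k (SuperpotentialAlgebra c N)).injective
    simp only [map_sum, TensorProduct.lid_tmul, this]
    simp

theorem LeftCoaction.bar_eq_coBar {A : Type u} [Ring A] [Algebra k A] {𝒜 : ℕ → Submodule k A}
    (ρ : LeftCoaction k K 𝒜) (i : ℕ) : ρ.bar i = coBar ρ.toAlgHom i := by
  induction i with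
  | zero => rfl
  | succ i ih =>
    rw [coBar, ← ih]
    rfl

/-- Exchanging tensor factors leaves the order of products in K unchanged, and `coBar` uses only the
algebra structure of K; so the results on `coBar` serve right coactions without passing to an
opposite algebra. -/
theorem RightCoaction.comm_bar {A : Type u} [Ring A] [Algebra k A] {𝒜 : ℕ → Submodule k A}
    (ρ : RightCoaction k K 𝒜) (i : ℕ) (z : PreregularQuantumGroup.bar k A i) :
    TensorProduct.comm k (PreregularQuantumGroup.bar k A i) K (ρ.bar i z) =
      coBar ((Algebra.TensorProduct.comm k A K).toAlgHom.comp ρ.toAlgHom) i z := by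
  induction i with
  | zero => rfl
  | succ i ih =>
    change TensorProduct.comm k (A ⊗[k] PreregularQuantumGroup.bar k A i) K
      ((LinearMap.mul' k K).lTensor (A ⊗[k] PreregularQuantumGroup.bar k A i)
        (TensorProduct.tensorTensorTensorComm k A K (PreregularQuantumGroup.bar k A i) K
          (TensorProduct.map ρ.toAlgHom.toLinearMap (ρ.bar i) z))) =
      coStep ((Algebra.TensorProduct.comm k A K).toAlgHom.comp ρ.toAlgHom)
        (coBar ((Algebra.TensorProduct.comm k A K).toAlgHom.comp ρ.toAlgHom) i) z
    have key : ∀ (p : A ⊗[k] K) (q : PreregularQuantumGroup.bar k A i ⊗[k] K),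
        TensorProduct.comm k (A ⊗[k] PreregularQuantumGroup.bar k A i) K
          ((LinearMap.mul' k K).lTensor (A ⊗[k] PreregularQuantumGroup.bar k A i)
            (TensorProduct.tensorTensorTensorComm k A K (PreregularQuantumGroup.bar k A i) K (p ⊗ₜ q))) =
        mulPair k A K (PreregularQuantumGroup.bar k A i)
          (TensorProduct.comm k A K p ⊗ₜ TensorProduct.comm k (PreregularQuantumGroup.bar k A i) K q) := by
      intro p q
      induction p with
      | zero => simp
      | add p p' hp hp' => simp only [TensorProduct.add_tmul, map_add, hp, hp']
      | tmul a κ =>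
        induction q with
        | zero => simp
        | add q q' hq hq' => simp only [TensorProduct.tmul_add, map_add, hq, hq']
        | tmul y κ' => rfl
    induction z using TensorProduct.induction_on with
    | zero => simp only [map_zero]
    | add s s' hs hs' => simp only [map_add, hs, hs']
    | tmul a y =>
      rw [TensorProduct.map_tmul, key, coStep_tmul, ih]
      rfl

/-! ### Relations from comatrices -/

theorem antipode_prodPow (α : Matrix (Fin n) (Fin n) K) (I J : Fin m → Fin n) :
    HopfAlgebra.antipode k (prodPow α I J) = revPow (α.map (HopfAlgebra.antipode k)) I J := by
  have h := map_prodPow α (HopfAlgebra.antipodeAlgHomOp k K) I J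
  have h1 : α.map (HopfAlgebra.antipodeAlgHomOp k K) =
      (α.map (HopfAlgebra.antipode k)).map MulOpposite.op := rfl
  rw [h1, prodPow_op] at h
  exact MulOpposite.op_injective h

variable {α : Matrix (Fin n) (Fin n) K} {g : K}

theorem IsComatrix.map_counit (hα : IsComatrix k α) :
    α.map (Bialgebra.counitAlgHom k K) = 1 := by
  ext i j
  simpa [Matrix.one_apply] using hα.counit i j

theorem IsComatrix.map_comul (hα : IsComatrix k α) : α.map (Bialgebra.comulAlgHom k K) =
    Matrix.of fun i j => ∑ l, α i l ⊗ₜ[k] α l j := by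
  ext i j
  simpa using hα.comul i j

/-- Counit and comultiplication are applied to `hg` at an index with c J ≠ 0. Under Δ the matrix
power splits over an intermediate index, and `hg` used twice turns the sum into c J times g ⊗ g. -/
theorem IsComatrix.isGroupLikeElem (hα : IsComatrix k α) (hc : ∃ J, c J ≠ 0)
    (hg : ∀ J, ∑ I, c I • prodPow α I J = c J • g) : IsGroupLikeElem k g := by
  obtain ⟨J, hJ⟩ := hc
  constructor
  · have h := congrArg (Bialgebra.counitAlgHom k K) (hg J)
    simp only [map_sum, map_smul, map_prodPow, hα.map_counit, prodPow_one] at h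
    simpa [hJ] using h
  · have h := congrArg (Bialgebra.comulAlgHom k K) (hg J)
    simp only [map_sum, map_smul, map_prodPow, hα.map_comul, prodPow_tensor, Finset.smul_sum] at h
    rw [Finset.sum_comm] at h
    simp only [TensorProduct.smul_tmul', ← TensorProduct.sum_tmul, hg] at h
    simp only [TensorProduct.smul_tmul, ← TensorProduct.tmul_sum, hg] at h
    rw [TensorProduct.tmul_smul] at h
    exact (smul_right_injective _ hJ h).symm

theorem IsComatrix.mul_antipode (hα : IsComatrix k α) :
    α * α.map (HopfAlgebra.antipode k) = 1 := by
  ext i j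
  have := HopfAlgebra.mul_antipode_lTensor_comul_apply (R := k) (α i j)
  rw [hα.comul, hα.counit] at this
  simpa [Matrix.mul_apply, Matrix.one_apply, apply_ite] using this

theorem IsComatrix.antipode_mul (hα : IsComatrix k α) :
    α.map (HopfAlgebra.antipode k) * α = 1 := by
  ext i j
  have := HopfAlgebra.mul_antipode_rTensor_comul_apply (R := k) (α i j)
  rw [hα.comul, hα.counit] at this
  simpa [Matrix.mul_apply, Matrix.one_apply, apply_ite] using this

theorem IsComatrix.leftRelations (hα : IsComatrix k α) (hc : ∃ J, c J ≠ 0)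
    (hg : ∀ J, ∑ I, c I • prodPow α I J = c J • g) :
    LeftRelations c α (α.map (HopfAlgebra.antipode k)) g (HopfAlgebra.antipode k g) where
  rel := hg
  rel' J := by simp only [← antipode_prodPow, ← map_smul, ← map_sum, hg]
  mul_inv := (hα.isGroupLikeElem hc hg).mul_antipode_cancel
  inv_mul := (hα.isGroupLikeElem hc hg).antipode_mul_cancel
  mul_eq_one := hα.mul_antipode

theorem IsComatrix.isGroupLikeElem_of_right (hα : IsComatrix k α) (hc : ∃ J, c J ≠ 0)
    (hg : ∀ J, ∑ I, c I • prodPow α J I = c J • g) : IsGroupLikeElem k g := by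
  obtain ⟨J, hJ⟩ := hc
  constructor
  · have h := congrArg (Bialgebra.counitAlgHom k K) (hg J)
    simp only [map_sum, map_smul, map_prodPow, hα.map_counit, prodPow_one] at h
    simpa [hJ] using h
  · have h := congrArg (Bialgebra.comulAlgHom k K) (hg J)
    simp only [map_sum, map_smul, map_prodPow, hα.map_comul, prodPow_tensor, Finset.smul_sum] at h
    rw [Finset.sum_comm] at h
    simp only [← TensorProduct.tmul_smul, ← TensorProduct.tmul_sum, hg] at h
    simp only [← TensorProduct.smul_tmul, ← TensorProduct.sum_tmul, hg] at h
    rw [← TensorProduct.smul_tmul'] at h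
    exact (smul_right_injective _ hJ h).symm

/-- The relations of H(f) carry D⁻¹ on the 𝔸 side, so the factor g takes the place of D⁻¹ and S(g)
that of D. -/
theorem IsComatrix.rightRelations (hα : IsComatrix k α) (hc : ∃ J, c J ≠ 0)
    (hg : ∀ J, ∑ I, c I • prodPow α J I = c J • g) :
    RightRelations c α (α.map (HopfAlgebra.antipode k)) (HopfAlgebra.antipode k g) g where
  rel := hg
  rel' J := by simp only [← antipode_prodPow, ← map_smul, ← map_sum, hg]
  mul_inv := (hα.isGroupLikeElem_of_right hc hg).antipode_mul_cancel
  inv_mul := (hα.isGroupLikeElem_of_right hc hg).mul_antipode_cancel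
  mul_eq_one := hα.antipode_mul

/-- Algebra maps respecting the entries of a generating comatrix are bialgebra maps. -/
theorem IsComatrix.existsUnique_bialgHom {H : Type w'} [Ring H] [HopfAlgebra k H]
    {γ : Matrix (Fin n) (Fin n) H} (hγ : IsComatrix k γ) (hα : IsComatrix k α)
    (φ₀ : H →ₐ[k] K) (hφ₀ : ∀ i j, φ₀ (γ i j) = α i j)
    (h1 : ∀ φ ψ : H →ₐ[k] K, (∀ i j, φ (γ i j) = ψ (γ i j)) → φ = ψ)
    (h2 : ∀ φ ψ : H →ₐ[k] K ⊗[k] K, (∀ i j, φ (γ i j) = ψ (γ i j)) → φ = ψ)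
    (h3 : ∀ φ ψ : H →ₐ[k] k, (∀ i j, φ (γ i j) = ψ (γ i j)) → φ = ψ) :
    ∃! φ : H →ₐc[k] K, ∀ i j, φ (γ i j) = α i j := by
  refine ⟨BialgHom.ofAlgHom φ₀ (h3 _ _ fun i j => ?_) (h2 _ _ fun i j => ?_), hφ₀,
    fun ψ hψ => ?_⟩
  · simp [hφ₀, hα.counit, hγ.counit]
  · simp [hφ₀, hα.comul, hγ.comul]
  · have := h1 (ψ : H →ₐ[k] K) φ₀ fun i j => (hψ i j).trans (hφ₀ i j).symm
    exact BialgHom.ext fun y => DFunLike.congr_fun this y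

theorem LeftCoaction.map_eq_iff (hN : 2 ≤ N) {H : Type w'} [Ring H] [HopfAlgebra k H]
    {γ : Matrix (Fin n) (Fin n) H} {ρ : LeftCoaction k H (degreePart c N)}
    (hρ : ∀ i, ρ.toAlgHom (x c N i) = ∑ j, γ i j ⊗ₜ x c N j)
    {ρK : LeftCoaction k K (degreePart c N)}
    (hρK : ∀ i, ρK.toAlgHom (x c N i) = ∑ j, α i j ⊗ₜ x c N j) (φ : H →ₐc[k] K) :
    (∀ a, (φ : H →ₗ[k] K).rTensor (SuperpotentialAlgebra c N) (ρ.toAlgHom a) = ρK.toAlgHom a) ↔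
      ∀ i j, φ (γ i j) = α i j := by
  constructor
  · intro h i
    refine congrFun (tmul_x_injective (c := c) hN ?_)
    have := h (x c N i)
    simpa [hρ, hρK] using this
  · intro h a
    have : (Algebra.TensorProduct.map (φ : H →ₐ[k] K)
        (AlgHom.id k (SuperpotentialAlgebra c N))).comp ρ.toAlgHom = ρK.toAlgHom :=
      SuperpotentialAlgebra.algHom_ext fun i => by simp [hρ, hρK, h]
    exact DFunLike.congr_fun this a

theorem RightCoaction.map_eq_iff (hN : 2 ≤ N) {H : Type w'} [Ring H] [HopfAlgebra k H]
    {γ : Matrix (Fin n) (Fin n) H} {ρ : RightCoaction k H (degreePart c N)}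
    (hρ : ∀ j, ρ.toAlgHom (x c N j) = ∑ i, x c N i ⊗ₜ γ i j)
    {ρK : RightCoaction k K (degreePart c N)}
    (hρK : ∀ j, ρK.toAlgHom (x c N j) = ∑ i, x c N i ⊗ₜ α i j) (φ : H →ₐc[k] K) :
    (∀ a, (φ : H →ₗ[k] K).lTensor (SuperpotentialAlgebra c N) (ρ.toAlgHom a) = ρK.toAlgHom a) ↔
      ∀ i j, φ (γ i j) = α i j := by
  constructor
  · intro h i j
    refine congrFun (tmul_x_injective (c := c) hN (a := fun i => φ (γ i j))
      (a' := fun i => α i j) ?_) i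
    have := congrArg (TensorProduct.comm k _ _) (h (x c N j))
    simpa [hρ, hρK] using this
  · intro h a
    have : (Algebra.TensorProduct.map (AlgHom.id k (SuperpotentialAlgebra c N))
        (φ : H →ₐ[k] K)).comp ρ.toAlgHom = ρK.toAlgHom :=
      SuperpotentialAlgebra.algHom_ext fun i => by simp [hρ, hρK, h]
    exact DFunLike.congr_fun this a

end MatrixCoactions

/-! ### Universality of `H(e)` and `H(f)` and of their quotients -/

section Inverse

variable {k : Type u} [Field k] {Z : Type v} [AddCommGroup Z] [Module k Z] {r n : ℕ}
  {t : PreregularForm k Z r} {b : Module.Basis (Fin n) k Z} {K : Type w} [Ring K] [Algebra k K]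
  {α β : Matrix (Fin n) (Fin n) K} {g g' : K}

/-- Over a noncommutative ring an inverse of α does not invert its transpose. Here βᵀ and the
transpose of g' P⁻¹ α P g are inverse to each other, P being the twist matrix; moving P and g to the
other side gives W as the transpose of P (g β g') P⁻¹. -/
theorem LeftRelations.exists_transpose_inverse (h : LeftRelations (t.coeff b) α β g g') :
    ∃ W : Matrix (Fin n) (Fin n) K, W * α.transpose = 1 := by
  let T : Fin n → Fin n → K := fun a s =>
    ∑ q, ∑ j, t.twistMatrix b q j • (g * β j a * g' * α s q)
  -- This is `mul_twist` conjugated by g. It says that P⁻¹ applied to `T a` is a standard basis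
  -- vector, so `T a` is a column of P.
  have h1 : ∀ a c, ∑ s, t.twistMatrixInv b c s • T a s = if a = c then 1 else 0 := by
    intro a c
    have := congrFun (congrFun h.mul_twist a) c
    rw [Matrix.mul_apply, Matrix.one_apply] at this
    calc _ = g * (∑ j, β.transpose a j * (leftTwist t b α g g').transpose j c) * g' := by
          simp only [T, leftTwist, Matrix.transpose_apply, Matrix.of_apply, Finset.mul_sum,
            Finset.sum_mul, Finset.smul_sum, smul_mul_assoc, mul_smul_comm, smul_smul, mul_assoc,
            h.mul_inv, mul_one]
          exact Finset.sum_comm.trans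
            ((Finset.sum_congr rfl fun q _ => Finset.sum_comm).trans Finset.sum_comm)
      _ = _ := by
          rw [this]
          split_ifs <;> simp [h.mul_inv]
  have h2 : ∀ a s, T a s = t.twistMatrix b s a • (1 : K) := by
    intro a s
    calc T a s = ∑ s', (t.twistMatrix b * t.twistMatrixInv b) s s' • T a s' := by
          simp [t.twistMatrix_mul_inv, Matrix.one_apply]
      _ = ∑ c, t.twistMatrix b s c • ∑ s', t.twistMatrixInv b c s' • T a s' := by
          simp only [Matrix.mul_apply, Finset.sum_smul, Finset.smul_sum, smul_smul]
          exact Finset.sum_comm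
      _ = _ := by simp [h1]
  refine ⟨Matrix.of fun p q => ∑ a, ∑ j,
    (t.twistMatrixInv b a p * t.twistMatrix b q j) • (g * β j a * g'), ?_⟩
  ext p s
  rw [Matrix.mul_apply]
  calc _ = ∑ a, t.twistMatrixInv b a p • T a s := by
        simp only [T, Matrix.transpose_apply, Matrix.of_apply, Finset.sum_mul, Finset.smul_sum,
          smul_smul, smul_mul_assoc]
        exact Finset.sum_comm
    _ = (t.twistMatrix b * t.twistMatrixInv b) s p • (1 : K) := by
        simp only [h2, smul_smul, Matrix.mul_apply, Finset.sum_smul]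
        exact Finset.sum_congr rfl fun a _ => by rw [mul_comm]
    _ = _ := by
        rw [t.twistMatrix_mul_inv, Matrix.one_apply, Matrix.one_apply]
        rcases eq_or_ne p s with rfl | hps
        · simp
        · simp [hps, hps.symm]

/-- A relation with nonzero coefficient expresses D through the a_{ij}; 𝔹 and D⁻¹ are two-sided
inverses, hence unique. The a_{ij} need not generate H(e), yet algebra maps are determined by them.
-/
theorem HLeft.algHom_ext_A (hc : ∃ J, t.coeff b J ≠ 0) (φ ψ : HLeft t b →ₐ[k] K)
    (hA : ∀ i j, φ (HLeft.A t b i j) = ψ (HLeft.A t b i j)) : φ = ψ := by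
  obtain ⟨J, hJ⟩ := hc
  have hA' : (HLeft.A t b).map φ = (HLeft.A t b).map ψ := by ext i j; exact hA i j
  have hD : φ (HLeft.D t b) = ψ (HLeft.D t b) := by
    refine smul_right_injective _ hJ ?_
    simp only [← map_smul, ← (HLeft.relations t b).rel, map_sum]
    simp only [map_smul, map_prodPow, hA']
  refine HLeft.algHom_ext hA (fun i j => ?_) hD (left_inv_eq_right_inv (a := φ (HLeft.D t b)) ?_ ?_)
  · refine congrFun (congrFun (left_inv_eq_right_inv (a := (HLeft.A t b).map φ)
      (b := (HLeft.B t b).map φ) (c := (HLeft.B t b).map ψ) ?_ ?_) i) j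
    · rw [← Matrix.map_mul, (HLeft.relations t b).inv_mul_eq_one,
        Matrix.map_one _ (map_zero _) (map_one _)]
    · rw [hA', ← Matrix.map_mul, (HLeft.relations t b).mul_eq_one,
        Matrix.map_one _ (map_zero _) (map_one _)]
  · rw [← map_mul, (HLeft.relations t b).inv_mul, map_one]
  · rw [hD, ← map_mul, (HLeft.relations t b).mul_inv, map_one]

theorem HRight.algHom_ext_A (hc : ∃ J, t.coeff b J ≠ 0) (φ ψ : HRight t b →ₐ[k] K)
    (hA : ∀ i j, φ (HRight.A t b i j) = ψ (HRight.A t b i j)) : φ = ψ := by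
  obtain ⟨J, hJ⟩ := hc
  have hA' : (HRight.A t b).map φ = (HRight.A t b).map ψ := by ext i j; exact hA i j
  have hD : φ (HRight.Dinv t b) = ψ (HRight.Dinv t b) := by
    refine smul_right_injective _ hJ ?_
    simp only [← map_smul, ← (HRight.relations t b).rel, map_sum]
    simp only [map_smul, map_prodPow, hA']
  refine HRight.algHom_ext hA (fun i j => ?_)
    (left_inv_eq_right_inv (a := φ (HRight.Dinv t b)) ?_ ?_) hD
  · refine congrFun (congrFun (left_inv_eq_right_inv (a := (HRight.A t b).map φ)
      (b := (HRight.B t b).map φ) (c := (HRight.B t b).map ψ) ?_ ?_) i) j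
    · rw [← Matrix.map_mul, (HRight.relations t b).mul_eq_one,
        Matrix.map_one _ (map_zero _) (map_one _)]
    · rw [hA', ← Matrix.map_mul, (HRight.relations t b).mul_inv_eq_one,
        Matrix.map_one _ (map_zero _) (map_one _)]
  · rw [← map_mul, (HRight.relations t b).mul_inv, map_one]
  · rw [hD, ← map_mul, (HRight.relations t b).inv_mul, map_one]

variable (t b)

theorem HLeft.isComatrix_A : IsComatrix k (HLeft.A t b) := ⟨HLeft.comul_A t b, HLeft.counit_A t b⟩

theorem HRight.isComatrix_A : IsComatrix k (HRight.A t b) :=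
  ⟨HRight.comul_A t b, HRight.counit_A t b⟩

theorem IsComatrix.map {H : Type w} [Ring H] [HopfAlgebra k H] {L : Type w'} [Ring L]
    [HopfAlgebra k L] {γ : Matrix (Fin n) (Fin n) H} (hγ : IsComatrix k γ) (φ : H →ₐc[k] L) :
    IsComatrix k (γ.map φ) where
  comul i j := by
    rw [Matrix.map_apply, ← CoalgHomClass.map_comp_comul_apply, hγ.comul]
    simp
  counit i j := by
    rw [Matrix.map_apply, CoalgHomClass.counit_comp_apply, hγ.counit]

theorem exists_algHom_of_subOneIdeal {H : Type w} {L : Type w'} [Ring H] [Algebra k H] [Ring L]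
    [Algebra k L] {g : H} (φ : H →ₐ[k] L) (hφ : φ g = 1) :
    ∃ ψ : (H ⧸ subOneIdeal g) →ₐ[k] L, ∀ y, ψ (Ideal.Quotient.mk _ y) = φ y := by
  have h : TwoSidedIdeal.span {g - 1} ≤ TwoSidedIdeal.ker φ := by
    rw [TwoSidedIdeal.span_le]
    rintro _ rfl
    simp [TwoSidedIdeal.mem_ker, hφ]
  exact ⟨Ideal.Quotient.liftₐ _ φ fun y hy =>
    (TwoSidedIdeal.mem_ker φ).1 (h (TwoSidedIdeal.mem_asIdeal.1 hy)), fun y => rfl⟩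

/-- The quotient map `H(e) → S(e)`. -/
noncomputable def SLeft.mk : HLeft t b →ₐc[k] SLeft t b :=
  haveI := subOneIdeal_isHopfIdeal (HLeft.isGroupLikeElem_D t b)
  Bialgebra.Quotient.mkBialgHom (subOneIdeal (HLeft.D t b))

theorem SLeft.mk_surjective : Function.Surjective (SLeft.mk t b) := Ideal.Quotient.mk_surjective

theorem SLeft.mk_D : SLeft.mk t b (HLeft.D t b) = 1 := mk_subOneIdeal _

theorem SLeft.isComatrix_A : IsComatrix k (SLeft.A t b) :=
  (HLeft.isComatrix_A t b).map (SLeft.mk t b)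

theorem SLeft.rel (J : Fin (r + 1) → Fin n) :
    ∑ I, t.coeff b I • prodPow (SLeft.A t b) I J = t.coeff b J • 1 := by
  have := congrArg (SLeft.mk t b) ((HLeft.relations t b).rel J)
  simp only [map_sum, map_smul, map_prodPow, SLeft.mk_D] at this
  exact this

theorem SLeft.exists_algHom {L : Type w'} [Ring L] [Algebra k L] (φ : HLeft t b →ₐ[k] L)
    (hφ : φ (HLeft.D t b) = 1) : ∃ ψ : SLeft t b →ₐ[k] L, ∀ y, ψ (SLeft.mk t b y) = φ y :=
  exists_algHom_of_subOneIdeal φ hφ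

/-- The quotient map `H(f) → S(f)`. -/
noncomputable def SRight.mk : HRight t b →ₐc[k] SRight t b :=
  haveI := subOneIdeal_isHopfIdeal (HRight.isGroupLikeElem_D t b)
  Bialgebra.Quotient.mkBialgHom (subOneIdeal (HRight.D t b))

theorem SRight.mk_surjective : Function.Surjective (SRight.mk t b) := Ideal.Quotient.mk_surjective

theorem SRight.mk_D : SRight.mk t b (HRight.D t b) = 1 := mk_subOneIdeal _

theorem SRight.mk_Dinv : SRight.mk t b (HRight.Dinv t b) = 1 := by
  have := congrArg (SRight.mk t b) (HRight.relations t b).mul_inv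
  rwa [map_mul, mk_D, one_mul, map_one] at this

theorem SRight.isComatrix_A : IsComatrix k (SRight.A t b) :=
  (HRight.isComatrix_A t b).map (SRight.mk t b)

theorem SRight.rel (J : Fin (r + 1) → Fin n) :
    ∑ I, t.coeff b I • prodPow (SRight.A t b) J I = t.coeff b J • 1 := by
  have := congrArg (SRight.mk t b) ((HRight.relations t b).rel J)
  simp only [map_sum, map_smul, map_prodPow, SRight.mk_Dinv] at this
  exact this

theorem SRight.exists_algHom {L : Type w'} [Ring L] [Algebra k L] (φ : HRight t b →ₐ[k] L)
    (hφ : φ (HRight.D t b) = 1) : ∃ ψ : SRight t b →ₐ[k] L, ∀ y, ψ (SRight.mk t b y) = φ y :=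
  exists_algHom_of_subOneIdeal φ hφ

variable {t b}

theorem SLeft.algHom_ext_A (hc : ∃ J, t.coeff b J ≠ 0) (φ ψ : SLeft t b →ₐ[k] K)
    (hA : ∀ i j, φ (SLeft.A t b i j) = ψ (SLeft.A t b i j)) : φ = ψ := by
  have := HLeft.algHom_ext_A hc (φ.comp (SLeft.mk t b : HLeft t b →ₐ[k] SLeft t b))
    (ψ.comp (SLeft.mk t b : HLeft t b →ₐ[k] SLeft t b)) hA
  refine AlgHom.ext fun y => ?_
  obtain ⟨y, rfl⟩ := SLeft.mk_surjective t b y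
  exact DFunLike.congr_fun this y

theorem SRight.algHom_ext_A (hc : ∃ J, t.coeff b J ≠ 0) (φ ψ : SRight t b →ₐ[k] K)
    (hA : ∀ i j, φ (SRight.A t b i j) = ψ (SRight.A t b i j)) : φ = ψ := by
  have := HRight.algHom_ext_A hc (φ.comp (SRight.mk t b : HRight t b →ₐ[k] SRight t b))
    (ψ.comp (SRight.mk t b : HRight t b →ₐ[k] SRight t b)) hA
  refine AlgHom.ext fun y => ?_
  obtain ⟨y, rfl⟩ := SRight.mk_surjective t b y
  exact DFunLike.congr_fun this y

end Inverse

/-! ### The universal coactions -/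

section Universality

open SuperpotentialAlgebra

variable {k : Type u} [Field k] {n : ℕ} {Z : Type v} [AddCommGroup Z] [Module k Z] {r : ℕ}
  {t : PreregularForm k Z r} {b : Module.Basis (Fin n) k Z} {N d : ℕ} {hN : 2 ≤ N}

theorem exists_HLeft_isQuantumGL (hNm : N ≤ r + 1) (hd : koszulDegree N d = r + 1)
    (hA : IsASRegular (degreePart (t.coeff b) N) (augmentation (t.coeff b) N hN) d)
    (hK : IsNKoszul (degreePart (t.coeff b) N) (augmentation (t.coeff b) N hN) N) :
    ∃ ρ : LeftCoaction k (HLeft t b) (degreePart (t.coeff b) N),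
      (∀ i, ρ.toAlgHom (x (t.coeff b) N i) =
        ∑ j, HLeft.A t b i j ⊗ₜ[k] x (t.coeff b) N j) ∧ ρ.IsQuantumGL.{u, u, w} := by
  have hc := coeff_ne_zero_of_isASRegular hd hA
  obtain ⟨W, hW⟩ := (HLeft.relations t b).exists_transpose_inverse
  obtain ⟨δ, hδ⟩ := exists_coaction hNm (HLeft.relations t b).rel hW
  obtain ⟨ρ, rfl⟩ := (HLeft.isComatrix_A t b).exists_leftCoaction hδ
  refine ⟨ρ, hδ, fun L _ _ ρL => ?_⟩
  obtain ⟨α, hα, hρL⟩ := ρL.exists_matrix hN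
  obtain ⟨g, hg⟩ := exists_factor hNm hd hA hK hρL
  simp only [LeftCoaction.map_eq_iff hN hδ hρL]
  -- The extension lemma serves three targets: L for uniqueness, L ⊗ L and k for compatibility with
  -- comultiplication and counit.
  exact (HLeft.isComatrix_A t b).existsUnique_bialgHom hα
    (HLeft.lift (hα.leftRelations hc hg)) (HLeft.lift_A _) (HLeft.algHom_ext_A hc)
    (HLeft.algHom_ext_A hc) (HLeft.algHom_ext_A hc)

theorem exists_SLeft_isQuantumSL (hNm : N ≤ r + 1) (hd : koszulDegree N d = r + 1)
    (hA : IsASRegular (degreePart (t.coeff b) N) (augmentation (t.coeff b) N hN) d)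
    (hK : IsNKoszul (degreePart (t.coeff b) N) (augmentation (t.coeff b) N hN) N) :
    ∃ ρ : LeftCoaction k (SLeft t b) (degreePart (t.coeff b) N),
      (∀ i, ρ.toAlgHom (x (t.coeff b) N i) =
        ∑ j, SLeft.A t b i j ⊗ₜ[k] x (t.coeff b) N j) ∧
      ρ.IsQuantumSL.{u, u, w} (augmentation (t.coeff b) N hN) d := by
  have hc := coeff_ne_zero_of_isASRegular hd hA
  obtain ⟨W, hW⟩ := (HLeft.relations t b).exists_transpose_inverse
  have hW' : W.map (SLeft.mk t b) * (SLeft.A t b).transpose = 1 := by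
    have := congrArg (fun M => M.map (SLeft.mk t b)) hW
    simp only [Matrix.map_mul, Matrix.map_one _ (map_zero (SLeft.mk t b)) (map_one _)] at this
    exact this
  obtain ⟨δ, hδ⟩ := exists_coaction hNm (SLeft.rel t b) hW'
  obtain ⟨ρ, rfl⟩ := (SLeft.isComatrix_A t b).exists_leftCoaction hδ
  refine ⟨ρ, hδ, ⟨IsGroupLikeElem.one, fun φ hφ => ?_⟩, fun L _ _ ρL hρ1 => ?_⟩
  · rw [ρ.bar_eq_coBar]
    exact coBar_top hNm hd hA hK hδ (SLeft.rel t b) φ hφ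
  obtain ⟨α, hα, hρL⟩ := ρL.exists_matrix hN
  obtain ⟨g, hg⟩ := exists_factor hNm hd hA hK hρL
  -- On the superpotential cycle the detecting cocycle has value 1, so the codeterminant condition
  -- there reads g = 1.
  obtain rfl : g = 1 := by
    obtain ⟨φ, h1, h2, h3, -⟩ := exists_top_cocycle hNm hd hA hK
    have h4 := hρ1.2 φ h1 _ h2
    rw [ρL.bar_eq_coBar, coBar_top hNm hd hA hK hρL hg φ h1 _ h2, h3] at h4
    simpa using h4
  simp only [LeftCoaction.map_eq_iff hN hδ hρL]
  obtain ⟨ψ, hψ⟩ := SLeft.exists_algHom t b (HLeft.lift (hα.leftRelations hc hg)) (HLeft.lift_D _)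
  exact (SLeft.isComatrix_A t b).existsUnique_bialgHom hα ψ
    (fun i j => (hψ _).trans (HLeft.lift_A _ i j)) (SLeft.algHom_ext_A hc)
    (SLeft.algHom_ext_A hc) (SLeft.algHom_ext_A hc)

theorem RightCoaction.comm_comp_apply_x {K : Type w} [Ring K] [HopfAlgebra k K]
    {α : Matrix (Fin n) (Fin n) K} {δ : SuperpotentialAlgebra (t.coeff b) N →ₐ[k]
      SuperpotentialAlgebra (t.coeff b) N ⊗[k] K}
    (hδ : ∀ j, δ (x (t.coeff b) N j) = ∑ i, x (t.coeff b) N i ⊗ₜ α i j) (i : Fin n) :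
    ((Algebra.TensorProduct.comm k (SuperpotentialAlgebra (t.coeff b) N) K).toAlgHom.comp δ)
      (x (t.coeff b) N i) = ∑ j, α.transpose i j ⊗ₜ x (t.coeff b) N j := by
  simp [hδ]

/-- With γ = αᵀ the transpose to be inverted is α itself, so the given β serves as W and no twist is
needed. -/
theorem exists_rightCoaction_apply_x (hNm : N ≤ r + 1) {K : Type w} [Ring K] [HopfAlgebra k K]
    {α β : Matrix (Fin n) (Fin n) K} {g : K} (hα : IsComatrix k α) (hβ : β * α = 1)
    (hg : ∀ J, ∑ I, t.coeff b I • prodPow α J I = t.coeff b J • g) :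
    ∃ ρ : RightCoaction k K (degreePart (t.coeff b) N), ∀ j, ρ.toAlgHom (x (t.coeff b) N j) =
      ∑ i, x (t.coeff b) N i ⊗ₜ α i j := by
  obtain ⟨δ, hδ⟩ := exists_coaction hNm (c := t.coeff b) (γ := α.transpose) (W := β) hg hβ
  have h : ∀ j, ((Algebra.TensorProduct.comm k K (SuperpotentialAlgebra (t.coeff b) N)).toAlgHom.comp
      δ) (x (t.coeff b) N j) = ∑ i, x (t.coeff b) N i ⊗ₜ α i j := by
    intro j
    simp [hδ]
  obtain ⟨ρ, hρ⟩ := hα.exists_rightCoaction h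
  exact ⟨ρ, fun j => by rw [hρ, h]⟩

theorem RightCoaction.rTensor_bar_top (hNm : N ≤ r + 1) (hd : koszulDegree N d = r + 1)
    (hA : IsASRegular (degreePart (t.coeff b) N) (augmentation (t.coeff b) N hN) d)
    (hK : IsNKoszul (degreePart (t.coeff b) N) (augmentation (t.coeff b) N hN) N)
    {K : Type w} [Ring K] [HopfAlgebra k K] {α : Matrix (Fin n) (Fin n) K} {g : K}
    {ρ : RightCoaction k K (degreePart (t.coeff b) N)}
    (hρ : ∀ j, ρ.toAlgHom (x (t.coeff b) N j) = ∑ i, x (t.coeff b) N i ⊗ₜ α i j)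
    (hg : ∀ J, ∑ I, t.coeff b I • prodPow α J I = t.coeff b J • g)
    (φ : PreregularQuantumGroup.bar k (SuperpotentialAlgebra (t.coeff b) N) d →ₗ[k] k)
    (hφ : ∀ z ∈ barBoundaries (augmentation (t.coeff b) N hN) d, φ z = 0) :
    ∀ z ∈ barCycles (augmentation (t.coeff b) N hN) d,
      TensorProduct.lid k K (φ.rTensor K (ρ.bar d z)) = φ z • g := by
  intro z hz
  rw [← coBar_top hNm hd hA hK (comm_comp_apply_x hρ) hg φ hφ z hz, ← ρ.comm_bar]
  induction ρ.bar d z with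
  | zero => simp
  | add s s' hs hs' => simp only [map_add, hs, hs']
  | tmul y κ => simp

theorem exists_HRight_isQuantumGL (hNm : N ≤ r + 1) (hd : koszulDegree N d = r + 1)
    (hA : IsASRegular (degreePart (t.coeff b) N) (augmentation (t.coeff b) N hN) d)
    (hK : IsNKoszul (degreePart (t.coeff b) N) (augmentation (t.coeff b) N hN) N) :
    ∃ ρ : RightCoaction k (HRight t b) (degreePart (t.coeff b) N),
      (∀ j, ρ.toAlgHom (x (t.coeff b) N j) =
        ∑ i, x (t.coeff b) N i ⊗ₜ[k] HRight.A t b i j) ∧ ρ.IsQuantumGL.{u, u, w} := by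
  have hc := coeff_ne_zero_of_isASRegular hd hA
  obtain ⟨ρ, hρ⟩ := exists_rightCoaction_apply_x hNm (HRight.isComatrix_A t b)
    (HRight.relations t b).mul_eq_one (HRight.relations t b).rel
  refine ⟨ρ, hρ, fun L _ _ ρL => ?_⟩
  obtain ⟨α, hα, hρL⟩ := ρL.exists_matrix hN
  obtain ⟨g, hg⟩ := exists_factor hNm hd hA hK (RightCoaction.comm_comp_apply_x hρL)
  simp only [RightCoaction.map_eq_iff hN hρ hρL]
  exact (HRight.isComatrix_A t b).existsUnique_bialgHom hα
    (HRight.lift (hα.rightRelations hc hg)) (HRight.lift_A _) (HRight.algHom_ext_A hc)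
    (HRight.algHom_ext_A hc) (HRight.algHom_ext_A hc)

theorem exists_SRight_isQuantumSL (hNm : N ≤ r + 1) (hd : koszulDegree N d = r + 1)
    (hA : IsASRegular (degreePart (t.coeff b) N) (augmentation (t.coeff b) N hN) d)
    (hK : IsNKoszul (degreePart (t.coeff b) N) (augmentation (t.coeff b) N hN) N) :
    ∃ ρ : RightCoaction k (SRight t b) (degreePart (t.coeff b) N),
      (∀ j, ρ.toAlgHom (x (t.coeff b) N j) =
        ∑ i, x (t.coeff b) N i ⊗ₜ[k] SRight.A t b i j) ∧
      ρ.IsQuantumSL.{u, u, w} (augmentation (t.coeff b) N hN) d := by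
  have hc := coeff_ne_zero_of_isASRegular hd hA
  obtain ⟨ρ, hρ⟩ := exists_rightCoaction_apply_x hNm (SRight.isComatrix_A t b)
    (SRight.isComatrix_A t b).antipode_mul (SRight.rel t b)
  refine ⟨ρ, hρ, ⟨IsGroupLikeElem.one, fun φ hφ => ?_⟩, fun L _ _ ρL hρ1 => ?_⟩
  · rw [HopfAlgebra.antipode_one]
    exact RightCoaction.rTensor_bar_top hNm hd hA hK hρ (SRight.rel t b) φ hφ
  obtain ⟨α, hα, hρL⟩ := ρL.exists_matrix hN
  obtain ⟨g, hg⟩ := exists_factor hNm hd hA hK (RightCoaction.comm_comp_apply_x hρL)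
  obtain rfl : g = 1 := by
    obtain ⟨φ, h1, h2, h3, -⟩ := exists_top_cocycle hNm hd hA hK
    have h4 := hρ1.2 φ h1 _ h2
    rw [RightCoaction.rTensor_bar_top hNm hd hA hK hρL hg φ h1 _ h2, h3,
      HopfAlgebra.antipode_one] at h4
    simpa using h4
  simp only [RightCoaction.map_eq_iff hN hρ hρL]
  -- D is sent to S(g), which is S(1) = 1, so the map factors through S(f).
  obtain ⟨ψ, hψ⟩ := SRight.exists_algHom t b (HRight.lift (hα.rightRelations hc hg))
    ((HRight.lift_D _).trans HopfAlgebra.antipode_one)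
  exact (SRight.isComatrix_A t b).existsUnique_bialgHom hα ψ
    (fun i j => (hψ _).trans (HRight.lift_A _ i j)) (SRight.algHom_ext_A hc)
    (SRight.algHom_ext_A hc) (SRight.algHom_ext_A hc)

end Universality

end PreregularQuantumGroup

theorem mainTheorem2 {k : Type u} [Field k] {V : Type v} [AddCommGroup V] [Module k V] {n : ℕ}
    (b : Module.Basis (Fin n) k V) (r N d : ℕ) (hN : 2 ≤ N) (hNm : N ≤ r + 1)
    (hd : koszulDegree N d = r + 1) :
    (∀ e : PreregularForm k V r,
      IsASRegular (SuperpotentialAlgebra.degreePart (e.coeff b) N)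
        (SuperpotentialAlgebra.augmentation (e.coeff b) N hN) d →
      IsNKoszul (SuperpotentialAlgebra.degreePart (e.coeff b) N)
        (SuperpotentialAlgebra.augmentation (e.coeff b) N hN) N →
      (∃ ρ : LeftCoaction k (HLeft e b) (SuperpotentialAlgebra.degreePart (e.coeff b) N),
        (∀ i, ρ.toAlgHom (SuperpotentialAlgebra.x (e.coeff b) N i) =
          ∑ j, HLeft.A e b i j ⊗ₜ[k] SuperpotentialAlgebra.x (e.coeff b) N j) ∧
        ρ.IsQuantumGL.{u, u, w}) ∧
      (∃ ρ : LeftCoaction k (SLeft e b) (SuperpotentialAlgebra.degreePart (e.coeff b) N),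
        (∀ i, ρ.toAlgHom (SuperpotentialAlgebra.x (e.coeff b) N i) =
          ∑ j, SLeft.A e b i j ⊗ₜ[k] SuperpotentialAlgebra.x (e.coeff b) N j) ∧
        ρ.IsQuantumSL.{u, u, w} (SuperpotentialAlgebra.augmentation (e.coeff b) N hN) d)) ∧
    (∀ f : PreregularForm k (Module.Dual k V) r,
      IsASRegular (SuperpotentialAlgebra.degreePart (f.coeff b.dualBasis) N)
        (SuperpotentialAlgebra.augmentation (f.coeff b.dualBasis) N hN) d →
      IsNKoszul (SuperpotentialAlgebra.degreePart (f.coeff b.dualBasis) N)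
        (SuperpotentialAlgebra.augmentation (f.coeff b.dualBasis) N hN) N →
      (∃ ρ : RightCoaction k (HRight f b.dualBasis)
          (SuperpotentialAlgebra.degreePart (f.coeff b.dualBasis) N),
        (∀ j, ρ.toAlgHom (SuperpotentialAlgebra.x (f.coeff b.dualBasis) N j) =
          ∑ i, SuperpotentialAlgebra.x (f.coeff b.dualBasis) N i ⊗ₜ[k]
            HRight.A f b.dualBasis i j) ∧
        ρ.IsQuantumGL.{u, u, w}) ∧
      (∃ ρ : RightCoaction k (SRight f b.dualBasis)
          (SuperpotentialAlgebra.degreePart (f.coeff b.dualBasis) N),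
        (∀ j, ρ.toAlgHom (SuperpotentialAlgebra.x (f.coeff b.dualBasis) N j) =
          ∑ i, SuperpotentialAlgebra.x (f.coeff b.dualBasis) N i ⊗ₜ[k]
            SRight.A f b.dualBasis i j) ∧
        ρ.IsQuantumSL.{u, u, w}
          (SuperpotentialAlgebra.augmentation (f.coeff b.dualBasis) N hN) d)) :=
  ⟨fun _ hA hK => ⟨exists_HLeft_isQuantumGL hNm hd hA hK, exists_SLeft_isQuantumSL hNm hd hA hK⟩,
    fun _ hA hK => ⟨exists_HRight_isQuantumGL hNm hd hA hK, exists_SRight_isQuantumSL hNm hd hA hK⟩⟩
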